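/- The path avoiding forbidden pairs (PAFP) problem with well-parenthesized forbidden pairs is the following. Given are a directed acyclic graph $G=(V,E)$ on $n$ vertices, a topological ordering $\prec$ of its vertices, two vertices $s,t\in V$, and a set $F$ of forbidden pairs $\{u,v\}$, $u\prec v$, no two of which are halving: there are no $\{u,v\},\{x,y\}\in F$ with $u\prec x\prec v\prec y$. The task is to find a directed path from $s$ to $t$ that contains at most one vertex of each forbidden pair, or to report that there is none. Time is counted on a word RAM: programs with unit-cost elementary instructions on words of $O(\log n)$ bits. The graph (with vertices numbered along $\prec$), the set $F$ and matrices are given as $0$/$1$ matrices. Corollary. Let $\omega>2$ be a real number such that two $n\times n$ boolean matrices can be multiplied in $O(n^\omega)$ time. Then the PAFP problem with well-parenthesized forbidden pairs can be solved in $O(n^\omega)$ time. -/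

import Mathlib

/-! ### The word RAM

Registers and memory cells are indexed by natural numbers and hold natural numbers.  Every
elementary instruction and every test costs one unit of time.  A word bound `W` limits the values:
an instruction that would produce a value that is not below `W` cannot be executed. -/

namespace WordRAM

/-- The arithmetic instructions (truncated subtraction, division rounded down). -/
inductive Op where
  | add
  | sub
  | mul
  | div

/-- The value of an arithmetic instruction. -/
def Op.eval : Op → ℕ → ℕ → ℕ
  | .add, a, b => a + b
  | .sub, a, b => a - b
  | .mul, a, b => a * b
  | .div, a, b => a / b

/-- Programs.  The arguments are register names, except the second one of `const`, which is a
numeral. -/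
inductive Prog where
  /-- do nothing -/
  | skip
  /-- `const r k`: put the number `k` into register `r` -/
  | const (r k : ℕ)
  /-- `arith o r a b`: put the result of `o` on registers `a`, `b` into register `r` -/
  | arith (o : Op) (r a b : ℕ)
  /-- `load r a`: put the memory cell whose address is in register `a` into register `r` -/
  | load (r a : ℕ)
  /-- `store a r`: put register `r` into the memory cell whose address is in register `a` -/
  | store (a r : ℕ)
  /-- run the first program, then the second one -/
  | seq (p q : Prog)
  /-- `ifLt a b p q`: if register `a` is less than register `b` run `p`, otherwise run `q` -/
  | ifLt (a b : ℕ) (p q : Prog)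
  /-- `whileLt a b p`: as long as register `a` is less than register `b`, run `p` -/
  | whileLt (a b : ℕ) (p : Prog)

/-- A configuration: the contents of the registers and of the memory. -/
structure State where
  reg : ℕ → ℕ
  mem : ℕ → ℕ

/-- Overwrite register `r`. -/
def State.setReg (s : State) (r v : ℕ) : State :=
  { s with reg := Function.update s.reg r v }

/-- Overwrite memory cell `a`. -/
def State.setMem (s : State) (a v : ℕ) : State :=
  { s with mem := Function.update s.mem a v }

/-- `Exec W p s t s'`: with word bound `W`, the program `p`, started in `s`, halts in `s'` after
exactly `t` steps. -/
inductive Exec (W : ℕ) : Prog → State → ℕ → State → Prop where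
  | skip (s : State) : Exec W .skip s 1 s
  | const (s : State) (r k : ℕ) (h : k < W) : Exec W (.const r k) s 1 (s.setReg r k)
  | arith (s : State) (o : Op) (r a b : ℕ) (h : o.eval (s.reg a) (s.reg b) < W) :
      Exec W (.arith o r a b) s 1 (s.setReg r (o.eval (s.reg a) (s.reg b)))
  | load (s : State) (r a : ℕ) : Exec W (.load r a) s 1 (s.setReg r (s.mem (s.reg a)))
  | store (s : State) (a r : ℕ) : Exec W (.store a r) s 1 (s.setMem (s.reg a) (s.reg r))
  | seq {p q : Prog} {s s₁ s₂ : State} {t₁ t₂ : ℕ}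
      (hp : Exec W p s t₁ s₁) (hq : Exec W q s₁ t₂ s₂) : Exec W (.seq p q) s (t₁ + t₂) s₂
  | ifLt_true {a b : ℕ} {p q : Prog} {s s₁ : State} {t : ℕ} (h : s.reg a < s.reg b)
      (hp : Exec W p s t s₁) : Exec W (.ifLt a b p q) s (t + 1) s₁
  | ifLt_false {a b : ℕ} {p q : Prog} {s s₁ : State} {t : ℕ} (h : ¬ s.reg a < s.reg b)
      (hq : Exec W q s t s₁) : Exec W (.ifLt a b p q) s (t + 1) s₁
  | whileLt_true {a b : ℕ} {p : Prog} {s s₁ s₂ : State} {t₁ t₂ : ℕ} (h : s.reg a < s.reg b)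
      (hp : Exec W p s t₁ s₁) (hw : Exec W (.whileLt a b p) s₁ t₂ s₂) :
      Exec W (.whileLt a b p) s (t₁ + t₂ + 1) s₂
  | whileLt_false {a b : ℕ} {p : Prog} {s : State} (h : ¬ s.reg a < s.reg b) :
      Exec W (.whileLt a b p) s 1 s

/-- The initial configuration: the input list stands in memory from address `0` on, and all
other memory cells and all registers are `0`. -/
def State.init (input : List ℕ) : State where
  reg := fun _ => 0
  mem := fun i => input.getD i 0

/-- The output list: register `0` holds its length, register `1` the address of its first
entry. -/
def State.output (s : State) : List ℕ :=
  (List.range (s.reg 0)).map fun i => s.mem (s.reg 1 + i)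

/-- A computational (search) problem: instances with their size parameter, their encoding as
input lists, and the correct outputs. -/
structure Problem where
  Inst : Type
  size : Inst → ℕ
  input : Inst → List ℕ
  Correct : Inst → List ℕ → Prop

/-- The problem is solved in `O(T n)` time, where `n` is the size parameter: one program halts on
every instance with a correct output, within a worst-case number of steps `f n` that is `O(T n)`,
and with words of `O(log n)` bits, that is, with values below a bound polynomial in `n`. -/
def Problem.SolvableInTime (Q : Problem) (T : ℕ → ℝ) : Prop :=
  ∃ (p : Prog) (c : ℕ) (f : ℕ → ℕ),
    (fun n => (f n : ℝ)) =O[Filter.atTop] T ∧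
    ∀ x : Q.Inst, ∃ (t : ℕ) (s' : State),
      Exec (c * (Q.size x + 1) ^ c) p (State.init (Q.input x)) t s' ∧
      t ≤ f (Q.size x) ∧
      Q.Correct x s'.output

/-- The row-major list of the entries of an `n × n` Boolean matrix as zeros and ones: entry
`(i, j)` stands at position `i * n + j`. -/
def encodeMatrix {n : ℕ} (A : Fin n → Fin n → Bool) : List ℕ :=
  List.ofFn fun k : Fin (n * n) => (A k.divNat k.modNat).toNat

/-- A pair of square Boolean matrices of the same size. -/
structure MatrixPair where
  n : ℕ
  A : Fin n → Fin n → Bool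
  B : Fin n → Fin n → Bool

/-- The Boolean matrix product: disjunction over `k` of the conjunctions of entries. -/
def boolMul {n : ℕ} (A B : Fin n → Fin n → Bool) : Fin n → Fin n → Bool :=
  fun i j => decide (∃ k, A i k = true ∧ B k j = true)

/-- Boolean matrix multiplication; the size parameter is the number `n` of rows. -/
def booleanMatrixMultiplication : Problem where
  Inst := MatrixPair
  size x := x.n
  input x := x.n :: (encodeMatrix x.A ++ encodeMatrix x.B)
  Correct x out := out = encodeMatrix (boolMul x.A x.B)

end WordRAM

/-! ### Paths avoiding forbidden pairs -/

namespace PAFP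

/-- A directed acyclic graph on the vertices `0, …, n - 1`, numbered along a topological
ordering, with two distinguished vertices and a set of forbidden pairs of vertices.  A forbidden
pair `{u, v}` is recorded as `forb u v = true` with `u < v`. -/
structure Instance where
  n : ℕ
  adj : Fin n → Fin n → Bool
  forb : Fin n → Fin n → Bool
  s : Fin n
  t : Fin n
  adj_lt : ∀ u v, adj u v = true → u < v
  forb_lt : ∀ u v, forb u v = true → u < v

/-- No two forbidden pairs `{u, v}`, `{x, y}` are halving, that is, `u < x < v < y`. -/
def Instance.WellParenthesized (I : Instance) : Prop :=
  ∀ u v x y, I.forb u v = true → I.forb x y = true → ¬ (u < x ∧ x < v ∧ v < y)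

/-- `l` is the list of vertices of a directed path from `s` to `t`. -/
def Instance.IsPath (I : Instance) (l : List (Fin I.n)) : Prop :=
  l.IsChain (fun u v => I.adj u v = true) ∧ l.head? = some I.s ∧ l.getLast? = some I.t

/-- `l` contains at most one vertex of each forbidden pair. -/
def Instance.Safe (I : Instance) (l : List (Fin I.n)) : Prop :=
  ∀ u v, I.forb u v = true → ¬ (u ∈ l ∧ v ∈ l)

/-- The problem of finding a safe path from `s` to `t` in an instance with well-parenthesized
forbidden pairs; the size parameter is the number of vertices.  The output is the list of vertices
of such a path, or the empty list if there is none. -/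
def wellParenthesizedPAFP : WordRAM.Problem where
  Inst := { I : Instance // I.WellParenthesized }
  size I := I.1.n
  input I := I.1.n :: (I.1.s : ℕ) :: (I.1.t : ℕ) ::
    (WordRAM.encodeMatrix I.1.adj ++ WordRAM.encodeMatrix I.1.forb)
  Correct I out :=
    (∃ l : List (Fin I.1.n), I.1.IsPath l ∧ I.1.Safe l ∧ out = l.map Fin.val) ∨
    ((¬ ∃ l : List (Fin I.1.n), I.1.IsPath l ∧ I.1.Safe l) ∧ out = [])

end PAFP

/-! Combinatorial core. Call a walk from `u` to `v` safe up to `θ` if the only forbidden pairs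
inside it are pairs `{a, v}` with `a < θ` (`SafeWalk`). For each vertex `v`, take as thresholds `v`
itself and then the partners of `v` to its left in decreasing order, and string all these (vertex,
threshold) positions together along the topological order (`Layout`). At the first position of `v`
every pair ending in `v` is tolerated, at the last one none is. Since no two pairs are halving,
there are at most `3n` positions (`PreLayout.card_le`).

Let `S a p` say that a walk leads from the vertex of `a`, taken at its last position, to position
`p`, safe up to its threshold `θ`. If the walk starts behind `θ`, then `S a p` is `S a (p - 1)`, as
no other partner lies between consecutive thresholds (`Layout.tabS_of_gt`). If it starts at `θ < v`,
there is none. If it starts before `θ`, some edge `w → z` jumps over `θ`, and both pieces beside the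
edge are entirely safe (`SafeWalk.split`). Conversely, two safe pieces can be joined at such an
edge: a pair `{a, b}` across it with `b ≠ v` would have `a < θ < b < v` and be halving with `{θ, v}`
(`SafeWalk.append`). So `S` is `D ∪ R·D`, where `R` restricts `S` to safe walks between last
positions and `D` consists of the walks whose first edge jumps over `θ`; apart from single edges,
`D` is a product `E·T` of edges with walks that start behind `θ` (`Layout.tabS_of_lt`).

Fast evaluation. The tables are filled by increasing distance `p - a`, so the two Boolean products
involve factors that are only partly known. Every triple `a < q < p` with both gaps at least 2 lies,
at some dyadic scale `b`, in three blocks whose two distances are at least 2 and of which the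
smaller is 2 or 3 (`exists_block`). If the larger block distance is `e`, that block product is
carried out as soon as all distances below `b(e + 1)` are known, which is in time for `p - a`. The
remaining terms `q = a + 1` and `q = p - 1` are added directly (`Acc.product`). At scale `b` there
are `O((N/b)²)` block products of cost `O(b^ω)`, which gives `N² b^(ω-2)`. Summed over the powers of
two up to `N` this is a geometric series because `ω > 2`, and the total is `O(N^ω)`
(`exists_mainTime_le`). A path is then read off from the tables in quadratic time, with a stack of
unfinished segments (`Partial`).

Machine model. The given multiplication program is a black box that expects its input at address 0
in an otherwise zero machine. It is confined to the odd registers and to a window of memory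
(`Exec.relocate`), and each call uses a new window of untouched cells. The algorithm itself is
written in a small language whose specification `Run` carries time bounds, and is compiled to the
word RAM by `Stmt.compile_exec`. -/

namespace WordRAM

/-! ### Running a program inside a window of memory -/

/-- A strict upper bound on the registers mentioned in a program. -/
def Prog.regBound : Prog → ℕ
  | .skip => 0
  | .const r _ => r + 1
  | .arith _ r a b => r + a + b + 1
  | .load r a => r + a + 1
  | .store a r => r + a + 1
  | .seq p q => p.regBound + q.regBound
  | .ifLt a b p q => a + b + 1 + p.regBound + q.regBound
  | .whileLt a b p => a + b + 1 + p.regBound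

/-- The register that holds the start of the unused part of the memory. -/
def regFresh : ℕ := 10

/-- A register for intermediate results. -/
def regTmp : ℕ := 12

/-- The program that works on the odd registers and on the memory from the address in
`regFresh` on. -/
def Prog.relocate : Prog → Prog
  | .skip => .skip
  | .const r k => .const (2 * r + 1) k
  | .arith o r a b => .arith o (2 * r + 1) (2 * a + 1) (2 * b + 1)
  | .load r a => .seq (.arith .add regTmp (2 * a + 1) regFresh) (.load (2 * r + 1) regTmp)
  | .store a r => .seq (.arith .add regTmp (2 * a + 1) regFresh) (.store regTmp (2 * r + 1))
  | .seq p q => .seq p.relocate q.relocate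
  | .ifLt a b p q => .ifLt (2 * a + 1) (2 * b + 1) p.relocate q.relocate
  | .whileLt a b p => .whileLt (2 * a + 1) (2 * b + 1) p.relocate

/-- `S` represents `s` in the odd registers and in `Z` memory cells from `F` on. -/
structure Relocated (m F Z : ℕ) (s S : State) : Prop where
  reg : ∀ r < m, S.reg (2 * r + 1) = s.reg r
  mem : ∀ i < Z, S.mem (F + i) = s.mem i
  fresh : S.reg regFresh = F

/-- `S` and `S'` agree outside the odd registers, the register `regTmp` and `Z` memory cells from
`F` on. -/
structure SameOutside (F Z : ℕ) (S S' : State) : Prop where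
  reg : ∀ r, r ≠ regTmp → r % 2 = 0 → S'.reg r = S.reg r
  mem : ∀ i, (i < F ∨ F + Z ≤ i) → S'.mem i = S.mem i

theorem SameOutside.trans {F Z : ℕ} {S₁ S₂ S₃ : State} (h : SameOutside F Z S₁ S₂)
    (h' : SameOutside F Z S₂ S₃) : SameOutside F Z S₁ S₃ :=
  ⟨fun r h₁ h₂ => (h'.reg r h₁ h₂).trans (h.reg r h₁ h₂),
    fun i hi => (h'.mem i hi).trans (h.mem i hi)⟩

/-- Values computed under the word bound `W` are below `W`, so if the starting values are below `V ≥
W`, all registers and cells stay below `V`. Hence every address used is below `V ≤ Z` and the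
relocated run never leaves its window of `Z` cells. The factor 2 pays for the address addition in
front of each load and store. -/
theorem Exec.relocate {W W' V m F Z : ℕ} (hV : W ≤ V) (hZ : V ≤ Z) (hW : F + Z ≤ W')
    {p : Prog} {s s' : State} {t : ℕ} (h : Exec W p s t s') (hm : p.regBound ≤ m)
    (hreg : ∀ r, s.reg r < V) (hmem : ∀ i, s.mem i < V) {S : State}
    (hS : Relocated m F Z s S) :
    (∀ r, s'.reg r < V) ∧ (∀ i, s'.mem i < V) ∧
    ∃ t' S', Exec W' p.relocate S t' S' ∧ t' ≤ 2 * t ∧ Relocated m F Z s' S' ∧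
      SameOutside F Z S S' := by
  have setReg_rel : ∀ {s S : State} (r v : ℕ), Relocated m F Z s S →
      Relocated m F Z (s.setReg r v) (S.setReg (2 * r + 1) v) := by
    intro s S r v h
    refine ⟨fun r' hr' => ?_, h.mem, ?_⟩
    · by_cases e : r' = r
      · subst e; simp [State.setReg]
      · have : 2 * r' + 1 ≠ 2 * r + 1 := by omega
        simp [State.setReg, Function.update_of_ne e, Function.update_of_ne this, h.reg r' hr']
    · have : regFresh ≠ 2 * r + 1 := by unfold regFresh; omega
      simp [State.setReg, Function.update_of_ne this, h.fresh]
  have setTmp_rel : ∀ {s S : State} (v : ℕ), Relocated m F Z s S →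
      Relocated m F Z s (S.setReg regTmp v) := by
    intro s S v h
    refine ⟨fun r' hr' => ?_, h.mem, ?_⟩
    · have : 2 * r' + 1 ≠ regTmp := by unfold regTmp; omega
      simp [State.setReg, Function.update_of_ne this, h.reg r' hr']
    · simp [State.setReg, regTmp, regFresh, ← h.fresh]
  have setReg_out : ∀ {S : State} (r v : ℕ), SameOutside F Z S (S.setReg (2 * r + 1) v) := by
    intro S r v
    refine ⟨fun r' _ hr' => ?_, fun _ _ => rfl⟩
    have : r' ≠ 2 * r + 1 := by omega
    simp [State.setReg, Function.update_of_ne this]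
  have setTmp_out : ∀ {S : State} (v : ℕ), SameOutside F Z S (S.setReg regTmp v) := by
    intro S v
    refine ⟨fun r' h _ => ?_, fun _ _ => rfl⟩
    simp [State.setReg, Function.update_of_ne h]
  have setReg_lt : ∀ {s : State} (r v : ℕ), (∀ r, s.reg r < V) → v < V →
      ∀ r', (s.setReg r v).reg r' < V := by
    intro s r v h hv r'
    by_cases e : r' = r
    · subst e; simpa [State.setReg] using hv
    · simpa [State.setReg, Function.update_of_ne e] using h r'
  have addr : ∀ {s S : State} (a : ℕ), a < m → (∀ r, s.reg r < V) → Relocated m F Z s S →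
      Exec W' (.arith .add regTmp (2 * a + 1) regFresh) S 1
        (S.setReg regTmp (s.reg a + F)) := by
    intro s S a ha hr h
    have := Exec.arith (W := W') S .add regTmp (2 * a + 1) regFresh (by
      have := hr a
      simp only [Op.eval, h.reg a ha, h.fresh]; omega)
    simpa only [Op.eval, h.reg a ha, h.fresh] using this
  have tmp_val : ∀ (S : State) (v : ℕ), (S.setReg regTmp v).reg regTmp = v := by
    intro S v; simp [State.setReg]
  have tmp_odd : ∀ (S : State) (v r : ℕ), (S.setReg regTmp v).reg (2 * r + 1) =
      S.reg (2 * r + 1) := by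
    intro S v r
    have : 2 * r + 1 ≠ regTmp := by unfold regTmp; omega
    simp [State.setReg, Function.update_of_ne this]
  induction h generalizing S with
  | skip s => exact ⟨hreg, hmem, 1, S, .skip S, by omega, hS, ⟨fun _ _ _ => rfl, fun _ _ => rfl⟩⟩
  | const s r k h =>
    refine ⟨setReg_lt r k hreg (by omega), hmem, 1, _, .const S (2 * r + 1) k (by omega),
      by omega, setReg_rel r k hS, setReg_out r k⟩
  | arith s o r a b h =>
    simp only [Prog.regBound] at hm
    have e₁ := hS.reg a (by omega)
    have e₂ := hS.reg b (by omega)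
    refine ⟨setReg_lt r _ hreg (by omega), hmem, 1, _,
      .arith S o (2 * r + 1) (2 * a + 1) (2 * b + 1) (by rw [e₁, e₂]; omega),
      by omega, ?_, setReg_out r _⟩
    rw [e₁, e₂]; exact setReg_rel r _ hS
  | load s r a =>
    simp only [Prog.regBound] at hm
    refine ⟨setReg_lt r _ hreg (hmem _), hmem, 1 + 1, _,
      .seq (addr a (by omega) hreg hS) (.load _ _ _), by omega, ?_,
      (setTmp_out _).trans (setReg_out r _)⟩
    have : (S.setReg regTmp (s.reg a + F)).mem (s.reg a + F) = s.mem (s.reg a) := by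
      rw [← hS.mem (s.reg a) (lt_of_lt_of_le (hreg a) hZ), add_comm]; rfl
    rw [tmp_val, this]
    exact setReg_rel r _ (setTmp_rel _ hS)
  | store s a r =>
    simp only [Prog.regBound] at hm
    refine ⟨hreg, fun i => ?_, 1 + 1, _,
      .seq (addr a (by omega) hreg hS) (.store _ _ _), by omega, ?_, ?_⟩
    · by_cases e : i = s.reg a
      · subst e; simpa [State.setMem] using hreg r
      · simpa [State.setMem, Function.update_of_ne e] using hmem i
    · rw [tmp_val, tmp_odd, hS.reg r (by omega)]
      have h' := setTmp_rel (s.reg a + F) hS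
      refine ⟨h'.reg, fun i hi => ?_, h'.fresh⟩
      by_cases e : i = s.reg a
      · subst e; simp [State.setMem, add_comm]
      · have : F + i ≠ s.reg a + F := by omega
        simpa [State.setMem, State.setReg, Function.update_of_ne e, Function.update_of_ne this]
          using hS.mem i hi
    · refine (setTmp_out (s.reg a + F)).trans ⟨fun _ _ _ => rfl, fun i hi => ?_⟩
      have := hreg a
      have : i ≠ s.reg a + F := by omega
      rw [tmp_val]
      simp [State.setMem, Function.update_of_ne this]
  | seq _ _ ih₁ ih₂ =>
    simp only [Prog.regBound] at hm
    obtain ⟨a₁, b₁, t₁, S₁, x₁, l₁, r₁, o₁⟩ := ih₁ (by omega) hreg hmem hS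
    obtain ⟨a₂, b₂, t₂, S₂, x₂, l₂, r₂, o₂⟩ := ih₂ (by omega) a₁ b₁ r₁
    exact ⟨a₂, b₂, _, S₂, .seq x₁ x₂, by omega, r₂, o₁.trans o₂⟩
  | ifLt_true h _ ih =>
    simp only [Prog.regBound] at hm
    obtain ⟨a₁, b₁, t₁, S₁, x₁, l₁, r₁, o₁⟩ := ih (by omega) hreg hmem hS
    exact ⟨a₁, b₁, _, S₁, .ifLt_true (by
      rwa [hS.reg _ (by omega), hS.reg _ (by omega)]) x₁, by omega, r₁, o₁⟩
  | ifLt_false h _ ih =>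
    simp only [Prog.regBound] at hm
    obtain ⟨a₁, b₁, t₁, S₁, x₁, l₁, r₁, o₁⟩ := ih (by omega) hreg hmem hS
    exact ⟨a₁, b₁, _, S₁, .ifLt_false (by
      rwa [hS.reg _ (by omega), hS.reg _ (by omega)]) x₁, by omega, r₁, o₁⟩
  | whileLt_true h _ _ ih₁ ih₂ =>
    have hm' := hm
    simp only [Prog.regBound] at hm
    obtain ⟨a₁, b₁, t₁, S₁, x₁, l₁, r₁, o₁⟩ := ih₁ (by omega) hreg hmem hS
    obtain ⟨a₂, b₂, t₂, S₂, x₂, l₂, r₂, o₂⟩ := ih₂ hm' a₁ b₁ r₁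
    exact ⟨a₂, b₂, _, S₂, .whileLt_true (by
      rwa [hS.reg _ (by omega), hS.reg _ (by omega)]) x₁ x₂, by omega, r₂, o₁.trans o₂⟩
  | whileLt_false h =>
    simp only [Prog.regBound] at hm
    exact ⟨hreg, hmem, 1, S, .whileLt_false (by
      rwa [hS.reg _ (by omega), hS.reg _ (by omega)]), by omega, hS,
      ⟨fun _ _ _ => rfl, fun _ _ => rfl⟩⟩

/-- Put zeros into the first `m` odd registers. -/
def clearOdd : ℕ → Prog
  | 0 => .skip
  | m + 1 => .seq (clearOdd m) (.const (2 * m + 1) 0)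

theorem clearOdd_exec {W : ℕ} (hW : 0 < W) (m : ℕ) (S : State) :
    ∃ S', Exec W (clearOdd m) S (m + 1) S' ∧ S'.mem = S.mem ∧
      (∀ r < m, S'.reg (2 * r + 1) = 0) ∧ ∀ r, r % 2 = 0 → S'.reg r = S.reg r := by
  induction m with
  | zero => exact ⟨S, .skip S, rfl, by simp, fun _ _ => rfl⟩
  | succ m ih =>
    obtain ⟨S', h, hm, h0, hr⟩ := ih
    refine ⟨_, .seq h (.const S' _ 0 hW), hm, fun r hrm => ?_, fun r hr2 => ?_⟩
    · by_cases e : r = m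
      · subst e; simp [State.setReg]
      · have : 2 * r + 1 ≠ 2 * m + 1 := by omega
        simp [State.setReg, Function.update_of_ne this, h0 r (by omega)]
    · have : r ≠ 2 * m + 1 := by omega
      simp [State.setReg, Function.update_of_ne this, hr r hr2]

theorem encodeMatrix_length {n : ℕ} (A : Fin n → Fin n → Bool) :
    (encodeMatrix A).length = n * n := by
  simp [encodeMatrix]

theorem encodeMatrix_le_one {n : ℕ} (A : Fin n → Fin n → Bool) :
    ∀ x ∈ encodeMatrix A, x ≤ 1 := by
  intro x hx
  simp only [encodeMatrix, List.mem_ofFn] at hx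
  obtain ⟨k, rfl⟩ := hx
  exact Bool.toNat_le _

theorem encodeMatrix_getD {n : ℕ} (A : Fin n → Fin n → Bool) {i j : ℕ} (hi : i < n) (hj : j < n) :
    (encodeMatrix A).getD (i * n + j) 0 = (A ⟨i, hi⟩ ⟨j, hj⟩).toNat := by
  have h : i * n + j < n * n := by nlinarith
  have e₁ : (i * n + j) / n = i := by
    rw [mul_comm, Nat.mul_add_div (by omega), Nat.div_eq_of_lt hj, add_zero]
  have e₂ : (i * n + j) % n = j := by
    rw [mul_comm, Nat.mul_add_mod, Nat.mod_eq_of_lt hj]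
  rw [List.getD_eq_getElem _ _ (by simpa [encodeMatrix] using h)]
  simp only [encodeMatrix, List.getElem_ofFn]
  congr 2
  · apply Fin.ext; simpa [Fin.divNat] using e₁
  · apply Fin.ext; simpa [Fin.modNat] using e₂

/-- Correctness of a relocated program for Boolean matrix multiplication. -/
theorem relocate_mul {p : Prog} {W W' m F Z b t : ℕ} {A B : Fin b → Fin b → Bool} {s' : State}
    (h : Exec W p (State.init (b :: (encodeMatrix A ++ encodeMatrix B))) t s')
    (hout : s'.output = encodeMatrix (boolMul A B)) (hm : p.regBound + 2 ≤ m)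
    (hZ : W + b + 2 + b * b ≤ Z) (hW : F + Z ≤ W') {S : State} (hF : S.reg regFresh = F)
    (hS : ∀ i < Z, S.mem (F + i) = (b :: (encodeMatrix A ++ encodeMatrix B)).getD i 0) :
    ∃ t' S', Exec W' (.seq (clearOdd m) p.relocate) S t' S' ∧ t' ≤ 2 * t + m + 1 ∧
      SameOutside F Z S S' ∧ S'.reg 3 + b * b < Z ∧
      ∀ i < b * b, S'.mem (F + (S'.reg 3 + i)) = (encodeMatrix (boolMul A B)).getD i 0 := by
  obtain ⟨S₁, x₁, m₁, z₁, r₁⟩ := clearOdd_exec (W := W') (by omega) m S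
  have hrel : Relocated m F Z (State.init (b :: (encodeMatrix A ++ encodeMatrix B))) S₁ :=
    ⟨fun r hr => z₁ r hr, fun i hi => by rw [m₁, hS i hi]; rfl,
      by rw [r₁ _ (by simp [regFresh]), hF]⟩
  -- The input need not respect the word bound: `b` and the entries 0, 1 may be at least `W`. The
  -- bound for the relocation is therefore `V = W + b + 2`.
  have hmem : ∀ i, (State.init (b :: (encodeMatrix A ++ encodeMatrix B))).mem i < W + b + 2 := by
    intro i
    simp only [State.init, List.getD_eq_getElem?_getD]
    rcases hx : (b :: (encodeMatrix A ++ encodeMatrix B))[i]? with _ | x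
    · simp
    · have hx' := List.mem_of_getElem? hx
      simp only [List.mem_cons, List.mem_append] at hx'
      rcases hx' with rfl | hx' | hx'
      · simp; omega
      · have := encodeMatrix_le_one _ _ hx'; simp; omega
      · have := encodeMatrix_le_one _ _ hx'; simp; omega
  obtain ⟨a, -, t', S', x, l, rel, out⟩ := h.relocate (V := W + b + 2) (W' := W') (m := m) (F := F)
    (Z := Z) (by omega) (by omega) hW (by omega) (fun _ => by simp [State.init]) hmem hrel
  have hlen : s'.reg 0 = b * b := by
    have := congrArg List.length hout
    simpa [State.output, encodeMatrix_length] using this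
  -- Register 1, with the address of the output, has become register `2 * 1 + 1`.
  have e3 : S'.reg 3 = s'.reg 1 := rel.reg 1 (by omega)
  have h3 := a 1
  refine ⟨_, S', .seq x₁ x, by omega, ?_, by omega, fun i hi => ?_⟩
  · refine ⟨fun r h₁ h₂ => ?_, fun i hi => ?_⟩
    · rw [out.reg r h₁ h₂, r₁ r h₂]
    · rw [out.mem i hi, m₁]
  · rw [rel.mem _ (by omega), ← hout, e3]
    simp [State.output, List.getD_eq_getElem?_getD, hlen, hi]

end WordRAM

namespace WordRAM

/-! ### A language with arrays and scoped variables -/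

/-- The input, and the sizes of the parts of the memory: `K` square arrays of dimension `M`, a
scratch array of length `Z`, which also bounds all numbers, and an input of length `H`. -/
structure Ctx where
  inp : ℕ → ℕ
  M : ℕ
  Z : ℕ
  H : ℕ
  K : ℕ

/-- The contents of the arrays. -/
structure Store where
  arr : ℕ → ℕ → ℕ → ℕ
  scr : ℕ → ℕ

inductive Expr where
  | num (k : ℕ)
  | var (i : ℕ)
  | op (o : Op) (a b : Expr)
  | get (k : ℕ) (i j : Expr)
  | inp (i : Expr)
  | scr (i : Expr)

/-- The value of a variable. -/
def lookup : List ℕ → ℕ → ℕ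
  | [], _ => 0
  | x :: _, 0 => x
  | _ :: l, i + 1 => lookup l i

theorem lookup_append_left (l l' : List ℕ) {i : ℕ} (hi : i < l.length) :
    lookup (l ++ l') i = lookup l i := by
  induction l generalizing i with
  | nil => simp at hi
  | cons x l ih =>
    cases i with
    | zero => rfl
    | succ i => exact ih (by simpa using hi)

theorem lookup_append_right (l l' : List ℕ) (i : ℕ) :
    lookup (l ++ l') (l.length + i) = lookup l' i := by
  induction l with
  | nil => simp
  | cons x l ih => rw [List.length_cons, Nat.add_right_comm]; exact ih

def Expr.eval (C : Ctx) (env : List ℕ) (st : Store) : Expr → ℕ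
  | .num k => k
  | .var i => lookup env i
  | .op o a b => o.eval (a.eval C env st) (b.eval C env st)
  | .get k i j => st.arr k (i.eval C env st) (j.eval C env st)
  | .inp i => C.inp (i.eval C env st)
  | .scr i => st.scr (i.eval C env st)

/-- All variables are bound and all array accesses are within the bounds. -/
def Expr.Ok (C : Ctx) (env : List ℕ) (st : Store) : Expr → Prop
  | .num k => k < C.Z
  | .var i => i < env.length
  | .op _ a b => a.Ok C env st ∧ b.Ok C env st
  | .get k i j => i.Ok C env st ∧ j.Ok C env st ∧ k < C.K ∧ i.eval C env st < C.M ∧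
      j.eval C env st < C.M
  | .inp i => i.Ok C env st ∧ i.eval C env st < C.H
  | .scr i => i.Ok C env st ∧ i.eval C env st < C.Z ∧ st.scr (i.eval C env st) < C.Z

/-- Serves as an exponent: an expression that respects all bounds has a value below `C.Z ^ size`. -/
def Expr.size : Expr → ℕ
  | .num _ => 1
  | .var _ => 1
  | .op _ a b => a.size + b.size
  | .get _ i j => i.size + j.size
  | .inp i => i.size
  | .scr i => i.size

/-- Variables are numbered by nesting depth from the outside, so the numbers used in a statement
depend on where it stands: `bind` adds one variable, `loop` adds two (the counter and the bound,
evaluated once), and `call` adds one (the position of the product). -/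
inductive Stmt where
  | skip
  | put (k : ℕ) (i j e : Expr)
  | sput (i e : Expr)
  | seq (p q : Stmt)
  | ite (a b : Expr) (p q : Stmt)
  | bind (e : Expr) (p : Stmt)
  | loop (e : Expr) (p : Stmt)
  | call (p : Stmt)

def Store.put (st : Store) (k i j v : ℕ) : Store :=
  { st with arr := Function.update st.arr k (Function.update (st.arr k) i
      (Function.update (st.arr k i) j v)) }

theorem Store.put_arr (st : Store) (k i j v k' i' j' : ℕ) :
    (st.put k i j v).arr k' i' j' =
      if k' = k ∧ i' = i ∧ j' = j then v else st.arr k' i' j' := by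
  unfold Store.put
  by_cases hk : k' = k
  · subst hk
    by_cases hi : i' = i
    · subst hi
      by_cases hj : j' = j
      · subst hj; simp
      · simp [hj]
    · simp [hi]
  · simp [hk]

def Store.sput (st : Store) (i v : ℕ) : Store :=
  { st with scr := Function.update st.scr i v }

/-- `Run C f p env st T Q`: the statement `p`, started in the store `st` with values `env` of the
variables, respects all bounds and leads within `T` steps to a store that satisfies `Q`.  The
statement `call` multiplies two matrices in the scratch array in time `f`; its body, in which a
variable is bound to the position of the product, is followed by clearing the scratch array. -/
def Run (C : Ctx) (f : ℕ → ℕ) : Stmt → List ℕ → Store → ℕ → (Store → Prop) → Prop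
  | .skip, _, st, T, Q => 1 ≤ T ∧ Q st
  | .put k i j e, env, st, T, Q => 1 ≤ T ∧ (k < C.K ∧ i.Ok C env st ∧ j.Ok C env st ∧
      e.Ok C env st ∧ i.eval C env st < C.M ∧ j.eval C env st < C.M ∧ e.eval C env st < C.Z) ∧
      Q (st.put k (i.eval C env st) (j.eval C env st) (e.eval C env st))
  | .sput i e, env, st, T, Q => 1 ≤ T ∧ (i.Ok C env st ∧ e.Ok C env st ∧
      i.eval C env st < C.Z ∧ e.eval C env st < C.Z) ∧
      Q (st.sput (i.eval C env st) (e.eval C env st))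
  | .seq p q, env, st, T, Q => ∃ T₁ T₂, T₁ + T₂ ≤ T ∧
      Run C f p env st T₁ fun st' => Run C f q env st' T₂ Q
  | .ite a b p q, env, st, T, Q => (a.Ok C env st ∧ b.Ok C env st) ∧ ∃ T₁, T₁ + 1 ≤ T ∧
      (a.eval C env st < b.eval C env st → Run C f p env st T₁ Q) ∧
      (¬ a.eval C env st < b.eval C env st → Run C f q env st T₁ Q)
  | .bind e p, env, st, T, Q => (e.Ok C env st ∧ e.eval C env st < C.Z) ∧ ∃ T₁, T₁ + 1 ≤ T ∧
      Run C f p (env ++ [e.eval C env st]) st T₁ Q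
  | .loop e p, env, st, T, Q => (e.Ok C env st ∧ e.eval C env st < C.Z) ∧
      ∃ (I : ℕ → Store → Prop) (T₁ : ℕ → ℕ),
        1 + ∑ i ∈ Finset.range (e.eval C env st), (T₁ i + 1) ≤ T ∧ I 0 st ∧
        (∀ i < e.eval C env st, ∀ st', I i st' →
          Run C f p (env ++ [i, e.eval C env st]) st' (T₁ i) (I (i + 1))) ∧
        ∀ st', I (e.eval C env st) st' → Q st'
  | .call p, env, st, T, Q => ∃ (b : ℕ) (A B : Fin b → Fin b → Bool) (T₁ : ℕ),
      f b + T₁ + 1 ≤ T ∧ b ≤ C.M ∧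
      (∀ i < C.Z, st.scr i = (b :: (encodeMatrix A ++ encodeMatrix B)).getD i 0) ∧
      ∀ (a : ℕ) (scr : ℕ → ℕ), a + b * b < C.Z →
        (∀ i < b * b, scr (a + i) = (encodeMatrix (boolMul A B)).getD i 0) →
        Run C f p (env ++ [a]) ⟨st.arr, scr⟩ T₁ fun st' => Q ⟨st'.arr, fun _ => 0⟩

theorem Run.mono {C : Ctx} {f : ℕ → ℕ} {p : Stmt} {env : List ℕ} {st : Store} {T T' : ℕ}
    {Q Q' : Store → Prop} (h : Run C f p env st T Q) (hT : T ≤ T') (hQ : ∀ st, Q st → Q' st) :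
    Run C f p env st T' Q' := by
  induction p generalizing env st T T' Q Q' with
  | skip => exact ⟨h.1.trans hT, hQ _ h.2⟩
  | put => exact ⟨h.1.trans hT, h.2.1, hQ _ h.2.2⟩
  | sput => exact ⟨h.1.trans hT, h.2.1, hQ _ h.2.2⟩
  | seq p q ihp ihq =>
    obtain ⟨T₁, T₂, hle, h⟩ := h
    exact ⟨T₁, T₂, hle.trans hT, ihp h le_rfl fun _ h => ihq h le_rfl hQ⟩
  | ite a b p q ihp ihq =>
    obtain ⟨ho, T₁, hle, h₁, h₂⟩ := h
    exact ⟨ho, T₁, hle.trans hT, fun c => ihp (h₁ c) le_rfl hQ, fun c => ihq (h₂ c) le_rfl hQ⟩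
  | bind e p ih =>
    obtain ⟨ho, T₁, hle, h⟩ := h
    exact ⟨ho, T₁, hle.trans hT, ih h le_rfl hQ⟩
  | loop e p ih =>
    obtain ⟨ho, I, T₁, hle, h0, hs, hq⟩ := h
    exact ⟨ho, I, T₁, hle.trans hT, h0, hs, fun _ h => hQ _ (hq _ h)⟩
  | call p ih =>
    obtain ⟨b, A, B, T₁, hle, hb, hsc, h⟩ := h
    exact ⟨b, A, B, T₁, hle.trans hT, hb, hsc,
      fun a scr ha hscr => ih (h a scr ha hscr) le_rfl fun _ h => hQ _ h⟩

/-! ### Compilation -/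

/-- The register of a variable. -/
def regVar (i : ℕ) : ℕ := 2 * i + 14

/-- From the indices in the registers of the variables `d`, `d + 1`, compute the address of an
array entry. -/
def addrProg (k d : ℕ) : Prog :=
  .seq (.const 12 k) <| .seq (.arith .mul 12 12 4) <|
  .seq (.arith .add (regVar d) 12 (regVar d)) <| .seq (.arith .mul (regVar d) (regVar d) 4) <|
  .seq (.arith .add (regVar d) (regVar d) (regVar (d + 1))) <|
  .arith .add (regVar d) (regVar d) 6

/-- Evaluate an expression, with the result in the register of the variable `d`. -/
def Expr.compile : Expr → ℕ → Prog
  | .num k, d => .const (regVar d) k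
  | .var i, d => .arith .add (regVar d) (regVar i) 2
  | .op o a b, d => .seq (a.compile d) <| .seq (b.compile (d + 1)) <|
      .arith o (regVar d) (regVar d) (regVar (d + 1))
  | .get k i j, d => .seq (i.compile d) <| .seq (j.compile (d + 1)) <|
      .seq (addrProg k d) <| .load (regVar d) (regVar d)
  | .inp i, d => .seq (i.compile d) <| .load (regVar d) (regVar d)
  | .scr i, d => .seq (i.compile d) <| .seq (.arith .add (regVar d) (regVar d) 10) <|
      .load (regVar d) (regVar d)

def Expr.cost : Expr → ℕ
  | .num _ => 1
  | .var _ => 1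
  | .op _ a b => a.cost + b.cost + 1
  | .get _ i j => i.cost + j.cost + 7
  | .inp i => i.cost + 1
  | .scr i => i.cost + 2

/-- The state `s` represents the store `st` and the values `env` of the variables. -/
structure Sim (C : Ctx) (env : List ℕ) (st : Store) (s : State) : Prop where
  zero : s.reg 2 = 0
  dim : s.reg 4 = C.M
  start : s.reg 6 = C.H
  bound : s.reg 8 = C.Z
  fresh : C.H + C.K * C.M * C.M ≤ s.reg 10
  env : ∀ i < env.length, s.reg (regVar i) = lookup env i ∧ lookup env i < C.Z
  inp : ∀ i < C.H, s.mem i = C.inp i ∧ C.inp i < C.Z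
  arr : ∀ k < C.K, ∀ i < C.M, ∀ j < C.M,
    s.mem (C.H + ((k * C.M + i) * C.M + j)) = st.arr k i j ∧ st.arr k i j < C.Z
  scr : ∀ i < C.Z, s.mem (s.reg 10 + i) = st.scr i
  rest : ∀ i, s.reg 10 + C.Z ≤ i → s.mem i = 0

/-- The states agree on the even registers below the one of the variable `d`, except on the
register for intermediate results. -/
def Keep (d : ℕ) (s s' : State) : Prop :=
  ∀ r, r % 2 = 0 → r ≠ 12 → r < 2 * d + 14 → s'.reg r = s.reg r

theorem Keep.trans {d d' : ℕ} {s₁ s₂ s₃ : State} (h : Keep d s₁ s₂) (h' : Keep d' s₂ s₃)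
    (hd : d ≤ d') : Keep d s₁ s₃ :=
  fun r h₁ h₂ h₃ => (h' r h₁ h₂ (by omega)).trans (h r h₁ h₂ h₃)

theorem Keep.setReg (d : ℕ) (s : State) (r v : ℕ) (hr : r = 12 ∨ 2 * d + 14 ≤ r) :
    Keep d s (s.setReg r v) := by
  intro r' h₁ h₂ h₃
  have : r' ≠ r := by omega
  simp [State.setReg, Function.update_of_ne this]

theorem Sim.keep {C : Ctx} {env : List ℕ} {st : Store} {s s' : State} (h : Sim C env st s)
    {d : ℕ} (hd : env.length ≤ d) (hk : Keep d s s') (hm : s'.mem = s.mem) :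
    Sim C env st s' := by
  have e10 := hk 10 (by omega) (by omega) (by omega)
  refine ⟨(hk 2 (by omega) (by omega) (by omega)).trans h.zero,
    (hk 4 (by omega) (by omega) (by omega)).trans h.dim,
    (hk 6 (by omega) (by omega) (by omega)).trans h.start,
    (hk 8 (by omega) (by omega) (by omega)).trans h.bound, by rw [e10]; exact h.fresh,
    fun i hi => ?_, by rw [hm]; exact h.inp, by rw [hm]; exact h.arr,
    by rw [e10, hm]; exact h.scr, by rw [e10, hm]; exact h.rest⟩
  rw [hk (regVar i) (by unfold regVar; omega) (by unfold regVar; omega)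
    (by unfold regVar; omega)]
  exact h.env i hi

theorem Sim.extend {C : Ctx} {env : List ℕ} {st : Store} {s : State} (h : Sim C env st s)
    {v : ℕ} (hv : s.reg (regVar env.length) = v) (hlt : v < C.Z) : Sim C (env ++ [v]) st s := by
  refine ⟨h.zero, h.dim, h.start, h.bound, h.fresh, fun i hi => ?_, h.inp, h.arr, h.scr, h.rest⟩
  by_cases e : i < env.length
  · rw [lookup_append_left _ _ e]; exact h.env i e
  · have : i = env.length + 0 := by simp at hi; omega
    rw [this, lookup_append_right]
    exact ⟨hv, hlt⟩

theorem Sim.restrict {C : Ctx} {env env' : List ℕ} {st : Store} {s : State}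
    (h : Sim C (env ++ env') st s) : Sim C env st s := by
  refine ⟨h.zero, h.dim, h.start, h.bound, h.fresh, fun i hi => ?_, h.inp, h.arr, h.scr, h.rest⟩
  have := h.env i (by simp; omega)
  rwa [lookup_append_left _ _ hi] at this

theorem exec_arith {W : ℕ} {s : State} {o : Op} {r a b v : ℕ}
    (hv : o.eval (s.reg a) (s.reg b) = v) (h : v < W) :
    Exec W (.arith o r a b) s 1 (s.setReg r v) := by
  subst hv; exact .arith s o r a b h

theorem setReg_same (s : State) (r v : ℕ) : (s.setReg r v).reg r = v := by simp [State.setReg]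

theorem setReg_ne (s : State) {r r' : ℕ} (v : ℕ) (h : r' ≠ r) :
    (s.setReg r v).reg r' = s.reg r' := by simp [State.setReg, Function.update_of_ne h]

theorem addr_lt {K M k i j : ℕ} (hk : k < K) (hi : i < M) (hj : j < M) :
    k * M ≤ (k * M + i) * M + j ∧ k * M + i ≤ (k * M + i) * M + j ∧
      (k * M + i) * M + j < K * M * M := by
  have h₁ : k * M + i + 1 ≤ K * M := by nlinarith
  have h₂ : (k * M + i + 1) * M ≤ K * M * M := Nat.mul_le_mul_right _ h₁
  have h₃ : k * M + i ≤ (k * M + i) * M := Nat.le_mul_of_pos_right _ (by omega)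
  refine ⟨by omega, by omega, ?_⟩
  rw [add_mul, one_mul] at h₂
  omega

theorem addrProg_exec {W H K M k i j d : ℕ} (hk : k < K) (hi : i < M) (hj : j < M)
    (hKW : k < W) (hW : H + K * M * M ≤ W) {s : State} (hM : s.reg 4 = M) (hH : s.reg 6 = H)
    (h₁ : s.reg (regVar d) = i) (h₂ : s.reg (regVar (d + 1)) = j) :
    ∃ s', Exec W (addrProg k d) s 6 s' ∧ s'.mem = s.mem ∧ Keep d s s' ∧
      s'.reg (regVar d) = H + ((k * M + i) * M + j) ∧
      ∀ r, regVar (d + 1) < r → s'.reg r = s.reg r := by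
  obtain ⟨l₁, l₂, l₃⟩ := addr_lt hk hi hj
  have n₁ : regVar d ≠ 12 := by unfold regVar; omega
  have n₂ : regVar (d + 1) ≠ 12 := by unfold regVar; omega
  have n₃ : regVar (d + 1) ≠ regVar d := by unfold regVar; omega
  have n₄ : 4 ≠ regVar d := by unfold regVar; omega
  have n₅ : 6 ≠ regVar d := by unfold regVar; omega
  have l₄ : (k * M + i) * M ≤ (k * M + i) * M + j := Nat.le_add_right _ _
  refine ⟨_, .seq (.const s 12 k hKW) <|
    .seq (exec_arith (v := k * M) (by simp [Op.eval, setReg_same, setReg_ne, hM]) (by omega)) <|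
    .seq (exec_arith (v := k * M + i)
      (by simp [Op.eval, setReg_same, setReg_ne, h₁, n₁]) (by omega)) <|
    .seq (exec_arith (v := (k * M + i) * M)
      (by simp [Op.eval, setReg_same, setReg_ne, hM, n₄]) (by omega)) <|
    .seq (exec_arith (v := (k * M + i) * M + j)
      (by simp [Op.eval, setReg_same, setReg_ne, h₂, n₂, n₃]) (by omega))
    (exec_arith (v := H + ((k * M + i) * M + j))
      (by simp [Op.eval, setReg_same, setReg_ne, hH, n₅]; omega) (by omega)), rfl, ?_, ?_, ?_⟩
  · refine Keep.trans (Keep.setReg d _ _ _ (Or.inl rfl)) (Keep.trans (Keep.setReg d _ _ _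
      (Or.inl rfl)) (Keep.trans (Keep.setReg d _ _ _ ?_) (Keep.trans (Keep.setReg d _ _ _ ?_)
      (Keep.trans (Keep.setReg d _ _ _ ?_) (Keep.setReg d _ _ _ ?_) le_rfl) le_rfl) le_rfl)
      le_rfl) le_rfl
    all_goals exact Or.inr (by unfold regVar; omega)
  · simp [setReg_same]
  · intro r hr
    have e₁ : r ≠ 12 := by unfold regVar at hr; omega
    have e₂ : r ≠ regVar d := by unfold regVar at hr ⊢; omega
    simp [setReg_ne, e₁, e₂]

/-- Multiplication is the worst case and adds the exponents. A sum is covered as well, since `Z ≥ 2`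
makes both powers at least 2. -/
theorem Op.eval_lt_pow {Z a b x y : ℕ} (o : Op) (hZ : 2 ≤ Z) (ha : 1 ≤ a) (hb : 1 ≤ b)
    (hx : x < Z ^ a) (hy : y < Z ^ b) : o.eval x y < Z ^ (a + b) := by
  have ha' : Z ≤ Z ^ a := by simpa using Nat.pow_le_pow_right (by omega : 0 < Z) ha
  have hb' : Z ≤ Z ^ b := by simpa using Nat.pow_le_pow_right (by omega : 0 < Z) hb
  rw [pow_add]
  have h₁ : Z ^ a ≤ Z ^ a * Z ^ b := by nlinarith
  cases o with
  | add => simp only [Op.eval]; nlinarith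
  | sub => simp only [Op.eval]; omega
  | mul => exact Nat.mul_lt_mul'' hx hy
  | div => exact lt_of_le_of_lt (Nat.div_le_self x y) (by omega)

theorem Expr.one_le_size (e : Expr) : 1 ≤ e.size := by
  induction e with
  | num | var => exact le_rfl
  | op o a b iha ihb => simp only [Expr.size]; omega
  | get k a b iha ihb => simp only [Expr.size]; omega
  | inp i ih => exact ih
  | scr i ih => exact ih

/-- Among the even registers, evaluation at depth `d` changes only those of the variables from `d`
on and register 12. So the first operand survives the evaluation of the second one at depth `d + 1`,
and the variables in use are untouched. -/
theorem Expr.compile_exec {C : Ctx} {W : ℕ} {env : List ℕ} {st : Store} (hZ : 2 ≤ C.Z)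
    (hK : C.K ≤ C.Z) (e : Expr) :
    ∀ (d : ℕ) (s : State), Sim C env st s → env.length ≤ d → e.Ok C env st →
      C.Z ^ e.size ≤ W → s.reg 10 + C.Z ≤ W →
      e.eval C env st < C.Z ^ e.size ∧
      ∃ t s', Exec W (e.compile d) s t s' ∧ t ≤ e.cost ∧ s'.mem = s.mem ∧ Keep d s s' ∧
        s'.reg (regVar d) = e.eval C env st := by
  induction e with
  | num k =>
    intro d s hs hd hok hW hF
    simp only [Expr.size, pow_one] at hW
    simp only [Expr.Ok] at hok
    exact ⟨by simpa [Expr.size, Expr.eval] using hok, 1, _, .const s _ k (by omega), le_rfl, rfl,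
      Keep.setReg _ _ _ _ (Or.inr le_rfl), setReg_same _ _ _⟩
  | var i =>
    intro d s hs hd hok hW hF
    simp only [Expr.size, pow_one] at hW
    have := hs.env i hok
    exact ⟨by simpa [Expr.size, Expr.eval] using this.2, 1, _,
      exec_arith (v := lookup env i) (by simp [Op.eval, this.1, hs.zero]) (by omega), le_rfl, rfl,
      Keep.setReg _ _ _ _ (Or.inr le_rfl), setReg_same _ _ _⟩
  | op o a b iha ihb =>
    intro d s hs hd hok hW hF
    have hp : C.Z ^ a.size ≤ C.Z ^ (a.size + b.size) :=
      Nat.pow_le_pow_right (by omega) (by omega)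
    have hp' : C.Z ^ b.size ≤ C.Z ^ (a.size + b.size) :=
      Nat.pow_le_pow_right (by omega) (by omega)
    simp only [Expr.size] at hW
    obtain ⟨v₁, t₁, s₁, x₁, l₁, m₁, k₁, r₁⟩ := iha d s hs hd hok.1 (by omega) hF
    have hs₁ := hs.keep hd k₁ m₁
    obtain ⟨v₂, t₂, s₂, x₂, l₂, m₂, k₂, r₂⟩ := ihb (d + 1) s₁ hs₁ (by omega) hok.2 (by omega)
      (by rw [k₁ 10 (by omega) (by omega) (by omega)]; exact hF)
    have hlt := Op.eval_lt_pow o hZ a.one_le_size b.one_le_size v₁ v₂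
    refine ⟨hlt, _, _, .seq x₁ (.seq x₂ (exec_arith (v := o.eval (a.eval C env st)
      (b.eval C env st)) ?_ (by omega))), ?_, m₂.trans m₁,
      (k₁.trans k₂ (by omega)).trans (Keep.setReg d _ _ _ (Or.inr le_rfl)) le_rfl,
      setReg_same _ _ _⟩
    · rw [r₂, k₂ (regVar d) (by unfold regVar; omega) (by unfold regVar; omega)
        (by unfold regVar; omega), r₁]
    · simp only [Expr.cost]; omega
  | get k a b iha ihb =>
    intro d s hs hd hok hW hF
    have hp : C.Z ^ a.size ≤ C.Z ^ (a.size + b.size) :=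
      Nat.pow_le_pow_right (by omega) (by omega)
    have hp' : C.Z ^ b.size ≤ C.Z ^ (a.size + b.size) :=
      Nat.pow_le_pow_right (by omega) (by omega)
    simp only [Expr.size] at hW
    obtain ⟨oa, ob, hk, ha, hb⟩ := hok
    obtain ⟨v₁, t₁, s₁, x₁, l₁, m₁, k₁, r₁⟩ := iha d s hs hd oa (by omega) hF
    have hs₁ := hs.keep hd k₁ m₁
    have hF₁ : s₁.reg 10 + C.Z ≤ W := by
      rw [k₁ 10 (by omega) (by omega) (by omega)]; exact hF
    obtain ⟨v₂, t₂, s₂, x₂, l₂, m₂, k₂, r₂⟩ := ihb (d + 1) s₁ hs₁ (by omega) ob (by omega) hF₁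
    have hs₂ := hs₁.keep (d := d + 1) (by omega) k₂ m₂
    have hfr := hs.fresh
    obtain ⟨s₃, x₃, m₃, k₃, r₃, -⟩ := addrProg_exec (W := W) (d := d) hk ha hb (by omega)
      (by omega) hs₂.dim hs₂.start (by
        rw [k₂ (regVar d) (by unfold regVar; omega) (by unfold regVar; omega)
          (by unfold regVar; omega), r₁]) r₂
    have hc := hs.arr k hk _ ha _ hb
    refine ⟨lt_of_lt_of_le hc.2 ?_, _, _, .seq x₁ (.seq x₂ (.seq x₃ (.load s₃ _ _))), ?_,
      m₃.trans (m₂.trans m₁), ((k₁.trans k₂ (by omega)).trans k₃ le_rfl).trans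
        (Keep.setReg d _ _ _ (Or.inr le_rfl)) le_rfl, ?_⟩
    · have := a.one_le_size
      simpa [Expr.size] using Nat.pow_le_pow_right (by omega : 0 < C.Z)
        (by omega : 1 ≤ a.size + b.size)
    · simp only [Expr.cost]; omega
    · rw [setReg_same, r₃, m₃, m₂, m₁, hc.1]; rfl
  | inp i ih =>
    intro d s hs hd hok hW hF
    obtain ⟨v₁, t₁, s₁, x₁, l₁, m₁, k₁, r₁⟩ := ih d s hs hd hok.1 hW hF
    have hc := hs.inp _ hok.2
    refine ⟨lt_of_lt_of_le hc.2 ?_, _, _, .seq x₁ (.load s₁ _ _), ?_, m₁,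
      k₁.trans (Keep.setReg d _ _ _ (Or.inr le_rfl)) le_rfl, ?_⟩
    · simpa [Expr.size] using Nat.pow_le_pow_right (by omega : 0 < C.Z) i.one_le_size
    · simp only [Expr.cost]; omega
    · rw [setReg_same, r₁, m₁, hc.1]; rfl
  | scr i ih =>
    intro d s hs hd hok hW hF
    obtain ⟨v₁, t₁, s₁, x₁, l₁, m₁, k₁, r₁⟩ := ih d s hs hd hok.1 hW hF
    have hc := hs.scr _ hok.2.1
    have h10 := k₁ 10 (by omega) (by omega) (by omega)
    refine ⟨lt_of_lt_of_le hok.2.2 ?_, _, _, .seq x₁ (.seq (exec_arith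
      (v := s.reg 10 + i.eval C env st) ?_ ?_) (.load _ _ _)), ?_, m₁,
      (k₁.trans (Keep.setReg d _ _ _ (Or.inr le_rfl)) le_rfl).trans
        (Keep.setReg d _ _ _ (Or.inr le_rfl)) le_rfl, ?_⟩
    · simpa [Expr.size] using Nat.pow_le_pow_right (by omega : 0 < C.Z) i.one_le_size
    · rw [r₁, h10, add_comm]; rfl
    · have := hok.2.1; omega
    · simp only [Expr.cost]; omega
    · rw [setReg_same, setReg_same]
      simp only [Expr.eval]
      rw [← hc]
      change s₁.mem _ = _
      rw [m₁]

/-- Dominates the size of every expression in the statement, so the single condition `C.Z ^ size ≤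
W` serves all evaluations. -/
def Stmt.size : Stmt → ℕ
  | .skip => 1
  | .put _ i j e => i.size + j.size + e.size
  | .sput i e => i.size + e.size
  | .seq p q => p.size + q.size
  | .ite a b p q => a.size + b.size + p.size + q.size
  | .bind e p => e.size + p.size
  | .loop e p => e.size + p.size
  | .call p => p.size

/-- The compiled program, where the variables from number `d` on are not yet in use, and `mp` is a
program for matrix multiplication. -/
def Stmt.compile (mp : Prog) : Stmt → ℕ → Prog
  | .skip, _ => .skip
  | .put k i j e, d => .seq (i.compile d) <| .seq (j.compile (d + 1)) <|
      .seq (e.compile (d + 2)) <| .seq (addrProg k d) <| .store (regVar d) (regVar (d + 2))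
  | .sput i e, d => .seq (i.compile d) <| .seq (e.compile (d + 1)) <|
      .seq (.arith .add (regVar d) (regVar d) 10) <| .store (regVar d) (regVar (d + 1))
  | .seq p q, d => .seq (p.compile mp d) (q.compile mp d)
  | .ite a b p q, d => .seq (a.compile d) <| .seq (b.compile (d + 1)) <|
      .ifLt (regVar d) (regVar (d + 1)) (p.compile mp d) (q.compile mp d)
  | .bind e p, d => .seq (e.compile d) (p.compile mp (d + 1))
  | .loop e p, d => .seq (e.compile (d + 1)) <| .seq (.const (regVar d) 0) <|
      .whileLt (regVar d) (regVar (d + 1)) <| .seq (p.compile mp (d + 2)) <|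
        .seq (.const 12 1) <| .arith .add (regVar d) (regVar d) 12
  | .call p, d => .seq (.seq (clearOdd (mp.regBound + 2)) mp.relocate) <|
      .seq (.arith .add (regVar d) 3 2) <| .seq (p.compile mp (d + 1)) <| .arith .add 10 10 8

def Stmt.cost (mp : Prog) : Stmt → ℕ
  | .skip => 1
  | .put _ i j e => i.cost + j.cost + e.cost + 7
  | .sput i e => i.cost + e.cost + 2
  | .seq p q => p.cost mp + q.cost mp
  | .ite a b p q => a.cost + b.cost + 1 + p.cost mp + q.cost mp
  | .bind e p => e.cost + p.cost mp
  | .loop e p => e.cost + p.cost mp + 5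
  | .call p => mp.regBound + 7 + p.cost mp

/-- The program `mp` multiplies matrices of dimension up to `C.M` in time `f` and with a memory
that fits into the scratch array. -/
def MulSpec (C : Ctx) (f : ℕ → ℕ) (mp : Prog) : Prop :=
  ∀ b ≤ C.M, ∀ A B : Fin b → Fin b → Bool, ∃ W t s',
    Exec W mp (State.init (b :: (encodeMatrix A ++ encodeMatrix B))) t s' ∧ t ≤ f b ∧
      s'.output = encodeMatrix (boolMul A B) ∧ W + b + 2 + b * b ≤ C.Z

theorem addr_inj {M k i j k' i' j' : ℕ} (hi : i < M) (hj : j < M) (hi' : i' < M) (hj' : j' < M)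
    (h : (k * M + i) * M + j = (k' * M + i') * M + j') : k = k' ∧ i = i' ∧ j = j' := by
  have inj : ∀ {x y x' y' : ℕ}, y < M → y' < M → x * M + y = x' * M + y' → x = x' ∧ y = y' := by
    intro x y x' y' hy hy' h
    have h₁ := congrArg (· / M) h
    simp only [mul_comm _ M, Nat.mul_add_div (by omega : 0 < M), Nat.div_eq_of_lt hy,
      Nat.div_eq_of_lt hy', add_zero] at h₁
    subst h₁
    exact ⟨rfl, by omega⟩
  obtain ⟨h₁, h₂⟩ := inj hj hj' h
  obtain ⟨h₃, h₄⟩ := inj hi hi' h₁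
  exact ⟨h₃, h₄, h₂⟩

theorem Sim.put {C : Ctx} {env : List ℕ} {st : Store} {s : State} (h : Sim C env st s)
    {k i j v : ℕ} (hk : k < C.K) (hi : i < C.M) (hj : j < C.M) (hv : v < C.Z) :
    Sim C env (st.put k i j v) (s.setMem (C.H + ((k * C.M + i) * C.M + j)) v) := by
  obtain ⟨-, -, l⟩ := addr_lt hk hi hj
  have hf := h.fresh
  have ne : ∀ x, x ≠ C.H + ((k * C.M + i) * C.M + j) →
      (s.setMem (C.H + ((k * C.M + i) * C.M + j)) v).mem x = s.mem x := by
    intro x hx; simp [State.setMem, Function.update_of_ne hx]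
  refine ⟨h.zero, h.dim, h.start, h.bound, hf, h.env, fun x hx => ?_,
    fun k' hk' i' hi' j' hj' => ?_,
    fun x hx => ?_, fun x hx => ?_⟩
  · rw [ne x (by omega)]; exact h.inp x hx
  · rw [Store.put_arr]
    split_ifs with e
    · obtain ⟨rfl, rfl, rfl⟩ := e
      exact ⟨by simp [State.setMem], hv⟩
    · rw [ne _ fun e' => e (addr_inj hi' hj' hi hj (by omega))]
      exact h.arr k' hk' i' hi' j' hj'
  · change (s.setMem _ v).mem (s.reg 10 + x) = _
    rw [ne _ (by omega)]; exact h.scr x hx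
  · change s.reg 10 + C.Z ≤ x at hx
    rw [ne _ (by omega)]; exact h.rest x hx

theorem Sim.sput {C : Ctx} {env : List ℕ} {st : Store} {s : State} (h : Sim C env st s)
    {i v : ℕ} (hi : i < C.Z) : Sim C env (st.sput i v) (s.setMem (s.reg 10 + i) v) := by
  have hf := h.fresh
  have ne : ∀ x, x ≠ s.reg 10 + i →
      (s.setMem (s.reg 10 + i) v).mem x = s.mem x := by
    intro x hx; simp [State.setMem, Function.update_of_ne hx]
  refine ⟨h.zero, h.dim, h.start, h.bound, hf, h.env, fun x hx => ?_,
    fun k' hk' i' hi' j' hj' => ?_,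
    fun x hx => ?_, fun x hx => ?_⟩
  · rw [ne x (by omega)]; exact h.inp x hx
  · obtain ⟨-, -, l'⟩ := addr_lt hk' hi' hj'
    rw [ne _ (by omega)]
    exact h.arr k' hk' i' hi' j' hj'
  · change (s.setMem _ v).mem (s.reg 10 + x) = _
    by_cases e : x = i
    · subst e; simp [State.setMem, Store.sput]
    · rw [ne _ (by omega)]; simpa [Store.sput, Function.update_of_ne e] using h.scr x hx
  · change s.reg 10 + C.Z ≤ x at hx
    rw [ne _ (by omega)]; exact h.rest x hx

-- Time units double as memory units. A `call` takes at least one unit of `T` and uses up one window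
-- of `C.Z` cells, because the scratch array is not cleared but moved to untouched memory. So
-- register 10 grows by at most `T * C.Z`, and the word bound has to leave room for one more window.
-- The factor between `T` and the true number of steps depends only on `p` and `mp`.
set_option maxHeartbeats 1000000 in
theorem Stmt.compile_exec {C : Ctx} {f : ℕ → ℕ} {mp : Prog} {W : ℕ} (hZ : 2 ≤ C.Z)
    (hK : C.K ≤ C.Z) (hmul : MulSpec C f mp) (p : Stmt) :
    ∀ (env : List ℕ) (st : Store) (T : ℕ) (Q : Store → Prop) (s : State), Sim C env st s →
      Run C f p env st T Q → C.Z ^ p.size ≤ W → s.reg 10 + (T + 1) * C.Z ≤ W →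
      ∃ t s' st', Exec W (p.compile mp env.length) s t s' ∧ t ≤ p.cost mp * T ∧
        Sim C env st' s' ∧ Q st' ∧ s'.reg 10 ≤ s.reg 10 + T * C.Z := by
  have le_add : ∀ {a b : ℕ}, C.Z ^ (a + b) ≤ W → C.Z ^ a ≤ W ∧ C.Z ^ b ≤ W := fun {a b} h =>
    ⟨(Nat.pow_le_pow_right (by omega) (by omega)).trans h,
      (Nat.pow_le_pow_right (by omega) (by omega)).trans h⟩
  have fresh_keep : ∀ {d : ℕ} {s s' : State}, Keep d s s' → s'.reg 10 = s.reg 10 :=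
    fun h => h 10 (by omega) (by omega) (by omega)
  have one_le : ∀ {T x : ℕ}, x + (T + 1) * C.Z ≤ W → x + C.Z ≤ W := by
    intro T x h
    rw [add_mul, one_mul] at h
    exact le_trans (by omega) h
  induction p with
  | skip =>
    intro env st T Q s hs hr hW hF
    exact ⟨1, s, st, .skip s, by simpa [Stmt.cost] using hr.1, hs, hr.2, Nat.le_add_right _ _⟩
  | put k i j e =>
    intro env st T Q s hs hr hW hF
    obtain ⟨hT, ⟨hk, oi, oj, oe, hi, hj, he⟩, hQ⟩ := hr
    obtain ⟨hW', hW₃⟩ := le_add hW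
    obtain ⟨hW₁, hW₂⟩ := le_add hW'
    have hF := one_le hF
    obtain ⟨-, t₁, s₁, x₁, l₁, m₁, k₁, r₁⟩ :=
      Expr.compile_exec hZ hK i env.length s hs le_rfl oi hW₁ hF
    have hs₁ := hs.keep le_rfl k₁ m₁
    obtain ⟨-, t₂, s₂, x₂, l₂, m₂, k₂, r₂⟩ :=
      Expr.compile_exec hZ hK j (env.length + 1) s₁ hs₁ (by omega) oj hW₂
        (by rw [fresh_keep k₁]; exact hF)
    have hs₂ := hs₁.keep (d := env.length + 1) (by omega) k₂ m₂
    obtain ⟨-, t₃, s₃, x₃, l₃, m₃, k₃, r₃⟩ :=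
      Expr.compile_exec hZ hK e (env.length + 2) s₂ hs₂ (by omega) oe hW₃
        (by rw [fresh_keep k₂, fresh_keep k₁]; exact hF)
    have hs₃ := hs₂.keep (d := env.length + 2) (by omega) k₃ m₃
    have e₁ : s₃.reg (regVar env.length) = i.eval C env st := by
      rw [k₃ _ (by unfold regVar; omega) (by unfold regVar; omega) (by unfold regVar; omega),
        k₂ _ (by unfold regVar; omega) (by unfold regVar; omega) (by unfold regVar; omega), r₁]
    have e₂ : s₃.reg (regVar (env.length + 1)) = j.eval C env st := by
      rw [k₃ _ (by unfold regVar; omega) (by unfold regVar; omega) (by unfold regVar; omega), r₂]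
    have hf := hs.fresh
    obtain ⟨s₄, x₄, m₄, k₄, r₄, q₄⟩ := addrProg_exec (W := W) (d := env.length) hk hi hj
      (by omega) (by omega) hs₃.dim hs₃.start e₁ e₂
    have hs₄ := hs₃.keep (d := env.length) le_rfl k₄ m₄
    have hst := hs₄.put hk hi hj he
    refine ⟨_, _, _, .seq x₁ (.seq x₂ (.seq x₃ (.seq x₄ (.store s₄ _ _)))), ?_, ?_, hQ, ?_⟩
    · calc _ ≤ Stmt.cost mp (.put k i j e) * 1 := by simp only [Stmt.cost]; omega
        _ ≤ _ := Nat.mul_le_mul_left _ hT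
    · rw [r₄, q₄ _ (by unfold regVar; omega), r₃]
      exact hst
    · change s₄.reg 10 ≤ _
      rw [fresh_keep k₄, fresh_keep k₃, fresh_keep k₂, fresh_keep k₁]
      exact Nat.le_add_right _ _
  | sput i e =>
    intro env st T Q s hs hr hW hF
    obtain ⟨hT, ⟨oi, oe, hi, he⟩, hQ⟩ := hr
    obtain ⟨hW₁, hW₂⟩ := le_add hW
    have hF := one_le hF
    obtain ⟨-, t₁, s₁, x₁, l₁, m₁, k₁, r₁⟩ :=
      Expr.compile_exec hZ hK i env.length s hs le_rfl oi hW₁ hF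
    have hs₁ := hs.keep le_rfl k₁ m₁
    obtain ⟨-, t₂, s₂, x₂, l₂, m₂, k₂, r₂⟩ :=
      Expr.compile_exec hZ hK e (env.length + 1) s₁ hs₁ (by omega) oe hW₂
        (by rw [fresh_keep k₁]; exact hF)
    have hs₂ := hs₁.keep (d := env.length + 1) (by omega) k₂ m₂
    have e₁ : s₂.reg (regVar env.length) = i.eval C env st := by
      rw [k₂ _ (by unfold regVar; omega) (by unfold regVar; omega) (by unfold regVar; omega), r₁]
    have f₂ : s₂.reg 10 = s.reg 10 := by rw [fresh_keep k₂, fresh_keep k₁]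
    have k₃ := Keep.setReg env.length s₂ (regVar env.length) (s₂.reg 10 + i.eval C env st)
      (Or.inr le_rfl)
    have hs₃ := hs₂.keep (d := env.length) le_rfl k₃ rfl
    have hst := hs₃.sput (v := e.eval C env st) hi
    refine ⟨_, _, _, .seq x₁ (.seq x₂ (.seq (exec_arith (v := s₂.reg 10 + i.eval C env st)
      ?_ ?_) (.store _ _ _))), ?_, ?_, hQ, ?_⟩
    · rw [e₁, add_comm]; rfl
    · omega
    · calc _ ≤ Stmt.cost mp (.sput i e) * 1 := by simp only [Stmt.cost]; omega
        _ ≤ _ := Nat.mul_le_mul_left _ hT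
    · rw [setReg_same, setReg_ne _ _ (by unfold regVar; omega), r₂]
      rw [fresh_keep k₃] at hst
      exact hst
    · change (s₂.setReg (regVar env.length) (s₂.reg 10 + i.eval C env st)).reg 10 ≤ _
      rw [fresh_keep k₃, f₂]
      exact Nat.le_add_right _ _
  | seq p q ihp ihq =>
    intro env st T Q s hs hr hW hF
    obtain ⟨T₁, T₂, hT, hr⟩ := hr
    obtain ⟨hW₁, hW₂⟩ := le_add hW
    have hTZ : (T₁ + T₂ + 1) * C.Z ≤ (T + 1) * C.Z := Nat.mul_le_mul_right _ (by omega)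
    rw [add_mul, add_mul, one_mul] at hTZ
    obtain ⟨t₁, s₁, st₁, x₁, l₁, hs₁, hr₁, f₁⟩ := ihp env st T₁ _ s hs hr hW₁ (by
      rw [add_mul, one_mul]; omega)
    obtain ⟨t₂, s₂, st₂, x₂, l₂, hs₂, hr₂, f₂⟩ := ihq env st₁ T₂ _ s₁ hs₁ hr₁ hW₂ (by
      rw [add_mul, one_mul]; omega)
    refine ⟨_, s₂, st₂, .seq x₁ x₂, ?_, hs₂, hr₂, ?_⟩
    · calc t₁ + t₂ ≤ (p.cost mp + q.cost mp) * (T₁ + T₂) := by nlinarith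
        _ ≤ _ := Nat.mul_le_mul_left _ hT
    · have : (T₁ + T₂) * C.Z ≤ T * C.Z := Nat.mul_le_mul_right _ hT
      rw [add_mul] at this
      omega
  | ite a b p q ihp ihq =>
    intro env st T Q s hs hr hW hF
    obtain ⟨⟨oa, ob⟩, T₁, hT, h₁, h₂⟩ := hr
    obtain ⟨hW', hW₄⟩ := le_add hW
    obtain ⟨hW'', hW₃⟩ := le_add hW'
    obtain ⟨hW₁, hW₂⟩ := le_add hW''
    have hF' := one_le hF
    obtain ⟨-, t₁, s₁, x₁, l₁, m₁, k₁, r₁⟩ :=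
      Expr.compile_exec hZ hK a env.length s hs le_rfl oa hW₁ hF'
    have hs₁ := hs.keep le_rfl k₁ m₁
    obtain ⟨-, t₂, s₂, x₂, l₂, m₂, k₂, r₂⟩ :=
      Expr.compile_exec hZ hK b (env.length + 1) s₁ hs₁ (by omega) ob hW₂
        (by rw [fresh_keep k₁]; exact hF')
    have hs₂ := hs₁.keep (d := env.length + 1) (by omega) k₂ m₂
    have e₁ : s₂.reg (regVar env.length) = a.eval C env st := by
      rw [k₂ _ (by unfold regVar; omega) (by unfold regVar; omega) (by unfold regVar; omega), r₁]
    have f₂ : s₂.reg 10 = s.reg 10 := by rw [fresh_keep k₂, fresh_keep k₁]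
    have hTZ : (T₁ + 1) * C.Z ≤ (T + 1) * C.Z := Nat.mul_le_mul_right _ (by omega)
    have hTZ' : T₁ * C.Z ≤ T * C.Z := Nat.mul_le_mul_right _ (by omega)
    by_cases hc : a.eval C env st < b.eval C env st
    · obtain ⟨t₃, s₃, st₃, x₃, l₃, hs₃, hr₃, f₃⟩ := ihp env st T₁ _ s₂ hs₂ (h₁ hc) hW₃ (by omega)
      refine ⟨_, s₃, st₃, .seq x₁ (.seq x₂ (.ifLt_true (by rwa [e₁, r₂]) x₃)), ?_, hs₃, hr₃,
        by omega⟩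
      calc _ ≤ (a.cost + b.cost + 1 + p.cost mp + q.cost mp) * (T₁ + 1) := by nlinarith
        _ ≤ _ := Nat.mul_le_mul_left _ hT
    · obtain ⟨t₃, s₃, st₃, x₃, l₃, hs₃, hr₃, f₃⟩ := ihq env st T₁ _ s₂ hs₂ (h₂ hc) hW₄ (by omega)
      refine ⟨_, s₃, st₃, .seq x₁ (.seq x₂ (.ifLt_false (by rwa [e₁, r₂]) x₃)), ?_, hs₃, hr₃,
        by omega⟩
      calc _ ≤ (a.cost + b.cost + 1 + p.cost mp + q.cost mp) * (T₁ + 1) := by nlinarith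
        _ ≤ _ := Nat.mul_le_mul_left _ hT
  | bind e p ih =>
    intro env st T Q s hs hr hW hF
    obtain ⟨⟨oe, he⟩, T₁, hT, hr⟩ := hr
    obtain ⟨hW₁, hW₂⟩ := le_add hW
    obtain ⟨-, t₁, s₁, x₁, l₁, m₁, k₁, r₁⟩ :=
      Expr.compile_exec hZ hK e env.length s hs le_rfl oe hW₁ (one_le hF)
    have hs₁ := (hs.keep le_rfl k₁ m₁).extend r₁ he
    have hTZ : (T₁ + 1) * C.Z ≤ (T + 1) * C.Z := Nat.mul_le_mul_right _ (by omega)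
    have hTZ' : T₁ * C.Z ≤ T * C.Z := Nat.mul_le_mul_right _ (by omega)
    have f₁ := fresh_keep k₁
    obtain ⟨t₂, s₂, st₂, x₂, l₂, hs₂, hr₂, f₂⟩ := ih _ st T₁ _ s₁ hs₁ hr hW₂ (by omega)
    rw [List.length_append, List.length_singleton] at x₂
    refine ⟨_, s₂, st₂, .seq x₁ x₂, ?_, hs₂.restrict, hr₂, by omega⟩
    calc _ ≤ (e.cost + p.cost mp) * (T₁ + 1) := by nlinarith
      _ ≤ _ := Nat.mul_le_mul_left _ hT
  | loop e p ih =>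
    intro env st T Q s hs hr hW hF
    obtain ⟨⟨oe, he⟩, I, T₁, hT, h0, hstep, hQ⟩ := hr
    obtain ⟨hW₁, hW₂⟩ := le_add hW
    obtain ⟨-, t₁, s₁, x₁, l₁, m₁, k₁, r₁⟩ :=
      Expr.compile_exec hZ hK e (env.length + 1) s hs (by omega) oe hW₁ (one_le hF)
    set n := e.eval C env st with hn
    have hF' := one_le hF
    -- Induction on the number `k` of rounds that remain, with `i` rounds done.
    have iter : ∀ (k i : ℕ) (st : Store) (s : State), i + k = n → I i st →
        Sim C (env ++ [i, n]) st s →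
        s.reg 10 + (∑ j ∈ Finset.range k, (T₁ (i + j) + 1)) * C.Z + C.Z ≤ W →
        ∃ t s' st', Exec W (.whileLt (regVar env.length) (regVar (env.length + 1)) <|
          .seq (p.compile mp (env.length + 2)) <| .seq (.const 12 1) <|
          .arith .add (regVar env.length) (regVar env.length) 12) s t s' ∧
          t ≤ (p.cost mp + 3) * (∑ j ∈ Finset.range k, (T₁ (i + j) + 1)) + 1 ∧
          Sim C env st' s' ∧ I n st' ∧
          s'.reg 10 ≤ s.reg 10 + (∑ j ∈ Finset.range k, (T₁ (i + j) + 1)) * C.Z := by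
      intro k
      induction k with
      | zero =>
        intro i st s hik hI hs hF
        have e₁ := (hs.env env.length (by simp)).1
        have e₂ := (hs.env (env.length + 1) (by simp)).1
        rw [← add_zero env.length, lookup_append_right] at e₁
        rw [lookup_append_right] at e₂
        simp only [lookup, add_zero] at e₁ e₂
        refine ⟨1, s, st, .whileLt_false (by rw [e₁, e₂]; omega), by omega, hs.restrict, ?_,
          Nat.le_add_right _ _⟩
        have : i = n := by omega
        exact this ▸ hI
      | succ k ihk =>
        intro i st s hik hI hs hF
        have e₁ := (hs.env env.length (by simp)).1
        have e₂ := (hs.env (env.length + 1) (by simp)).1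
        rw [← add_zero env.length, lookup_append_right] at e₁
        rw [lookup_append_right] at e₂
        simp only [lookup, add_zero] at e₁ e₂
        rw [Finset.sum_range_succ'] at hF ⊢
        simp only [add_zero] at hF ⊢
        have hshift : ∀ j, T₁ (i + (j + 1)) + 1 = T₁ (i + 1 + j) + 1 := fun j => by
          rw [add_comm j 1, add_assoc]
        simp only [hshift] at hF ⊢
        have ihk := ihk (i + 1)
        generalize ∑ j ∈ Finset.range k, (T₁ (i + 1 + j) + 1) = S' at hF ihk ⊢
        rw [add_mul, add_mul, one_mul] at hF
        obtain ⟨t₂, s₂, st₂, x₂, l₂, hs₂, hr₂, f₂⟩ := ih _ st (T₁ i) _ s hs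
          (hstep i (by omega) st hI) hW₂ (by rw [add_mul, one_mul]; omega)
        rw [List.length_append] at x₂
        have e₃ := (hs₂.env env.length (by simp)).1
        have e₄ := (hs₂.env (env.length + 1) (by simp)).1
        rw [← add_zero env.length, lookup_append_right] at e₃
        rw [lookup_append_right] at e₄
        simp only [lookup, add_zero] at e₃ e₄
        have k₃ := Keep.setReg env.length s₂ 12 1 (Or.inl rfl)
        have k₄ := Keep.setReg env.length (s₂.setReg 12 1) (regVar env.length) (i + 1)
          (Or.inr le_rfl)
        have k₅ := k₃.trans k₄ le_rfl
        have f₅ := fresh_keep k₅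
        have hs₅ := hs₂.restrict.keep le_rfl k₅ rfl
        have hs₆ := (hs₅.extend (v := i + 1) (setReg_same _ _ _) (by omega)).extend (v := n) (by
          rw [List.length_append, List.length_singleton,
            setReg_ne _ _ (by unfold regVar; omega), setReg_ne _ _ (by unfold regVar; omega)]
          exact e₄) he
        rw [List.append_assoc] at hs₆
        obtain ⟨t₇, s₇, st₇, x₇, l₇, hs₇, hI₇, f₇⟩ := ihk st₂ _ (by omega) hr₂ hs₆
          (by omega)
        refine ⟨_, s₇, st₇, .whileLt_true (by rw [e₁, e₂]; omega)
          (.seq x₂ (.seq (.const s₂ 12 1 (by omega)) (exec_arith (v := i + 1) ?_ (by omega)))) x₇,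
          ?_, hs₇, hI₇, ?_⟩
        · rw [setReg_same, setReg_ne _ _ (by unfold regVar; omega), e₃]; rfl
        · have := add_mul (p.cost mp) 3 (T₁ i)
          rw [mul_add, mul_add, mul_one]
          omega
        · rw [add_mul, add_mul, one_mul]; omega
    have k₂ := Keep.setReg env.length s₁ (regVar env.length) 0 (Or.inr le_rfl)
    have hs₁ := hs.keep (d := env.length + 1) (by omega) k₁ m₁
    have hs₂ := hs₁.keep le_rfl k₂ rfl
    have hs₃ := (hs₂.extend (v := 0) (setReg_same _ _ _) (by omega)).extend (v := n) (by
      rw [List.length_append, List.length_singleton, setReg_ne _ _ (by unfold regVar; omega)]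
      exact r₁) he
    rw [List.append_assoc] at hs₃
    have f₃ : (s₁.setReg (regVar env.length) 0).reg 10 = s.reg 10 := by
      rw [fresh_keep k₂, fresh_keep k₁]
    have hTZ : (1 + ∑ j ∈ Finset.range n, (T₁ j + 1)) * C.Z ≤ T * C.Z := Nat.mul_le_mul_right _ hT
    rw [add_mul] at hTZ
    rw [add_mul] at hF
    obtain ⟨t₄, s₄, st₄, x₄, l₄, hs₄, hI₄, f₄⟩ := iter n 0 st _ (by omega) h0 hs₃ (by
      simp only [zero_add]; omega)
    simp only [zero_add] at l₄ f₄
    refine ⟨_, s₄, st₄, .seq x₁ (.seq (.const s₁ _ 0 (by omega)) x₄), ?_, hs₄, hQ _ hI₄, by omega⟩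
    have hle := Nat.mul_le_mul_right (∑ j ∈ Finset.range n, (T₁ j + 1))
      (by omega : p.cost mp + 3 ≤ e.cost + p.cost mp + 5)
    calc _ ≤ (e.cost + p.cost mp + 5) * (1 + ∑ j ∈ Finset.range n, (T₁ j + 1)) := by
          rw [mul_add, mul_one]; omega
      _ ≤ _ := Nat.mul_le_mul_left _ hT
  | call p ih =>
    intro env st T Q s hs hr hW hF
    obtain ⟨b, A, B, T₁, hT, hb, hsc, hr⟩ := hr
    obtain ⟨W₀, t₀, s₀, x₀, l₀, o₀, hW₀⟩ := hmul b hb A B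
    have hTZ : (f b + T₁ + 1 + 1) * C.Z ≤ (T + 1) * C.Z := Nat.mul_le_mul_right _ (by omega)
    have hTZ' : (f b + T₁ + 1) * C.Z ≤ T * C.Z := Nat.mul_le_mul_right _ (by omega)
    simp only [add_mul, one_mul] at hTZ hTZ' hF
    obtain ⟨t₁, s₁, x₁, l₁, o₁, a₁, m₁⟩ := relocate_mul (m := mp.regBound + 2) (F := s.reg 10)
      (W' := W) x₀ o₀ le_rfl hW₀ (by omega) (S := s) rfl (fun i hi => by
        rw [hs.scr i hi, hsc i hi])
    have k₁ : Keep env.length s s₁ := fun r h₁ h₂ h₃ => o₁.reg r h₂ h₁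
    have f₁ := fresh_keep k₁
    have hs₁ : Sim C env ⟨st.arr, fun i => s₁.mem (s.reg 10 + i)⟩ s₁ := by
      have hf := hs.fresh
      refine ⟨(k₁ 2 (by omega) (by omega) (by omega)).trans hs.zero,
        (k₁ 4 (by omega) (by omega) (by omega)).trans hs.dim,
        (k₁ 6 (by omega) (by omega) (by omega)).trans hs.start,
        (k₁ 8 (by omega) (by omega) (by omega)).trans hs.bound, by rw [f₁]; exact hf,
        fun i hi => ?_, fun i hi => ?_, fun k hk i hi j hj => ?_, fun i hi => by rw [f₁],
        fun i hi => ?_⟩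
      · rw [k₁ (regVar i) (by unfold regVar; omega) (by unfold regVar; omega)
          (by unfold regVar; omega)]
        exact hs.env i hi
      · rw [o₁.mem i (by omega)]; exact hs.inp i hi
      · obtain ⟨-, -, l⟩ := addr_lt hk hi hj
        rw [o₁.mem _ (by omega)]; exact hs.arr k hk i hi j hj
      · rw [f₁] at hi
        rw [o₁.mem _ (by omega)]; exact hs.rest i hi
    have k₂ := Keep.setReg env.length s₁ (regVar env.length) (s₁.reg 3) (Or.inr le_rfl)
    have hs₂ := (hs₁.keep le_rfl k₂ rfl).extend (v := s₁.reg 3) (setReg_same _ _ _) (by omega)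
    have f₂ := fresh_keep k₂
    obtain ⟨t₃, s₃, st₃, x₃, l₃, hs₃, hr₃, f₃⟩ := ih _ _ T₁ _ _ hs₂
      (hr (s₁.reg 3) (fun i => s₁.mem (s.reg 10 + i)) a₁ (fun i hi => m₁ i hi)) hW (by
        rw [add_mul, one_mul]; omega)
    rw [List.length_append, List.length_singleton] at x₃
    have hs₃ := hs₃.restrict
    have ne : ∀ r, r ≠ 10 → (s₃.setReg 10 (s₃.reg 10 + C.Z)).reg r = s₃.reg r :=
      fun r hr => setReg_ne _ _ hr
    refine ⟨_, s₃.setReg 10 (s₃.reg 10 + C.Z), ⟨st₃.arr, fun _ => 0⟩, .seq x₁ (.seq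
      (exec_arith (v := s₁.reg 3) ?_ (by omega)) (.seq x₃
      (exec_arith (v := s₃.reg 10 + C.Z) ?_ (by omega)))), ?_, ?_, hr₃, ?_⟩
    · rw [k₁ 2 (by omega) (by omega) (by omega), hs.zero]; rfl
    · rw [hs₃.bound]; rfl
    · calc _ ≤ (mp.regBound + 7 + p.cost mp) * (f b + T₁ + 1) := by nlinarith
        _ ≤ _ := Nat.mul_le_mul_left _ hT
    · refine ⟨(ne 2 (by omega)).trans hs₃.zero, (ne 4 (by omega)).trans hs₃.dim,
        (ne 6 (by omega)).trans hs₃.start, (ne 8 (by omega)).trans hs₃.bound, ?_,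
        fun i hi => ?_, hs₃.inp, hs₃.arr, fun i hi => ?_, fun i hi => ?_⟩
      · rw [setReg_same]; exact hs₃.fresh.trans (Nat.le_add_right _ _)
      · rw [ne _ (by unfold regVar; omega)]; exact hs₃.env i hi
      -- The new window starts where the old one ends, and `rest` says that the cells there are
      -- still zero.
      · rw [setReg_same]; exact hs₃.rest _ (by omega)
      · rw [setReg_same] at hi; exact hs₃.rest _ (by omega)
    · rw [setReg_same]; omega

end WordRAM

/-! ### Walks in a graph with well-parenthesized forbidden pairs -/

namespace PAFP

/-- A graph with well-parenthesized forbidden pairs, on natural numbers. -/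
structure Graph where
  n : ℕ
  adj : ℕ → ℕ → Prop
  forb : ℕ → ℕ → Prop
  adj_lt : ∀ u v, adj u v → u < v ∧ v < n
  forb_lt : ∀ u v, forb u v → u < v ∧ v < n
  not_halving : ∀ u v x y, forb u v → forb x y → ¬ (u < x ∧ x < v ∧ v < y)

namespace Graph

variable (G : Graph)

/-- `G.Walk u v l`: `l` is the list of vertices of a path from `u` to `v`. -/
inductive Walk : ℕ → ℕ → List ℕ → Prop
  | single (u : ℕ) : Walk u u [u]
  | cons {u w v : ℕ} {l : List ℕ} (h : G.adj u w) (hw : Walk w v l) : Walk u v (u :: l)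

/-- A path from `u` to `v` where forbidden pairs are only allowed if they end in `v` and start
below `θ`. -/
def SafeWalk (u v θ : ℕ) (l : List ℕ) : Prop :=
  G.Walk u v l ∧ ∀ a b, G.forb a b → a ∈ l → b ∈ l → b = v ∧ a < θ

variable {G}

theorem Walk.bounds {u v : ℕ} {l : List ℕ} (h : G.Walk u v l) : ∀ x ∈ l, u ≤ x ∧ x ≤ v := by
  induction h with
  | single u => simp
  | @cons u w v l h hw ih =>
    have hlt := (G.adj_lt _ _ h).1
    intro x hx
    rcases List.mem_cons.1 hx with rfl | hx
    · cases hw with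
      | single => exact ⟨le_rfl, hlt.le⟩
      | cons => exact ⟨le_rfl, hlt.le.trans (ih _ List.mem_cons_self).2⟩
    · exact ⟨hlt.le.trans (ih x hx).1, (ih x hx).2⟩

theorem Walk.mem_left {u v : ℕ} {l : List ℕ} (h : G.Walk u v l) : u ∈ l := by
  cases h <;> simp

theorem Walk.mem_right {u v : ℕ} {l : List ℕ} (h : G.Walk u v l) : v ∈ l := by
  induction h with
  | single => simp
  | cons _ _ ih => exact List.mem_cons_of_mem _ ih

theorem Walk.le {u v : ℕ} {l : List ℕ} (h : G.Walk u v l) : u ≤ v :=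
  (h.bounds u h.mem_left).2

theorem Walk.append {u w z v : ℕ} {l l' : List ℕ} (h : G.Walk u w l) (hz : G.adj w z)
    (h' : G.Walk z v l') : G.Walk u v (l ++ l') := by
  induction h with
  | single => exact .cons hz h'
  | cons h _ ih => exact .cons h (ih hz)

theorem Walk.split {u v θ : ℕ} {l : List ℕ} (h : G.Walk u v l) (hu : u < θ) (hv : θ ≤ v) :
    ∃ w z l₁ l₂, l = l₁ ++ l₂ ∧ G.Walk u w l₁ ∧ w < θ ∧ G.adj w z ∧ θ ≤ z ∧ G.Walk z v l₂ := by
  induction h with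
  | single => omega
  | @cons u w v l h hw ih =>
    by_cases hwθ : w < θ
    · obtain ⟨w', z, l₁, l₂, rfl, h₁, h₂, h₃, h₄, h₅⟩ := ih hwθ hv
      exact ⟨w', z, u :: l₁, l₂, rfl, .cons h h₁, h₂, h₃, h₄, h₅⟩
    · exact ⟨u, w, [u], l, rfl, .single u, hu, h, by omega, hw⟩

/-- The tolerated pairs `{a, v}` with `a < θ` disappear from both pieces: the front piece stays
below `θ ≤ v` and misses `v`, the rear piece stays at or above `θ` and misses `a`. -/
theorem SafeWalk.split {u v θ : ℕ} {l : List ℕ} (h : G.SafeWalk u v θ l) (hu : u < θ)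
    (hv : θ ≤ v) :
    ∃ w z l₁ l₂, l = l₁ ++ l₂ ∧ G.SafeWalk u w 0 l₁ ∧ w < θ ∧ G.adj w z ∧ θ ≤ z ∧
      G.SafeWalk z v 0 l₂ := by
  obtain ⟨w, z, l₁, l₂, rfl, h₁, h₂, h₃, h₄, h₅⟩ := h.1.split hu hv
  refine ⟨w, z, l₁, l₂, rfl, ⟨h₁, fun a b hab ha hb => ?_⟩, h₂, h₃, h₄,
    ⟨h₅, fun a b hab ha hb => ?_⟩⟩
  · have := h.2 a b hab (List.mem_append_left _ ha) (List.mem_append_left _ hb)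
    have := (h₁.bounds b hb).2
    omega
  · have := h.2 a b hab (List.mem_append_right _ ha) (List.mem_append_right _ hb)
    have := (h₅.bounds a ha).1
    omega

/-- This is where the pairs must not be halving. A pair `{a, b}` across the edge has `a ≤ w < θ` and
`z ≤ b`. If `z = v`, then `b = v`. Otherwise `θ < z`, and `b ≠ v` would give `a < θ < b < v` against
the pair `{θ, v}`. -/
theorem SafeWalk.append {u w z v θ : ℕ} {l l' : List ℕ} (h : G.SafeWalk u w 0 l) (hw : w < θ)
    (hz : G.adj w z) (h' : G.SafeWalk z v 0 l') (hθ : z = v ∨ θ < z ∧ G.forb θ v) :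
    G.SafeWalk u v θ (l ++ l') := by
  refine ⟨h.1.append hz h'.1, fun a b hab ha hb => ?_⟩
  have hwz := (G.adj_lt _ _ hz).1
  have hlt := (G.forb_lt _ _ hab).1
  rcases List.mem_append.1 ha with ha | ha <;> rcases List.mem_append.1 hb with hb | hb
  · have := h.2 a b hab ha hb; omega
  · have h₁ := (h.1.bounds a ha).2
    have h₂ := h'.1.bounds b hb
    refine ⟨?_, by omega⟩
    rcases hθ with rfl | ⟨hθ, hv⟩
    · omega
    · by_contra hne
      exact G.not_halving _ _ _ _ hab hv ⟨by omega, by omega, by omega⟩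
  · have h₁ := (h.1.bounds b hb).2
    have h₂ := (h'.1.bounds a ha).1
    omega
  · have := h'.2 a b hab ha hb; omega

theorem SafeWalk.of_zero {u v θ : ℕ} {l : List ℕ} (h : G.SafeWalk u v 0 l) :
    G.SafeWalk u v θ l :=
  ⟨h.1, fun a b hab ha hb => by have := h.2 a b hab ha hb; omega⟩

theorem SafeWalk.single (u θ : ℕ) : G.SafeWalk u u θ [u] :=
  ⟨.single u, fun a b hab ha hb => by
    have := (G.forb_lt _ _ hab).1
    simp only [List.mem_singleton] at ha hb
    omega⟩

/-- The part of a layout that has been built so far: `N` positions, where position `p` belongs to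
the vertex `vt p` and has the threshold `thr p`.  The thresholds of a vertex are the vertex
itself, followed by its partners in decreasing order. -/
structure PreLayout (G : Graph) (N : ℕ) (vt thr : ℕ → ℕ) : Prop where
  vt_lt : ∀ p < N, vt p < G.n
  mono : ∀ p q, p ≤ q → q < N → vt p ≤ vt q
  step : ∀ p < N, thr p = vt p ∧ (p = 0 ∨ vt (p - 1) < vt p) ∨
    (1 ≤ p ∧ vt (p - 1) = vt p ∧ G.forb (thr p) (vt p) ∧ thr p < thr (p - 1) ∧
      ∀ x, G.forb x (vt p) → x < thr (p - 1) → x ≤ thr p)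

/-- A complete layout, where `en v` is the last position of the vertex `v`. -/
structure Layout (G : Graph) (N : ℕ) (vt thr en : ℕ → ℕ) : Prop extends PreLayout G N vt thr where
  en_lt : ∀ v < G.n, en v < N
  vt_en : ∀ v < G.n, vt (en v) = v
  le_en : ∀ p < N, p ≤ en (vt p)
  last : ∀ v < G.n, ∀ x, G.forb x v → thr (en v) ≤ x

/-! ### The length of a layout -/

section PreLayout

variable {N : ℕ} {vt thr : ℕ → ℕ}

theorem PreLayout.thr_le (h : PreLayout G N vt thr) {p : ℕ} (hp : p < N) : thr p ≤ vt p := by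
  rcases h.step p hp with h' | ⟨_, _, h', _⟩
  · exact h'.1.le
  · exact (G.forb_lt _ _ h').1.le

theorem PreLayout.thr_lt (h : PreLayout G N vt thr) {p : ℕ} :
    ∀ {q : ℕ}, p < q → q < N → vt p = vt q → thr q < thr p := by
  intro q
  induction q with
  | zero => intro h; omega
  | succ q ih =>
    intro hpq hq he
    have h₁ := h.mono p q (by omega) (by omega)
    rcases h.step (q + 1) hq with h' | ⟨_, h₂, _, h₃, _⟩
    · simp at h'; omega
    · simp only [Nat.add_sub_cancel] at h₂ h₃
      rcases Nat.lt_or_ge p q with hlt | hge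
      · exact h₃.trans (ih hlt (by omega) (by omega))
      · have : p = q := by omega
        exact this ▸ h₃

/-- Each vertex has one first position and at most one second position. A later position `p` is
charged to the threshold `y` of the position before it, which is a partner of `vt p`; the halving
condition allows each `y` to be charged only once. The three kinds give three residues modulo 3
below `3n`. The bound is stated for unfinished layouts since it also keeps the writes within the
arrays during the construction. -/
theorem PreLayout.card_le (h : PreLayout G N vt thr) : N ≤ 3 * G.n := by
  classical
  have first : ∀ {p q : ℕ}, p < N → q < N → thr p = vt p → thr q = vt q → vt p = vt q → p ≤ q := by
    intro p q hp hq ep eq e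
    by_contra hlt
    have := h.thr_lt (p := q) (q := p) (by omega) hp e.symm
    omega
  have forb_of : ∀ {p : ℕ}, p < N → thr p ≠ vt p → 1 ≤ p ∧ vt (p - 1) = vt p ∧
      G.forb (thr p) (vt p) ∧ thr p < thr (p - 1) := by
    intro p hp hne
    rcases h.step p hp with h' | ⟨h₁, h₂, h₃, h₄, _⟩
    · exact absurd h'.1 hne
    · exact ⟨h₁, h₂, h₃, h₄⟩
  have third : ∀ {p q : ℕ}, p < N → q < N → thr p ≠ vt p → thr q ≠ vt q →
      thr (p - 1) ≠ vt p → thr (q - 1) ≠ vt q → thr (p - 1) = thr (q - 1) → p ≤ q := by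
    intro p q hp hq ep eq ep' eq' e
    obtain ⟨p₁, p₂, p₃, p₄⟩ := forb_of hp ep
    obtain ⟨q₁, q₂, q₃, q₄⟩ := forb_of hq eq
    obtain ⟨-, -, p₅, -⟩ := forb_of (p := p - 1) (by omega) (by rwa [p₂])
    obtain ⟨-, -, q₅, -⟩ := forb_of (p := q - 1) (by omega) (by rwa [q₂])
    have l₁ := G.forb_lt _ _ p₅
    have l₂ := G.forb_lt _ _ q₅
    rw [p₂] at p₅
    rw [q₂] at q₅
    -- If `y` precedes both thresholds and `vt p < vt q`, then `{thr p, vt p}` and `{y, vt q}` are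
    -- halving, as `thr p < y < vt p < vt q`. The second instance treats `vt q < vt p`; for equal
    -- vertices the thresholds decrease strictly.
    have n₁ := G.not_halving _ _ _ _ p₃ q₅
    have n₂ := G.not_halving _ _ _ _ q₃ p₅
    by_contra hlt
    have := h.thr_lt (p := q - 1) (q := p - 1) (by omega) (by omega) (by omega)
    omega
  let φ : ℕ → ℕ := fun p => if thr p = vt p then 3 * vt p else
    if thr (p - 1) = vt p then 3 * vt p + 1 else 3 * thr (p - 1) + 2
  have hφ : ∀ p ∈ Finset.range N, φ p ∈ Finset.range (3 * G.n) := by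
    intro p hp
    have hp := Finset.mem_range.1 hp
    have h₁ := h.vt_lt p hp
    simp only [φ, Finset.mem_range]
    split_ifs with c₁ c₂
    · omega
    · omega
    · have h₂ := h.thr_le (p := p - 1) (by omega)
      have h₃ := h.vt_lt (p - 1) (by omega)
      omega
  have hinj : Set.InjOn φ (Finset.range N) := by
    have key : ∀ p < N, ∀ q < N, φ p = φ q → p ≤ q := by
      intro p hp q hq e
      simp only [φ] at e
      split_ifs at e with c₁ c₂ c₃ c₄ c₅ c₆ c₇
      · exact first hp hq c₁ c₂ (by omega)
      · omega
      · omega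
      · omega
      · obtain ⟨p₁, p₂, -⟩ := forb_of hp c₁
        obtain ⟨q₁, q₂, -⟩ := forb_of hq c₅
        have := first (p := p - 1) (q := q - 1) (by omega) (by omega) (by omega) (by omega)
          (by omega)
        omega
      · omega
      · omega
      · omega
      · exact third hp hq c₁ (by assumption) c₄ (by assumption) (by omega)
    intro p hp q hq e
    simp only [Finset.coe_range, Set.mem_Iio] at hp hq
    exact le_antisymm (key p hp q hq e) (key q hq p hp e.symm)
  simpa using Finset.card_le_card_of_injOn φ hφ hinj

end PreLayout

/-! ### The tables -/

section Tables

variable (G) (vt thr en : ℕ → ℕ)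

/-- There is a path from the vertex of `a` to position `p`. -/
def TabS (a p : ℕ) : Prop := en (vt a) = a ∧ ∃ l, G.SafeWalk (vt a) (vt p) (thr p) l

/-- There is a safe path between the vertices of two last positions. -/
def TabR (a p : ℕ) : Prop := en (vt p) = p ∧ TabS G vt thr en a p

/-- There is an edge between the vertices of two last positions. -/
def TabE (a p : ℕ) : Prop := en (vt a) = a ∧ en (vt p) = p ∧ G.adj (vt a) (vt p)

/-- There is a path to position `p` that starts behind the threshold. -/
def TabT (a p : ℕ) : Prop := thr p < vt a ∧ TabS G vt thr en a p

/-- There is a path to position `p` whose first edge jumps over the threshold. -/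
def TabD (a p : ℕ) : Prop := en (vt a) = a ∧ vt a < thr p ∧
  (G.adj (vt a) (vt p) ∨ ∃ q, a < q ∧ q < p ∧ TabE G vt en a q ∧ TabT G vt thr en q p)

end Tables

/-! ### Recurrences for the tables -/

section Layout

variable {N : ℕ} {vt thr en : ℕ → ℕ}

theorem Layout.vt_lt_vt (h : Layout G N vt thr en) {a p : ℕ} (ha : en (vt a) = a) (hap : a < p)
    (hp : p < N) : vt a < vt p := by
  have h₁ := h.mono a p hap.le hp
  have h₂ := h.le_en p hp
  rcases h₁.lt_or_eq with h₃ | h₃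
  · exact h₃
  · rw [← h₃, ha] at h₂; omega

theorem Layout.lt_en (h : Layout G N vt thr en) {a z : ℕ} (ha : a < N) (hz : z < G.n)
    (haz : vt a < z) : a < en z := by
  by_contra hlt
  have h₁ := h.mono (en z) a (by omega) ha
  rw [h.vt_en z hz] at h₁
  omega

theorem Layout.en_lt_pos (h : Layout G N vt thr en) {p z : ℕ} (hz : z < G.n)
    (hzp : z < vt p) : en z < p := by
  by_contra hlt
  have h₁ := h.mono p (en z) (by omega) (h.en_lt z hz)
  rw [h.vt_en z hz] at h₁
  omega

/-- At a last position the threshold is at most every partner of the vertex, so no pair is tolerated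
any more. -/
theorem Layout.safeWalk_zero (h : Layout G N vt thr en) {u q : ℕ} (hq : q < N)
    (he : en (vt q) = q) {l : List ℕ} (hl : G.SafeWalk u (vt q) (thr q) l) :
    G.SafeWalk u (vt q) 0 l := by
  refine ⟨hl.1, fun a b hab ha hb => ?_⟩
  obtain ⟨rfl, h₁⟩ := hl.2 a b hab ha hb
  have := h.last _ (h.vt_lt q hq) a hab
  rw [he] at this
  omega

theorem Layout.forb_thr (h : Layout G N vt thr en) {p : ℕ} (hp : p < N) (hlt : thr p < vt p) :
    1 ≤ p ∧ vt (p - 1) = vt p ∧ G.forb (thr p) (vt p) ∧ thr p < thr (p - 1) ∧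
      ∀ x, G.forb x (vt p) → x < thr (p - 1) → x ≤ thr p := by
  rcases h.step p hp with h' | h'
  · omega
  · exact h'

theorem SafeWalk.zero_of_le {u v θ : ℕ} {l : List ℕ} (h : G.SafeWalk u v θ l) (hu : θ ≤ u) :
    G.SafeWalk u v 0 l :=
  ⟨h.1, fun a b hab ha hb => by
    have h₁ := h.2 a b hab ha hb
    have h₂ := (h.1.bounds a ha).1
    omega⟩

/-- The paths that arise by jumping over the threshold of `p`, from a given path. -/
theorem Layout.join_adj (h : Layout G N vt thr en) {u q p : ℕ} (hq : q < N) (he : en (vt q) = q)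
    (hlt : vt q < thr p) (hadj : G.adj (vt q) (vt p)) {l : List ℕ}
    (hl : G.SafeWalk u (vt q) (thr q) l) : G.SafeWalk u (vt p) (thr p) (l ++ [vt p]) :=
  (h.safeWalk_zero hq he hl).append hlt hadj (.single _ _) (Or.inl rfl)

theorem Layout.join (h : Layout G N vt thr en) {u q r p : ℕ} (hq : q < N) (hp : p < N)
    (he : en (vt q) = q) (hlt : vt q < thr p) (hadj : G.adj (vt q) (vt r)) (hr : thr p < vt r)
    (hrp : vt r < vt p) {l l' : List ℕ} (hl : G.SafeWalk u (vt q) (thr q) l)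
    (hl' : G.SafeWalk (vt r) (vt p) (thr p) l') : G.SafeWalk u (vt p) (thr p) (l ++ l') :=
  (h.safeWalk_zero hq he hl).append hlt hadj (hl'.zero_of_le hr.le)
    (Or.inr ⟨hr, (h.forb_thr hp (by omega)).2.2.1⟩)

/-- Split the walk at the edge `w → z` that jumps over the threshold. The rear part together with
this edge is recorded in `TabD` at the last position of `w`; the front part is either empty (`w` is
the start) or recorded in `TabR`. Using last positions as the only intermediate indices represents
each vertex once. -/
theorem Layout.tabS_of_lt (h : Layout G N vt thr en) {a p : ℕ} (ha : en (vt a) = a) (hap : a < p)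
    (hp : p < N) (hlt : vt a < thr p) :
    TabS G vt thr en a p ↔ TabD G vt thr en a p ∨
      ∃ q, a < q ∧ q < p ∧ TabR G vt thr en a q ∧ TabD G vt thr en q p := by
  have hvt := h.vt_lt_vt ha hap hp
  have join : ∀ {q}, q < p → ∀ {l}, G.SafeWalk (vt a) (vt q) (thr q) l → TabD G vt thr en q p →
      TabS G vt thr en a p := by
    intro q hqp l hl hD
    obtain ⟨hq, hqt, hadj | ⟨r, hqr, hrp, hE, hr, hr', l', hl'⟩⟩ := hD
    · exact ⟨ha, _, h.join_adj (by omega) hq hqt hadj hl⟩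
    · exact ⟨ha, _, h.join (by omega) hp hq hqt hE.2.2 hr (h.vt_lt_vt hr' hrp hp) hl hl'⟩
  constructor
  · rintro ⟨-, l, hl⟩
    obtain ⟨w, z, l₁, l₂, rfl, h₁, h₂, h₃, h₄, h₅⟩ := hl.split hlt (h.thr_le hp)
    have hw : w < G.n := ((G.adj_lt _ _ h₃).1.trans (G.adj_lt _ _ h₃).2)
    have hz : z < G.n := (G.adj_lt _ _ h₃).2
    have hD : TabD G vt thr en (en w) p := by
      have e := h.vt_en w hw
      refine ⟨by rw [e], by rwa [e], ?_⟩
      rw [e]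
      rcases h₅.1.le.lt_or_eq with hzv | rfl
      · right
        -- If `z` were the threshold itself, the rear part would contain the pair `{z, v}`, although
        -- it is entirely safe.
        have hθz : thr p < z := by
          rcases h₄.lt_or_eq with h' | h'
          · exact h'
          · obtain ⟨-, -, hf, -⟩ := h.forb_thr hp (by omega)
            have := h₅.2 _ _ hf (h' ▸ h₅.1.mem_left) h₅.1.mem_right
            omega
        have ez := h.vt_en z hz
        refine ⟨en z, h.lt_en (h.en_lt w hw) hz (by rw [e]; exact (G.adj_lt _ _ h₃).1),
          h.en_lt_pos hz hzv, ⟨by rw [e], by rw [ez], by rw [e, ez]; exact h₃⟩,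
          by rwa [ez], by rw [ez], l₂, by rw [ez]; exact h₅.of_zero⟩
      · exact Or.inl h₃
    rcases h₁.1.le.lt_or_eq with hlt | hueq
    · right
      have e := h.vt_en w hw
      have h₆ := h.thr_le hp
      exact ⟨en w, h.lt_en (by omega) hw hlt, h.en_lt_pos hw (by omega),
        ⟨by rw [e], ha, l₁, by rw [e]; exact h₁.of_zero⟩, hD⟩
    · left
      rw [← hueq, ha] at hD
      exact hD
  · rintro (hD | ⟨q, haq, hqp, hR, hD⟩)
    · exact join hap (.single _ _) hD
    · obtain ⟨l, hl⟩ := hR.2.2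
      exact join hqp hl hD

/-- Such a walk contains the pair formed by the threshold and the end vertex, which is not tolerated
because `a < θ` is strict. -/
theorem Layout.not_tabS (h : Layout G N vt thr en) {a p : ℕ} (ha : en (vt a) = a) (hap : a < p)
    (hp : p < N) (hlt : vt a = thr p) : ¬ TabS G vt thr en a p := by
  rintro ⟨-, l, hl⟩
  have hvt := h.vt_lt_vt ha hap hp
  obtain ⟨-, -, hf, -⟩ := h.forb_thr hp (by omega)
  have := hl.2 _ _ hf (hlt ▸ hl.1.mem_left) hl.1.mem_right
  omega

theorem Layout.pred_of_lt (h : Layout G N vt thr en) {a p : ℕ} (ha : en (vt a) = a) (hap : a < p)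
    (hp : p < N) (hlt : thr p < vt a) : a < p - 1 ∧ vt (p - 1) = vt p := by
  have hvt := h.vt_lt_vt ha hap hp
  obtain ⟨h₁, h₂, -⟩ := h.forb_thr hp (by omega)
  refine ⟨?_, h₂⟩
  rcases Nat.lt_or_ge a (p - 1) with h' | h'
  · exact h'
  · have : a = p - 1 := by omega
    rw [this] at hvt; omega

/-- A walk that starts behind the threshold of `p` could only profit from the weaker threshold of `p
- 1` through a partner strictly between the two, and consecutive thresholds have none. -/
theorem Layout.safeWalk_pred (h : Layout G N vt thr en) {u p : ℕ} (hup : u < vt p)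
    (hp : p < N) (hlt : thr p < u) {l : List ℕ} :
    G.SafeWalk u (vt p) (thr p) l ↔ G.SafeWalk u (vt (p - 1)) (thr (p - 1)) l := by
  obtain ⟨h₁, h₂, -, h₃, h₄⟩ := h.forb_thr hp (by omega)
  rw [h₂]
  constructor
  · intro hl
    exact (hl.zero_of_le hlt.le).of_zero
  · intro hl
    refine ⟨hl.1, fun a b hab ha hb => ?_⟩
    obtain ⟨rfl, h₅⟩ := hl.2 a b hab ha hb
    have h₆ := h₄ a hab h₅
    have := (hl.1.bounds a ha).1
    omega

theorem Layout.tabS_of_gt (h : Layout G N vt thr en) {a p : ℕ} (ha : en (vt a) = a) (hap : a < p)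
    (hp : p < N) (hlt : thr p < vt a) :
    TabS G vt thr en a p ↔ TabS G vt thr en a (p - 1) := by
  have hvt := h.vt_lt_vt ha hap hp
  simp only [TabS, h.safeWalk_pred hvt hp hlt]

end Layout

end Graph

end PAFP

namespace WordRAM

/-! ### Rules for statements -/

section Rules

variable {C : Ctx} {f : ℕ → ℕ} {env : List ℕ} {st : Store} {Q : Store → Prop}

theorem Run.seq {p q : Stmt} {T₁ T₂ : ℕ} {R : Store → Prop} (h₁ : Run C f p env st T₁ R)
    (h₂ : ∀ st', R st' → Run C f q env st' T₂ Q) : Run C f (.seq p q) env st (T₁ + T₂) Q :=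
  ⟨T₁, T₂, le_rfl, h₁.mono le_rfl h₂⟩

theorem Run.ite {p q : Stmt} {a b : Expr} {T : ℕ} (ha : a.Ok C env st) (hb : b.Ok C env st)
    (h₁ : a.eval C env st < b.eval C env st → Run C f p env st T Q)
    (h₂ : ¬ a.eval C env st < b.eval C env st → Run C f q env st T Q) :
    Run C f (.ite a b p q) env st (T + 1) Q :=
  ⟨⟨ha, hb⟩, T, le_rfl, h₁, h₂⟩

theorem Run.bind {p : Stmt} {e : Expr} {T v : ℕ} (ho : e.Ok C env st) (hv : e.eval C env st = v)
    (hlt : v < C.Z) (h : Run C f p (env ++ [v]) st T Q) :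
    Run C f (.bind e p) env st (T + 1) Q := by
  subst hv; exact ⟨⟨ho, hlt⟩, T, le_rfl, h⟩

theorem Run.loop {p : Stmt} {e : Expr} {n : ℕ} (I : ℕ → Store → Prop) (T : ℕ → ℕ)
    (ho : e.Ok C env st) (hn : e.eval C env st = n) (hlt : n < C.Z) (h0 : I 0 st)
    (hs : ∀ i < n, ∀ st', I i st' → Run C f p (env ++ [i, n]) st' (T i) (I (i + 1))) :
    Run C f (.loop e p) env st (1 + ∑ i ∈ Finset.range n, (T i + 1)) (I n) := by
  subst hn; exact ⟨⟨ho, hlt⟩, I, T, le_rfl, h0, hs, fun _ h => h⟩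

theorem Run.loop_const {p : Stmt} {e : Expr} {n : ℕ} (I : ℕ → Store → Prop) (T : ℕ)
    (ho : e.Ok C env st) (hn : e.eval C env st = n) (hlt : n < C.Z) (h0 : I 0 st)
    (hs : ∀ i < n, ∀ st', I i st' → Run C f p (env ++ [i, n]) st' T (I (i + 1))) :
    Run C f (.loop e p) env st (1 + n * (T + 1)) (I n) := by
  have := Run.loop I (fun _ => T) ho hn hlt h0 hs
  simpa using this

theorem Run.put {k : ℕ} {i j e : Expr} (hk : k < C.K) (hi : i.Ok C env st) (hj : j.Ok C env st)
    (he : e.Ok C env st) (hi' : i.eval C env st < C.M) (hj' : j.eval C env st < C.M)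
    (he' : e.eval C env st < C.Z)
    (hQ : Q (st.put k (i.eval C env st) (j.eval C env st) (e.eval C env st))) :
    Run C f (.put k i j e) env st 1 Q :=
  ⟨le_rfl, ⟨hk, hi, hj, he, hi', hj', he'⟩, hQ⟩

theorem Run.skip (hQ : Q st) : Run C f .skip env st 1 Q := ⟨le_rfl, hQ⟩

theorem Run.le {p : Stmt} {T T' : ℕ} (h : Run C f p env st T Q) (hT : T ≤ T') :
    Run C f p env st T' Q := h.mono hT fun _ h => h

end Rules

instance : Add Expr := ⟨.op .add⟩
instance : Sub Expr := ⟨.op .sub⟩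
instance : Mul Expr := ⟨.op .mul⟩
instance : Div Expr := ⟨.op .div⟩

section Simp

variable (C : Ctx) (env : List ℕ) (st : Store) (a b : Expr)

theorem Expr.eval_sub : (a - b).eval C env st = a.eval C env st - b.eval C env st := rfl
theorem Expr.ok_sub : (a - b).Ok C env st ↔ a.Ok C env st ∧ b.Ok C env st := Iff.rfl
theorem Expr.ok_div : (a / b).Ok C env st ↔ a.Ok C env st ∧ b.Ok C env st := Iff.rfl

end Simp

/-! ### Multiplying blocks -/

/-- With the numbers `b`, `i₀`, `w₀`, `j₀` in the variables 7, 11, 12, 13, add the product of the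
blocks of dimension `b` at `(i₀, w₀)` of array `kX` and at `(w₀, j₀)` of array `kY` to the block at
`(i₀, j₀)` of array `kP`. -/
def blockMul (kX kY kP : ℕ) : Stmt :=
  .seq (.sput (.num 0) (.var 7)) <|
  .seq (.loop (.var 7) <| .loop (.var 7) <| .seq
    (.sput (.num 1 + (.var 14 * .var 7 + .var 16))
      (.get kX (.var 11 + .var 14) (.var 12 + .var 16)))
    (.sput (.num 1 + (.var 7 * .var 7 + (.var 14 * .var 7 + .var 16)))
      (.get kY (.var 12 + .var 14) (.var 13 + .var 16)))) <|
  .call <| .loop (.var 7) <| .loop (.var 7) <|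
    .ite (.num 0) (.scr (.var 14 + (.var 15 * .var 7 + .var 17)))
      (.put kP (.var 11 + .var 15) (.var 13 + .var 17) (.num 1)) .skip

theorem index_lt {b i j : ℕ} (hi : i < b) (hj : j < b) : i * b + j < b * b := by nlinarith

theorem index_inj {b i j i' j' : ℕ} (hj : j < b) (hj' : j' < b)
    (h : i * b + j = i' * b + j') : i = i' ∧ j = j' := by
  have h₁ := congrArg (· / b) h
  simp only [mul_comm _ b, Nat.mul_add_div (by omega : 0 < b), Nat.div_eq_of_lt hj,
    Nat.div_eq_of_lt hj', add_zero] at h₁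
  subst h₁
  exact ⟨rfl, by omega⟩

/-- The scratch array when `m` entries of each factor have been written. -/
def scratch (b : ℕ) (xs ys : ℕ → ℕ) (m x : ℕ) : ℕ :=
  if x = 0 then b else if x < 1 + m then xs (x - 1) else
    if 1 + b * b ≤ x ∧ x < 1 + b * b + m then ys (x - 1 - b * b) else 0

theorem scratch_step {b m : ℕ} {xs ys : ℕ → ℕ} (hm : m < b * b) {st : Store}
    (h : st.scr = scratch b xs ys m) :
    ((st.sput (1 + m) (xs m)).sput (1 + (b * b + m)) (ys m)).scr = scratch b xs ys (m + 1) := by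
  funext x
  simp only [Store.sput, h]
  by_cases h₁ : x = 1 + (b * b + m)
  · subst h₁
    rw [Function.update_self, scratch, if_neg (by omega), if_neg (by omega), if_pos (by omega)]
    congr 1; omega
  · rw [Function.update_of_ne h₁]
    by_cases h₂ : x = 1 + m
    · subst h₂
      rw [Function.update_self, scratch, if_neg (by omega), if_pos (by omega)]
      congr 1; omega
    · rw [Function.update_of_ne h₂]
      unfold scratch
      split_ifs <;> first | rfl | omega

theorem scratch_final {b : ℕ} (A B : Fin b → Fin b → Bool) (x : ℕ) :
    scratch b (fun m => (encodeMatrix A).getD m 0) (fun m => (encodeMatrix B).getD m 0) (b * b) x =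
      (b :: (encodeMatrix A ++ encodeMatrix B)).getD x 0 := by
  unfold scratch
  cases x with
  | zero => simp
  | succ x =>
    rw [List.getD_cons_succ, if_neg (by omega)]
    split_ifs with h₁ h₂
    · rw [List.getD_append _ _ _ _ (by rw [encodeMatrix_length]; omega)]; rfl
    · rw [List.getD_append_right _ _ _ _ (by rw [encodeMatrix_length]; omega),
        encodeMatrix_length]; rfl
    · rw [List.getD_append_right _ _ _ _ (by rw [encodeMatrix_length]; omega),
        List.getD_eq_default]
      rw [encodeMatrix_length, encodeMatrix_length]; omega

/-- The numbers below the dimension of the arrays and their squares are small. -/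
structure Ctx.Large (C : Ctx) : Prop where
  K : C.K = 14
  Z : 8 * (C.M * C.M) + 100 ≤ C.Z
  M : 8 ≤ C.M

/-- The result of a block multiplication. -/
def BlockPost (kX kY kP b i₀ w₀ j₀ : ℕ) (st st' : Store) : Prop :=
  st'.scr = (fun _ => 0) ∧ (∀ k a p, k ≠ kP → st'.arr k a p = st.arr k a p) ∧
  ∀ a p, (st'.arr kP a p = st.arr kP a p ∨ st'.arr kP a p = 1) ∧
    (st'.arr kP a p ≠ st.arr kP a p → ∃ q, st.arr kX a q = 1 ∧ st.arr kY q p = 1) ∧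
    ∀ q, i₀ ≤ a → a < i₀ + b → w₀ ≤ q → q < w₀ + b → j₀ ≤ p → p < j₀ + b →
      st.arr kX a q = 1 → st.arr kY q p = 1 → st'.arr kP a p = 1

-- The two blocks are written into the scratch array in the input format of the multiplication
-- program. The ones of the product are merged into array `kP` without erasing anything, so
-- contributions accumulate over many calls.
set_option maxHeartbeats 1000000 in
theorem blockMul_run {C : Ctx} (hC : C.Large) (f : ℕ → ℕ) {kX kY kP b i₀ w₀ j₀ : ℕ}
    (hX : kX < 14) (hY : kY < 14) (hP : kP < 14)
    (hi : i₀ + b ≤ C.M) (hw : w₀ + b ≤ C.M) (hj : j₀ + b ≤ C.M) {st : Store}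
    (hscr : st.scr = fun _ => 0) (hXb : ∀ a p, st.arr kX a p ≤ 1) (hYb : ∀ a p, st.arr kY a p ≤ 1)
    (x₀ x₁ x₂ x₃ x₄ x₅ x₆ x₈ x₉ x₁₀ : ℕ) :
    Run C f (blockMul kX kY kP) [x₀, x₁, x₂, x₃, x₄, x₅, x₆, b, x₈, x₉, x₁₀, i₀, w₀, j₀] st
      (f b + 10 * (b * b) + 10) (BlockPost kX kY kP b i₀ w₀ j₀ st) := by
  obtain ⟨hK, hZ, hM⟩ := hC
  have hbM : b ≤ C.M := by omega
  have hbb : b * b ≤ C.M * C.M := Nat.mul_le_mul hbM hbM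
  have hMM : C.M ≤ C.M * C.M := Nat.le_mul_of_pos_left _ (by omega)
  let A : Fin b → Fin b → Bool := fun i j => decide (st.arr kX (i₀ + i) (w₀ + j) = 1)
  let B : Fin b → Fin b → Bool := fun i j => decide (st.arr kY (w₀ + i) (j₀ + j) = 1)
  have hxs : ∀ i < b, ∀ j < b, (encodeMatrix A).getD (i * b + j) 0 =
      st.arr kX (i₀ + i) (w₀ + j) := by
    intro i hi j hj
    rw [encodeMatrix_getD A hi hj]
    have := hXb (i₀ + i) (w₀ + j)
    by_cases h : st.arr kX (i₀ + i) (w₀ + j) = 1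
    · simp [A, h]
    · simp only [A, h, decide_false, Bool.toNat_false]; omega
  have hys : ∀ i < b, ∀ j < b, (encodeMatrix B).getD (i * b + j) 0 =
      st.arr kY (w₀ + i) (j₀ + j) := by
    intro i hi j hj
    rw [encodeMatrix_getD B hi hj]
    have := hYb (w₀ + i) (j₀ + j)
    by_cases h : st.arr kY (w₀ + i) (j₀ + j) = 1
    · simp [B, h]
    · simp only [B, h, decide_false, Bool.toNat_false]; omega
  set xs : ℕ → ℕ := fun m => (encodeMatrix A).getD m 0 with hxs'
  set ys : ℕ → ℕ := fun m => (encodeMatrix B).getD m 0 with hys'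
  have h1 : Run C f (.sput (.num 0) (.var 7))
      [x₀, x₁, x₂, x₃, x₄, x₅, x₆, b, x₈, x₉, x₁₀, i₀, w₀, j₀] st 1
      fun st' => st'.arr = st.arr ∧ st'.scr = scratch b xs ys 0 := by
    refine ⟨le_rfl, ?_, rfl, ?_⟩
    · simp [Expr.Ok, Expr.eval, lookup]; omega
    · funext x
      simp only [Store.sput, Expr.eval, lookup, hscr, scratch, Function.update_apply]
      split_ifs <;> first | rfl | omega
  refine Run.le (Run.seq h1 (T₂ := f b + 10 * (b * b) + 9) fun st₁ hst₁ => ?_) (by omega)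
  have h2 := Run.loop_const (C := C) (f := f) (e := .var 7)
    (env := [x₀, x₁, x₂, x₃, x₄, x₅, x₆, b, x₈, x₉, x₁₀, i₀, w₀, j₀]) (st := st₁) (n := b)
    (p := .loop (.var 7) <| .seq
    (.sput (.num 1 + (.var 14 * .var 7 + .var 16))
      (.get kX (.var 11 + .var 14) (.var 12 + .var 16)))
    (.sput (.num 1 + (.var 7 * .var 7 + (.var 14 * .var 7 + .var 16)))
      (.get kY (.var 12 + .var 14) (.var 13 + .var 16))))
    (fun i st' => st'.arr = st.arr ∧ st'.scr = scratch b xs ys (i * b)) (1 + b * (2 + 1))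
    (by simp [Expr.Ok]) (by simp [Expr.eval, lookup]) (by omega) (by simpa using hst₁) (by
      intro i hi st₂ hst₂
      refine Run.mono (Run.loop_const (n := b)
        (fun j st' => st'.arr = st.arr ∧ st'.scr = scratch b xs ys (i * b + j)) 2
        (by simp [Expr.Ok]) (by simp [Expr.eval, lookup]) (by omega) (by simpa using hst₂) ?_)
        le_rfl (fun st' h => by rwa [add_mul, one_mul])
      intro j hj st₃ hst₃
      have hij := index_lt hi hj
      refine Run.seq (T₁ := 1) (T₂ := 1) (R := fun st' => st' = st₃.sput (1 + (i * b + j))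
        (xs (i * b + j))) ⟨le_rfl, ?_, ?_⟩ ?_
      · have := hXb (i₀ + i) (w₀ + j)
        simp only [Expr.Ok, List.cons_append, List.nil_append,
          List.length_cons, List.length_nil, Expr.eval, Op.eval, lookup,
          hst₃.1]
        refine ⟨⟨?_, ?_, ?_⟩, ⟨?_, ?_, ?_⟩, ?_⟩ <;> omega
      · simp only [List.cons_append, List.nil_append, Expr.eval, Op.eval,
          lookup, hst₃.1, ← hxs i hi j hj]
        rfl
      · rintro st₄ rfl
        refine ⟨le_rfl, ?_, ?_⟩
        · have := hYb (w₀ + i) (j₀ + j)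
          simp only [Expr.Ok, List.cons_append, List.nil_append,
            List.length_cons, List.length_nil, Expr.eval, Op.eval, lookup,
            hst₃.1, Store.sput]
          refine ⟨⟨?_, ?_, ?_⟩, ⟨?_, ?_, ?_⟩, ?_⟩ <;> omega
        · simp only [List.cons_append, List.nil_append, Expr.eval, Op.eval,
            lookup]
          refine ⟨hst₃.1, ?_⟩
          have := scratch_step hij hst₃.2
          rw [← add_assoc (i * b), ← this]
          simp only [Store.sput, hst₃.1, ← hys i hi j hj]
          rfl)
  refine Run.le (Run.seq h2 (T₂ := f b + 5 * (b * b) + 6) fun st₂ hst₂ => ?_) (by nlinarith)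
  refine ⟨b, A, B, 1 + b * (1 + b * (2 + 1) + 1), by nlinarith, hbM, fun x _ => ?_,
    fun a scr ha hout => ?_⟩
  · rw [hst₂.2, ← scratch_final]
  have hmul : ∀ i < b, ∀ j < b, (scr (a + (i * b + j)) ≤ 1) ∧
      (0 < scr (a + (i * b + j)) ↔ ∃ w < b, st.arr kX (i₀ + i) (w₀ + w) = 1 ∧
        st.arr kY (w₀ + w) (j₀ + j) = 1) := by
    intro i hi j hj
    rw [hout _ (index_lt hi hj), encodeMatrix_getD _ hi hj]
    refine ⟨Bool.toNat_le _, ?_⟩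
    simp only [boolMul, A, B, Nat.pos_iff_ne_zero, ne_eq, Bool.toNat_eq_zero, Bool.not_eq_false,
      decide_eq_true_eq]
    exact ⟨fun ⟨w, h⟩ => ⟨w, w.2, h⟩, fun ⟨w, hw, h⟩ => ⟨⟨w, hw⟩, h⟩⟩
  -- Loop invariant when the first `m` entries of the product, in row-major order, have been merged.
  -- All conditions refer to the tables before the call.
  let I : ℕ → Store → Prop := fun m st' => st'.scr = scr ∧
    (∀ k a p, k ≠ kP → st'.arr k a p = st.arr k a p) ∧
    ∀ a p, (st'.arr kP a p = st.arr kP a p ∨ st'.arr kP a p = 1) ∧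
    (st'.arr kP a p ≠ st.arr kP a p → ∃ q, st.arr kX a q = 1 ∧ st.arr kY q p = 1) ∧
    ∀ i j q, i < b → j < b → i * b + j < m → a = i₀ + i → p = j₀ + j → w₀ ≤ q → q < w₀ + b →
      st.arr kX a q = 1 → st.arr kY q p = 1 → st'.arr kP a p = 1
  refine Run.mono (Run.loop_const (n := b) (fun i st' => I (i * b) st') (1 + b * (2 + 1))
    (by simp [Expr.Ok]) (by simp [Expr.eval, lookup]) (by omega) ?_ ?_) le_rfl ?_
  · refine ⟨rfl, fun k a p _ => by rw [hst₂.1], fun a p => ⟨Or.inl (by rw [hst₂.1]), fun h => ?_,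
      fun i j q _ _ h => by omega⟩⟩
    exact absurd (by rw [hst₂.1]) h
  · intro i hi st₃ hst₃
    refine Run.mono (Run.loop_const (n := b) (fun j st' => I (i * b + j) st') (1 + 1)
        (by simp [Expr.Ok]) (by simp [Expr.eval, lookup]) (by omega) (by simpa using hst₃) ?_)
        le_rfl (fun st' h => by rwa [add_mul, one_mul])
    intro j hj st₄ hst₄
    have hij := index_lt hi hj
    obtain ⟨h₁, h₂, h₃⟩ := hst₄
    obtain ⟨m₁, m₂⟩ := hmul i hi j hj
    have hlast : ∀ {i' j' : ℕ}, j' < b → i' * b + j' < i * b + (j + 1) →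
        i' * b + j' < i * b + j ∨ (i' = i ∧ j' = j) := by
      intro i' j' hj' hlt
      rcases Nat.lt_or_ge (i' * b + j') (i * b + j) with h | h
      · exact Or.inl h
      · exact Or.inr (index_inj hj' hj (by omega))
    refine Run.ite ?_ ?_ ?_ ?_
    · simp only [Expr.Ok]; omega
    · simp only [Expr.Ok, List.cons_append, List.nil_append,
        List.length_cons, List.length_nil, Expr.eval, Op.eval, lookup, h₁]
      omega
    · intro hpos
      simp only [List.cons_append, List.nil_append, Expr.eval, Op.eval,
        lookup, h₁] at hpos
      obtain ⟨w, hw', hw₁, hw₂⟩ := m₂.1 hpos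
      refine Run.put (by omega) ?_ ?_ ?_ ?_ ?_ ?_ ?_
      iterate 6
        simp only [Expr.Ok, List.cons_append, List.nil_append,
          List.length_cons, List.length_nil, Expr.eval, Op.eval, lookup]
        omega
      simp only [List.cons_append, List.nil_append, Expr.eval, Op.eval, lookup]
      refine ⟨h₁, fun k a p hk => ?_, fun a p => ?_⟩
      · rw [Store.put_arr, if_neg (by tauto)]; exact h₂ k a p hk
      · rw [Store.put_arr]
        split_ifs with h
        · obtain ⟨-, rfl, rfl⟩ := h
          exact ⟨Or.inr rfl, fun _ => ⟨_, hw₁, hw₂⟩, fun _ _ _ _ _ _ _ _ _ _ _ _ => rfl⟩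
        · refine ⟨(h₃ a p).1, (h₃ a p).2.1, fun i' j' q hi' hj' hlt ha' hp' => ?_⟩
          rcases hlast hj' hlt with hlt | ⟨rfl, rfl⟩
          · exact (h₃ a p).2.2 i' j' q hi' hj' hlt ha' hp'
          · exact absurd ⟨rfl, ha', hp'⟩ h
    · intro hpos
      simp only [List.cons_append, List.nil_append, Expr.eval, Op.eval,
        lookup, h₁] at hpos
      refine Run.skip ⟨h₁, h₂, fun a p => ⟨(h₃ a p).1, (h₃ a p).2.1,
        fun i' j' q hi' hj' hlt ha' hp' hq hq' hx hy => ?_⟩⟩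
      rcases hlast hj' hlt with hlt | ⟨rfl, rfl⟩
      · exact (h₃ a p).2.2 i' j' q hi' hj' hlt ha' hp' hq hq' hx hy
      · subst ha' hp'
        refine absurd (m₂.2 ⟨q - w₀, by omega, ?_⟩) hpos
        rw [Nat.add_sub_cancel' hq]
        exact ⟨hx, hy⟩
  · rintro st' ⟨h₁, h₂, h₃⟩
    refine ⟨rfl, h₂, fun a p => ⟨(h₃ a p).1, (h₃ a p).2.1, fun q a₁ a₂ q₁ q₂ p₁ p₂ hx hy => ?_⟩⟩
    exact (h₃ a p).2.2 (a - i₀) (p - j₀) q (by omega) (by omega)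
      (index_lt (by omega) (by omega)) (by omega) (by omega) q₁ q₂ hx hy

end WordRAM

/-! ### Block products of partly known tables and their dyadic schedule -/

namespace PAFP

open WordRAM PAFP.Graph

/-- Array `k` of the store holds the relation `X` on the domain `D`. -/
def Tab (st : Store) (k : ℕ) (D X : ℕ → ℕ → Prop) : Prop :=
  ∀ a p, st.arr k a p ≤ 1 ∧ (st.arr k a p = 1 ↔ D a p ∧ X a p)

/-- Array `k` of the store holds a part of the product of the relations `X` and `Y` that contains
the contributions from the blocks in `B`. -/
structure Acc (st : Store) (k N : ℕ) (X Y : ℕ → ℕ → Prop) (B : ℕ → ℕ → ℕ → ℕ → Prop) : Prop where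
  le_one : ∀ a p, st.arr k a p ≤ 1
  sound : ∀ a p, st.arr k a p = 1 → ∃ q, a < q ∧ q < p ∧ X a q ∧ Y q p
  complete : ∀ b I W J, B b I W J → ∀ a q p, a / b = I → q / b = W → p / b = J → p < N →
    a < q → q < p → X a q → Y q p → st.arr k a p = 1

/-- A block whose columns all lie at or beyond `N` counts as done without any work, since
completeness is only claimed for `p < N`. -/
theorem Acc.mono {st : Store} {k N : ℕ} {X Y : ℕ → ℕ → Prop} {B B' : ℕ → ℕ → ℕ → ℕ → Prop}
    (h : Acc st k N X Y B) (hB : ∀ b I W J, B' b I W J → B b I W J ∨ N ≤ J * b) :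
    Acc st k N X Y B' := by
  refine ⟨h.le_one, h.sound, fun b I W J hb a q p ha hq hp hpN => ?_⟩
  rcases hB b I W J hb with h' | h'
  · exact h.complete b I W J h' a q p ha hq hp hpN
  · have := Nat.div_mul_le_self p b
    rw [hp] at this; omega

/-- The pairs of positions with a difference of less than `d`. -/
def Near (N d a p : ℕ) : Prop := a < p ∧ p < N ∧ p < a + d

/-- The contents of the arrays when the tables have been computed on the domain `D` and the
products of the blocks in `B` have been added up. -/
structure Inv (G : Graph) (N : ℕ) (vt thr en : ℕ → ℕ) (D : ℕ → ℕ → Prop)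
    (B : ℕ → ℕ → ℕ → ℕ → Prop) (st : Store) : Prop where
  scr : st.scr = fun _ => 0
  vt_eq : st.arr 1 0 = vt
  thr_eq : st.arr 2 0 = thr
  en_eq : st.arr 3 0 = en
  tabE : Tab st 4 D (TabE G vt en)
  tabR : Tab st 5 D (TabR G vt thr en)
  tabD : Tab st 6 D (TabD G vt thr en)
  tabT : Tab st 7 D (TabT G vt thr en)
  accR : Acc st 8 N (TabR G vt thr en) (TabD G vt thr en) B
  accE : Acc st 9 N (TabE G vt en) (TabT G vt thr en) B
  tabS : Tab st 10 D (TabS G vt thr en)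

section

variable {G : Graph} {N : ℕ} {vt thr en : ℕ → ℕ} {D : ℕ → ℕ → Prop}
  {B B' : ℕ → ℕ → ℕ → ℕ → Prop} {st st' : Store}

theorem Inv.congr (h : Inv G N vt thr en D B st) (hs : st'.scr = st.scr)
    (ha : ∀ k, 0 < k → k ≤ 10 → st'.arr k = st.arr k) : Inv G N vt thr en D B st' := by
  have hT : ∀ k, 0 < k → k ≤ 10 → ∀ X, Tab st k D X → Tab st' k D X := by
    intro k hk hk' X h; unfold Tab; rw [ha k hk hk']; exact h
  have hA : ∀ k, 0 < k → k ≤ 10 → ∀ X Y, Acc st k N X Y B → Acc st' k N X Y B := by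
    intro k hk hk' X Y h
    exact ⟨by rw [ha k hk hk']; exact h.1, by rw [ha k hk hk']; exact h.2,
      by rw [ha k hk hk']; exact h.3⟩
  refine ⟨hs.trans h.scr, ?_, ?_, ?_, hT 4 (by simp) (by simp) _ h.tabE,
    hT 5 (by simp) (by simp) _ h.tabR, hT 6 (by simp) (by simp) _ h.tabD,
    hT 7 (by simp) (by simp) _ h.tabT, hA 8 (by simp) (by simp) _ _ h.accR,
    hA 9 (by simp) (by simp) _ _ h.accE, hT 10 (by simp) (by simp) _ h.tabS⟩
  · rw [ha 1 (by simp) (by simp)]; exact h.vt_eq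
  · rw [ha 2 (by simp) (by simp)]; exact h.thr_eq
  · rw [ha 3 (by simp) (by simp)]; exact h.en_eq

theorem Inv.mono (h : Inv G N vt thr en D B st)
    (hB : ∀ b I W J, B' b I W J → B b I W J ∨ N ≤ J * b) : Inv G N vt thr en D B' st :=
  ⟨h.scr, h.vt_eq, h.thr_eq, h.en_eq, h.tabE, h.tabR, h.tabD, h.tabT, h.accR.mono hB,
    h.accE.mono hB, h.tabS⟩

end

/-- Unknown entries are 0, so a premature block product is still sound; it is complete if all
entries of both factor blocks are known. The differences in block `(I, W)` are less than `(W + 1) *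
b - I * b`, hence the two comparisons with `d`. -/
theorem Acc.block {st st' : Store} {kX kY kP N d b I W J : ℕ} {X Y : ℕ → ℕ → Prop}
    {B : ℕ → ℕ → ℕ → ℕ → Prop} (hb : 0 < b) (hX : Tab st kX (Near N d) X)
    (hY : Tab st kY (Near N d) Y) (h : Acc st kP N X Y B)
    (hst : BlockPost kX kY kP b (I * b) (W * b) (J * b) st st') :
    Acc st' kP N X Y fun b' I' W' J' => B b' I' W' J' ∨
      ((b' = b ∧ I' = I ∧ W' = W ∧ J' = J) ∧ (W + 1) * b ≤ d + I * b ∧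
        (J + 1) * b ≤ d + W * b) := by
  obtain ⟨-, -, hP⟩ := hst
  refine ⟨fun a p => ?_, fun a p h1 => ?_, ?_⟩
  · have := h.le_one a p
    have := (hP a p).1
    omega
  · by_cases e : st'.arr kP a p = st.arr kP a p
    · exact h.sound a p (e ▸ h1)
    · obtain ⟨q, hx, hy⟩ := (hP a p).2.1 e
      obtain ⟨d₁, x⟩ := (hX a q).2.1 hx
      obtain ⟨d₂, y⟩ := (hY q p).2.1 hy
      exact ⟨q, d₁.1, d₂.1, x, y⟩
  · rintro b' I' W' J' (hB | ⟨⟨rfl, rfl, rfl, rfl⟩, h₁, h₂⟩) a q p ha hq hp hpN haq hqp hx hy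
    · have := h.complete _ _ _ _ hB a q p ha hq hp hpN haq hqp hx hy
      have := (hP a p).1
      omega
    · have bounds : ∀ {x y : ℕ}, x / b' = y → y * b' ≤ x ∧ x < (y + 1) * b' := by
        intro x y hxy
        subst hxy
        exact ⟨Nat.div_mul_le_self _ _, by
          rw [mul_comm]; exact Nat.lt_mul_div_succ x hb⟩
      have ba := bounds ha
      have bq := bounds hq
      have bp := bounds hp
      refine (hP a p).2.2 q ba.1 (by linarith [ba.2]) bq.1 (by linarith [bq.2]) bp.1
        (by linarith [bp.2]) ((hX a q).2.2 ⟨⟨haq, by omega, by linarith⟩, hx⟩)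
        ((hY q p).2.2 ⟨⟨hqp, by omega, by linarith⟩, hy⟩)

/-- Add one block to the set of blocks. -/
def addBlock (B : ℕ → ℕ → ℕ → ℕ → Prop) (d b I W J : ℕ) : ℕ → ℕ → ℕ → ℕ → Prop :=
  fun b' I' W' J' => B b' I' W' J' ∨ ((b' = b ∧ I' = I ∧ W' = W ∧ J' = J) ∧
    (W + 1) * b ≤ d + I * b ∧ (J + 1) * b ≤ d + W * b)

/-- The products of the blocks with the given indices, with `N` in the variable 1, the dimension
in the variable 7 and the first index in the variable 9. -/
def cube (w j : Expr) : Stmt :=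
  .bind (.var 9 * .var 7) <| .bind (w * .var 7) <| .bind (j * .var 7) <|
    .ite (.var 13) (.var 1) (.seq (blockMul 5 6 8) (blockMul 4 7 9)) .skip

/-- The time for the products of all blocks with a given first index. -/
def cubeTime (f : ℕ → ℕ) (b : ℕ) : ℕ := 2 * (f b + 10 * (b * b) + 10) + 4

theorem Run.block {C : Ctx} (hC : C.Large) (f : ℕ → ℕ) {G : Graph} {N d b I W J : ℕ}
    {vt thr en : ℕ → ℕ} {B : ℕ → ℕ → ℕ → ℕ → Prop} {st : Store} (hb : 0 < b)
    (hI : I * b + b ≤ C.M) (hW : W * b + b ≤ C.M) (hJ : J * b + b ≤ C.M)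
    (h : Inv G N vt thr en (Near N d) B st) (x₀ x₁ x₂ x₃ x₄ x₅ x₆ x₈ x₉ x₁₀ : ℕ) :
    Run C f (.seq (blockMul 5 6 8) (blockMul 4 7 9))
      [x₀, x₁, x₂, x₃, x₄, x₅, x₆, b, x₈, x₉, x₁₀, I * b, W * b, J * b] st
      (2 * (f b + 10 * (b * b) + 10))
      fun st' => Inv G N vt thr en (Near N d) (addBlock B d b I W J) st' ∧
        st'.arr 0 = st.arr 0 := by
  rw [two_mul]
  refine Run.seq (blockMul_run hC f (by omega) (by omega) (by omega) hI hW hJ h.scr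
    (fun a p => (h.tabR a p).1) (fun a p => (h.tabD a p).1) ..) fun st₁ h₁ => ?_
  have e₁ : ∀ k, k ≠ 8 → st₁.arr k = st.arr k := fun k hk => by
    funext a p; exact h₁.2.1 k a p hk
  refine (blockMul_run hC f (by omega) (by omega) (by omega) hI hW hJ h₁.1
    (fun a p => by rw [e₁ 4 (by simp)]; exact (h.tabE a p).1)
    (fun a p => by rw [e₁ 7 (by simp)]; exact (h.tabT a p).1) ..).mono le_rfl fun st₂ h₂ => ?_
  have e₂ : ∀ k, k ≠ 9 → st₂.arr k = st₁.arr k := fun k hk => by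
    funext a p; exact h₂.2.1 k a p hk
  have e₃ : ∀ k, k ≠ 8 → k ≠ 9 → st₂.arr k = st.arr k := fun k hk hk' => by
    rw [e₂ k hk', e₁ k hk]
  have hT : ∀ k, k ≠ 8 → k ≠ 9 → ∀ X, Tab st k (Near N d) X → Tab st₂ k (Near N d) X := by
    intro k hk hk' X h; unfold Tab; rw [e₃ k hk hk']; exact h
  have hT' : ∀ k, k ≠ 8 → ∀ X, Tab st k (Near N d) X → Tab st₁ k (Near N d) X := by
    intro k hk X h; unfold Tab; rw [e₁ k hk]; exact h
  refine ⟨⟨h₂.1, ?_, ?_, ?_, hT 4 (by simp) (by simp) _ h.tabE, hT 5 (by simp) (by simp) _ h.tabR,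
    hT 6 (by simp) (by simp) _ h.tabD, hT 7 (by simp) (by simp) _ h.tabT, ?_, ?_,
    hT 10 (by simp) (by simp) _ h.tabS⟩, e₃ 0 (by simp) (by simp)⟩
  · rw [e₃ 1 (by simp) (by simp)]; exact h.vt_eq
  · rw [e₃ 2 (by simp) (by simp)]; exact h.thr_eq
  · rw [e₃ 3 (by simp) (by simp)]; exact h.en_eq
  · have := Acc.block hb h.tabR h.tabD h.accR h₁
    exact ⟨by rw [e₂ 8 (by simp)]; exact this.1, by rw [e₂ 8 (by simp)]; exact this.2,
      by rw [e₂ 8 (by simp)]; exact this.3⟩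
  · exact Acc.block hb (hT' 4 (by simp) _ h.tabE) (hT' 7 (by simp) _ h.tabT)
      ⟨by rw [e₁ 9 (by simp)]; exact h.accE.1, by rw [e₁ 9 (by simp)]; exact h.accE.2,
      by rw [e₁ 9 (by simp)]; exact h.accE.3⟩ h₂

/-- Blocks may stick out beyond `N`, but only by less than `b ≤ N` when they start below `N`; arrays
of dimension at least `2N` have room for them. Blocks with `N ≤ J * b` are skipped. -/
theorem cube_run {C : Ctx} (hC : C.Large) (f : ℕ → ℕ) {G : Graph} {N d b I W J : ℕ}
    {vt thr en : ℕ → ℕ} {B : ℕ → ℕ → ℕ → ℕ → Prop} {st : Store} (hb : 0 < b) (hbN : b ≤ N)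
    (hN : 2 * N ≤ C.M) (hIW : I ≤ W) (hWJ : W ≤ J) (hJ : J * b < C.Z) {w j : Expr}
    {x₀ x₂ x₃ x₄ x₅ x₆ x₈ x₁₀ : ℕ}
    (hw : ∀ y, w.Ok C [x₀, N, x₂, x₃, x₄, x₅, x₆, b, x₈, I, x₁₀, y] st)
    (hw' : ∀ y, w.eval C [x₀, N, x₂, x₃, x₄, x₅, x₆, b, x₈, I, x₁₀, y] st = W)
    (hj : ∀ y z, j.Ok C [x₀, N, x₂, x₃, x₄, x₅, x₆, b, x₈, I, x₁₀, y, z] st)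
    (hj' : ∀ y z, j.eval C [x₀, N, x₂, x₃, x₄, x₅, x₆, b, x₈, I, x₁₀, y, z] st = J)
    (h : Inv G N vt thr en (Near N d) B st) :
    Run C f (cube w j) [x₀, N, x₂, x₃, x₄, x₅, x₆, b, x₈, I, x₁₀] st (cubeTime f b)
      fun st' => Inv G N vt thr en (Near N d) (addBlock B d b I W J) st' ∧
        st'.arr 0 = st.arr 0 := by
  have l₁ : W * b ≤ J * b := Nat.mul_le_mul_right _ hWJ
  have l₂ : I * b ≤ W * b := Nat.mul_le_mul_right _ hIW
  refine Run.bind (v := I * b) ?_ ?_ (by omega) ?_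
  · exact ⟨by simp [Expr.Ok], by simp [Expr.Ok]⟩
  · rfl
  refine Run.bind (v := W * b) ?_ ?_ (by omega) ?_
  · exact ⟨hw _, by simp [Expr.Ok]⟩
  · change w.eval _ _ _ * _ = _
    simp only [List.cons_append, List.nil_append]
    rw [hw']; rfl
  refine Run.bind (v := J * b) ?_ ?_ hJ ?_
  · exact ⟨hj _ _, by simp [Expr.Ok]⟩
  · change j.eval _ _ _ * _ = _
    simp only [List.cons_append, List.nil_append]
    rw [hj']; rfl
  refine Run.ite (by simp [Expr.Ok]) (by simp [Expr.Ok]) (fun hlt => ?_) (fun hlt => ?_)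
  · simp only [List.cons_append, List.nil_append, Expr.eval, lookup] at hlt
    exact Run.block hC f hb (by omega) (by omega) (by omega) h ..
  · simp only [List.cons_append, List.nil_append, Expr.eval, lookup] at hlt
    refine (Run.skip (Q := fun st' => Inv G N vt thr en (Near N d) (addBlock B d b I W J) st' ∧
        st'.arr 0 = st.arr 0) ⟨h.mono fun b' I' W' J' hB => ?_, rfl⟩).le (by omega)
    rcases hB with hB | ⟨⟨rfl, rfl, rfl, rfl⟩, -⟩
    · exact Or.inl hB
    · exact Or.inr (by omega)

/-- The blocks of rows `I`, `W`, `J` have the distances 2 or 3 and `e`, where `e` is the larger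
one. -/
def Combo (e I W J : ℕ) : Prop :=
  (W = I + 2 ∧ J = W + e ∧ 2 ≤ e) ∨ (W = I + 3 ∧ J = W + e ∧ 3 ≤ e) ∨
    (W = I + e ∧ J = W + 2 ∧ 2 ≤ e) ∨ (W = I + e ∧ J = W + 3 ∧ 3 ≤ e)

/-- The blocks that have been multiplied before the distance `d` is treated. -/
def Blocks (d b I W J : ℕ) : Prop := ∃ k e, b = 2 ^ k ∧ b * (e + 1) ≤ d ∧ Combo e I W J

/-- Double the block size until one of the two block distances would drop below 2. Just before that,
both are at least 2 and one is at most 3, because block numbers that differ by 4 or more still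
differ by at least 2 after halving. -/
theorem exists_block {a q p : ℕ} (h₁ : a + 2 ≤ q) (h₂ : q + 2 ≤ p) :
    ∃ b, Blocks (p - a) b (a / b) (q / b) (p / b) := by
  have key : ∀ K, (¬ (a / 2 ^ K + 2 ≤ q / 2 ^ K ∧ q / 2 ^ K + 2 ≤ p / 2 ^ K)) →
      ∃ k, (a / 2 ^ k + 2 ≤ q / 2 ^ k ∧ q / 2 ^ k + 2 ≤ p / 2 ^ k) ∧
        ¬ (a / 2 ^ (k + 1) + 2 ≤ q / 2 ^ (k + 1) ∧ q / 2 ^ (k + 1) + 2 ≤ p / 2 ^ (k + 1)) := by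
    intro K
    induction K with
    | zero => intro h; exact absurd ⟨by simpa using h₁, by simpa using h₂⟩ h
    | succ K ih =>
      intro h
      by_cases h' : a / 2 ^ K + 2 ≤ q / 2 ^ K ∧ q / 2 ^ K + 2 ≤ p / 2 ^ K
      · exact ⟨K, h', h⟩
      · exact ih h'
  -- The doubling stops: at scale `2 ^ p` the block number of `p` is 0.
  obtain ⟨k, ⟨k₁, k₂⟩, k₃⟩ := key p (by
    rw [Nat.div_eq_of_lt (Nat.lt_two_pow_self (n := p))]
    exact fun h => Nat.not_succ_le_zero _ h.2)
  simp only [pow_succ, ← Nat.div_div_eq_div_mul] at k₃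
  have hb : 0 < 2 ^ k := by positivity
  have ha : a < (a / 2 ^ k + 1) * 2 ^ k := by
    rw [mul_comm]; exact Nat.lt_mul_div_succ a hb
  have hp := Nat.div_mul_le_self p (2 ^ k)
  -- The block distance from `a` to `p` is `e` plus the smaller distance, hence at least `e + 2`.
  -- This makes the product due before the distance `p - a` is treated.
  have bound : ∀ e, a / 2 ^ k + 1 + (e + 1) ≤ p / 2 ^ k → 2 ^ k * (e + 1) ≤ p - a := by
    intro e he
    have := Nat.mul_le_mul_right (2 ^ k) he
    rw [add_mul, mul_comm (e + 1)] at this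
    omega
  refine ⟨2 ^ k, k, max (q / 2 ^ k - a / 2 ^ k) (p / 2 ^ k - q / 2 ^ k), rfl, bound _ ?_, ?_⟩
  · omega
  · unfold Combo
    omega

/-- All block products that become due when the distance in the variable 4 has been treated. -/
def blockStage : Stmt :=
  .seq (.put 0 (.num 0) (.num 1) (.num 1)) <|
  .loop (.var 1) <| .bind (.get 0 (.num 0) (.num 1)) <| .ite (.var 1) (.var 7) .skip <|
    .seq (.ite (.var 4 + .num 1 - (.var 4 + .num 1) / .var 7 * .var 7) (.num 1)
      (.bind ((.var 4 + .num 1) / .var 7 - .num 1) <| .loop (.var 1 / .var 7 + .num 1) <|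
        .seq (cube (.var 9 + .num 2) (.var 9 + .num 2 + .var 8)) <|
        .seq (cube (.var 9 + .num 3) (.var 9 + .num 3 + .var 8)) <|
        .seq (cube (.var 9 + .var 8) (.var 9 + .var 8 + .num 2)) <|
        cube (.var 9 + .var 8) (.var 9 + .var 8 + .num 3))
      .skip)
    (.put 0 (.num 0) (.num 1) (.var 7 + .var 7))

/-- The time for the multiplications of blocks of dimension `2 ^ k` after distance `d`. -/
def levelTime (f : ℕ → ℕ) (N d k : ℕ) : ℕ :=
  if 2 ^ k ∣ d + 1 ∧ 2 ^ k ≤ N then (N / 2 ^ k + 1) * (4 * cubeTime f (2 ^ k) + 1) else 0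

-- At scale `b` something becomes due exactly if `b (e + 1) = d + 1` for some `e`, that is, if `b`
-- divides `d + 1`. Then the four shapes of `Combo` are multiplied for every first block index. For
-- small `e` some of these products are superfluous, but they do no harm.
set_option maxHeartbeats 1000000 in
theorem blockStage_run {C : Ctx} (hC : C.Large) (f : ℕ → ℕ) {G : Graph} {N d : ℕ}
    {vt thr en : ℕ → ℕ} {st : Store} (hd : d < N) (hN : 2 * N ≤ C.M)
    (h : Inv G N vt thr en (Near N (d + 1)) (Blocks d) st) (x₀ x₂ x₃ : ℕ) :
    Run C f blockStage [x₀, N, x₂, x₃, d] st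
      (2 + ∑ k ∈ Finset.range N, (levelTime f N d k + 6 + 1))
      (Inv G N vt thr en (Near N (d + 1)) (Blocks (d + 1))) := by
  obtain ⟨hK, hZ, hM⟩ := id hC
  have hMM : 8 * C.M ≤ C.M * C.M := Nat.mul_le_mul_right _ hM
  have put0 : ∀ {D B st} v, Inv G N vt thr en D B st → Inv G N vt thr en D B (st.put 0 0 1 v) := by
    intro D B st v h
    exact h.congr rfl fun k hk _ => by
      funext a p; rw [Store.put_arr, if_neg (by omega)]
  -- The cell with the block dimension is no longer doubled once it exceeds `N`, so that it stays at
  -- most `2N`; from then on it need not be `2 ^ k`, but both numbers exceed `N`.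
  let J : ℕ → Store → Prop := fun k st' =>
    Inv G N vt thr en (Near N (d + 1))
      (fun b I W J => Blocks d b I W J ∨ ∃ k' e, k' < k ∧ b = 2 ^ k' ∧ b * (e + 1) = d + 1 ∧
        Combo e I W J) st' ∧
    (st'.arr 0 0 1 = 2 ^ k ∧ 2 ^ k ≤ 2 * N ∨ N < st'.arr 0 0 1 ∧ N < 2 ^ k) ∧
    st'.arr 0 0 1 ≤ 2 * N
  have h1 : Run C f (.put 0 (.num 0) (.num 1) (.num 1)) [x₀, N, x₂, x₃, d] st 1 (J 0) := by
    refine Run.put (by omega) ?_ ?_ ?_ ?_ ?_ ?_ ?_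
    iterate 6
      simp only [Expr.Ok, Expr.eval]
      omega
    simp only [Expr.eval]
    refine ⟨(put0 1 h).mono fun b I W J hB => Or.inl ?_, Or.inl ⟨?_, ?_⟩, ?_⟩
    · rcases hB with hB | ⟨k', _, hk, _⟩
      · exact hB
      · omega
    · simp [Store.put_arr]
    · simp only [pow_zero]; omega
    · rw [Store.put_arr, if_pos ⟨rfl, rfl, rfl⟩]; omega
  refine Run.le (Run.seq h1 (T₂ := 1 + ∑ k ∈ Finset.range N, (levelTime f N d k + 6 + 1))
    fun st₁ hst₁ => ?_) (by omega)
  refine Run.mono (Run.loop (n := N) J (fun k => levelTime f N d k + 6) (by simp [Expr.Ok])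
    (by simp [Expr.eval, lookup]) (by omega) hst₁ ?_) le_rfl ?_
  · intro k hk st₂ hst₂
    obtain ⟨hinv, hval, hle⟩ := hst₂
    refine Run.bind (v := st₂.arr 0 0 1) ?_ (by simp [Expr.eval]) (by omega) (T :=
      levelTime f N d k + 5) ?_
    · simp only [Expr.Ok, Expr.eval]
      omega
    generalize hb : st₂.arr 0 0 1 = b at hval hle
    refine Run.ite (by simp [Expr.Ok]) (by simp [Expr.Ok]) (fun hlt => ?_) (fun hlt => ?_)
      (T := levelTime f N d k + 4)
    · simp only [List.cons_append, List.nil_append, Expr.eval, lookup] at hlt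
      refine (Run.skip (Q := J (k + 1)) ⟨hinv.mono fun b' I' W' J' hB => ?_, Or.inr ?_, ?_⟩).le
        (by omega)
      · rcases hB with hB | ⟨k', e, hk', rfl, he, hc⟩
        · exact Or.inl (Or.inl hB)
        · rcases Nat.lt_or_ge k' k with hlt' | hge
          · exact Or.inl (Or.inr ⟨k', e, hlt', rfl, he, hc⟩)
          · right
            have : k' = k := by omega
            subst this
            have : 1 ≤ J' := by unfold Combo at hc; omega
            have := Nat.mul_le_mul_right (2 ^ k') this
            omega
      · have : 2 ^ k ≤ 2 ^ (k + 1) := Nat.pow_le_pow_right (by omega) (by omega)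
        omega
      · omega
    · simp only [List.cons_append, List.nil_append, Expr.eval, lookup] at hlt
      have hbk : b = 2 ^ k := by omega
      have hb0 : 0 < b := hbk ▸ (by positivity)
      have hdiv := Nat.div_mul_le_self (d + 1) b
      have hdivN := Nat.div_mul_le_self N b
      have hdN : N / b ≤ N := Nat.div_le_self _ _
      have hdd : (d + 1) / b ≤ d + 1 := Nat.div_le_self _ _
      let J' : ℕ → Store → Prop := fun I₀ st' =>
        Inv G N vt thr en (Near N (d + 1))
          (fun b' I W J => (Blocks d b' I W J ∨ ∃ k' e, k' < k ∧ b' = 2 ^ k' ∧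
            b' * (e + 1) = d + 1 ∧ Combo e I W J) ∨
            (∃ e, b' = b ∧ b' * (e + 1) = d + 1 ∧ Combo e I W J ∧ I < I₀)) st' ∧
        st'.arr 0 = st₂.arr 0
      have hbody : Run C f (.ite (.var 4 + .num 1 - (.var 4 + .num 1) / .var 7 * .var 7) (.num 1)
          (.bind ((.var 4 + .num 1) / .var 7 - .num 1) <| .loop (.var 1 / .var 7 + .num 1) <|
          .seq (cube (.var 9 + .num 2) (.var 9 + .num 2 + .var 8)) <|
          .seq (cube (.var 9 + .num 3) (.var 9 + .num 3 + .var 8)) <|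
          .seq (cube (.var 9 + .var 8) (.var 9 + .var 8 + .num 2)) <|
          cube (.var 9 + .var 8) (.var 9 + .var 8 + .num 3))
          .skip) [x₀, N, x₂, x₃, d, k, N, b] st₂ (levelTime f N d k + 3) (J' (N / b + 1)) := by
        refine Run.ite (T := levelTime f N d k + 2) ?_ ?_ (fun hlt' => ?_) (fun hlt' => ?_)
        · simp only [Expr.Ok, Expr.ok_sub, Expr.ok_div, List.length_cons, List.length_nil]
          omega
        · simp only [Expr.Ok]; omega
        · have hlt' : d + 1 - (d + 1) / b * b < 1 := hlt'
          have heq : (d + 1) / b * b = d + 1 := by omega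
          have hpos : 0 < (d + 1) / b := by
            rcases Nat.eq_zero_or_pos ((d + 1) / b) with h0 | h0
            · rw [h0] at heq; omega
            · exact h0
          have hlev : levelTime f N d k = (N / b + 1) * (4 * cubeTime f b + 1) := by
            rw [levelTime, hbk, if_pos]
            exact ⟨hbk ▸ Dvd.intro_left _ heq, by omega⟩
          obtain ⟨e, he⟩ : ∃ e, (d + 1) / b = e + 1 := ⟨(d + 1) / b - 1, by omega⟩
          rw [he] at heq
          have hM' : e * b ≤ N := by rw [add_mul] at heq; omega
          refine Run.bind (v := e) (T := levelTime f N d k + 1) ?_ ?_ (by omega) ?_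
          · simp only [Expr.Ok, Expr.ok_sub, Expr.ok_div, List.length_cons, List.length_nil]
            omega
          · change (d + 1) / b - 1 = e
            omega
          rw [hlev, add_comm _ 1]
          refine Run.mono (Run.loop_const (n := N / b + 1) J' (4 * cubeTime f b) ?_ ?_ (by omega)
            ⟨hinv.mono fun b' I W J hB => Or.inl ?_, rfl⟩ ?_) le_rfl (fun _ h => h)
          · simp only [Expr.Ok, Expr.ok_div, List.cons_append, List.nil_append,
              List.length_cons, List.length_nil]
            omega
          · rfl
          · rcases hB with hB | ⟨e, -, -, -, h0⟩
            · exact hB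
            · omega
          · intro I hI st₃ hst₃
            have hIb : I * b ≤ N := (Nat.mul_le_mul_right b (by omega : I ≤ N / b)).trans hdivN
            have hrun : ∀ {w j : Expr} {W J : ℕ} {B : ℕ → ℕ → ℕ → ℕ → Prop} {st : Store}, I ≤ W →
                W ≤ J → J ≤ I + e + 3 →
                (∀ y, w.Ok C [x₀, N, x₂, x₃, d, k, N, b, e, I, N / b + 1, y] st) →
                (∀ y, w.eval C [x₀, N, x₂, x₃, d, k, N, b, e, I, N / b + 1, y] st = W) →
                (∀ y z, j.Ok C [x₀, N, x₂, x₃, d, k, N, b, e, I, N / b + 1, y, z] st) →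
                (∀ y z, j.eval C [x₀, N, x₂, x₃, d, k, N, b, e, I, N / b + 1, y, z] st = J) →
                Inv G N vt thr en (Near N (d + 1)) B st → st.arr 0 = st₂.arr 0 →
                Run C f (cube w j) [x₀, N, x₂, x₃, d, k, N, b, e, I, N / b + 1] st (cubeTime f b)
                fun st' => Inv G N vt thr en (Near N (d + 1)) (addBlock B (d + 1) b I W J) st' ∧
                  st'.arr 0 = st₂.arr 0 := by
              intro w j W J B st hIW hWJ hJ hw hw' hj hj' hI h0
              refine (cube_run hC f hb0 (by omega) hN hIW hWJ ?_ hw hw' hj hj' hI).mono le_rfl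
                fun st' h => ⟨h.1, h.2.trans h0⟩
              have := Nat.mul_le_mul_right b hJ
              rw [add_mul, add_mul] at this
              omega
            have four : 4 * cubeTime f b =
                cubeTime f b + (cubeTime f b + (cubeTime f b + cubeTime f b)) := by ring
            rw [four]
            refine Run.seq (hrun (W := I + 2) (J := I + 2 + e) (by omega) (by omega) (by omega)
              ?_ ?_ ?_ ?_ hst₃.1 hst₃.2) fun st₄ hst₄ => Run.seq (hrun (W := I + 3) (J := I + 3 + e)
              (by omega) (by omega) (by omega) ?_ ?_ ?_ ?_ hst₄.1 hst₄.2) fun st₅ hst₅ =>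
              Run.seq (hrun (W := I + e) (J := I + e + 2) (by omega) (by omega) (by omega)
              ?_ ?_ ?_ ?_ hst₅.1 hst₅.2) fun st₆ hst₆ => (hrun (W := I + e) (J := I + e + 3)
              (by omega) (by omega) (by omega) ?_ ?_ ?_ ?_ hst₆.1 hst₆.2).mono le_rfl
              fun st₇ hst₇ => ⟨hst₇.1.mono fun b' I' W' J' hB => Or.inl ?_, hst₇.2⟩
            -- The first sixteen goals concern the index expressions of the four cubes; the
            -- seventeenth is the claim that all due blocks have been added.
            on_goal 17 =>
              rcases hB with (hB | hB) | ⟨e', rfl, he', hc, hI'⟩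
              · exact Or.inl (Or.inl (Or.inl (Or.inl (Or.inl (Or.inl hB)))))
              · exact Or.inl (Or.inl (Or.inl (Or.inl (Or.inl (Or.inr hB)))))
              · rcases Nat.lt_or_ge I' I with hlt | hge
                · exact Or.inl (Or.inl (Or.inl (Or.inl (Or.inr ⟨e', rfl, he', hc, hlt⟩))))
                · have hII : I' = I := by omega
                  subst hII
                  have hee : e' = e := by
                    rw [mul_comm, ← heq] at he'
                    have := Nat.eq_of_mul_eq_mul_right hb0 he'
                    omega
                  subst hee
                  -- Blocks at distance `y ≤ e'` only have differences below `(e' + 1) * b' = d +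
                  -- 1`, all of which are known.
                  have le2 : ∀ x y, y ≤ e' → (x + y + 1) * b' ≤ d + 1 + x * b' := by
                    intro x y hy
                    have := Nat.mul_le_mul_right b' (by omega : y + 1 ≤ e' + 1)
                    rw [add_assoc, add_mul]
                    omega
                  rcases hc with ⟨rfl, rfl, h'⟩ | ⟨rfl, rfl, h'⟩ | ⟨rfl, rfl, h'⟩ | ⟨rfl, rfl, h'⟩
                  · exact Or.inl (Or.inl (Or.inl (Or.inr ⟨⟨rfl, rfl, rfl, rfl⟩, le2 _ _ h',
                      le2 _ _ le_rfl⟩)))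
                  · exact Or.inl (Or.inl (Or.inr ⟨⟨rfl, rfl, rfl, rfl⟩, le2 _ _ h',
                      le2 _ _ le_rfl⟩))
                  · exact Or.inl (Or.inr ⟨⟨rfl, rfl, rfl, rfl⟩, le2 _ _ le_rfl, le2 _ _ h'⟩)
                  · exact Or.inr ⟨⟨rfl, rfl, rfl, rfl⟩, le2 _ _ le_rfl, le2 _ _ h'⟩
            all_goals intros
            all_goals first
              | rfl
              | (simp only [Expr.Ok, List.length_cons, List.length_nil]
                 omega)
        · have hlt' : ¬ d + 1 - (d + 1) / b * b < 1 := hlt'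
          refine (Run.skip (Q := J' (N / b + 1)) ⟨hinv.mono fun b' I W J hB => Or.inl ?_, rfl⟩).le
            (by omega)
          rcases hB with hB | ⟨e, rfl, he, -⟩
          · exact hB
          · exfalso
            rw [← he, Nat.mul_div_cancel_left _ hb0, mul_comm] at hlt'
            omega
      refine Run.le (Run.seq hbody (T₂ := 1) fun st₃ hst₃ => ?_) (by omega)
      refine Run.put (by omega) ?_ ?_ ?_ ?_ ?_ ?_ ?_
      · simp only [Expr.Ok]; omega
      · simp only [Expr.Ok]; omega
      · simp only [Expr.Ok, List.cons_append, List.nil_append, List.length_cons, List.length_nil]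
        omega
      · simp only [Expr.eval]; omega
      · simp only [Expr.eval]; omega
      · change b + b < _; omega
      · change J (k + 1) (st₃.put 0 0 1 (b + b))
        have e : (st₃.put 0 0 1 (b + b)).arr 0 0 1 = b + b := by simp [Store.put_arr]
        refine ⟨(put0 (b + b) hst₃.1).mono fun b' I W J hB => ?_, Or.inl ⟨?_, ?_⟩, ?_⟩
        · rcases hB with hB | ⟨k', e', hk', rfl, he', hc⟩
          · exact Or.inl (Or.inl (Or.inl hB))
          · rcases Nat.lt_or_ge k' k with hlt' | hge
            · exact Or.inl (Or.inl (Or.inr ⟨k', e', hlt', rfl, he', hc⟩))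
            · have : k' = k := by omega
              subst this
              by_cases hI : I < N / b + 1
              · exact Or.inl (Or.inr ⟨e', hbk.symm, he', hc, hI⟩)
              -- First block indices above `N / b` lead to blocks entirely beyond `N`.
              · right
                have h₁ : I ≤ J := by unfold Combo at hc; omega
                have h₂ := Nat.mul_le_mul_right b (by omega : N / b + 1 ≤ J)
                have h₃ := Nat.lt_mul_div_succ N hb0
                rw [mul_comm] at h₃
                rw [← hbk]
                omega
        · rw [e, hbk, pow_succ]; omega
        · rw [pow_succ, ← hbk]; omega
        · rw [e]; omega
  · rintro st' ⟨hinv, -, -⟩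
    refine hinv.mono fun b I W J hB => ?_
    obtain ⟨k, e, rfl, he, hc⟩ := hB
    rcases Nat.lt_or_ge k N with hk | hk
    · left
      rcases Nat.lt_or_ge (2 ^ k * (e + 1)) (d + 1) with h' | h'
      · exact Or.inl ⟨k, e, rfl, by omega, hc⟩
      · exact Or.inr ⟨k, e, hk, rfl, by omega, hc⟩
    -- Scales `2 ^ k` with `k ≥ N` exceed `N`, and the last block index is positive, so these blocks
    -- are empty.
    · right
      have h₁ : N < 2 ^ N := Nat.lt_two_pow_self
      have h₂ : 2 ^ N ≤ 2 ^ k := Nat.pow_le_pow_right (by omega) hk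
      have h₃ : 1 ≤ J := by unfold Combo at hc; omega
      have := Nat.mul_le_mul_right (2 ^ k) h₃
      omega

end PAFP

/-! ### Filling the tables diagonal by diagonal -/

namespace PAFP

open WordRAM PAFP.Graph

/-- The input is the encoding of the graph, and the arrays are large enough for it. -/
structure Rep (C : Ctx) (G : Graph) : Prop where
  large : C.Large
  dim : C.M = 8 * G.n + 8
  length : C.H = 3 + 2 * (G.n * G.n)
  inp_n : C.inp 0 = G.n
  adj : ∀ u < G.n, ∀ v < G.n, C.inp (3 + (u * G.n + v)) ≤ 1 ∧
    (C.inp (3 + (u * G.n + v)) = 1 ↔ G.adj u v)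
  forb : ∀ u < G.n, ∀ v < G.n, C.inp (3 + (G.n * G.n + (u * G.n + v))) ≤ 1 ∧
    (C.inp (3 + (G.n * G.n + (u * G.n + v))) = 1 ↔ G.forb u v)

/-- Intermediate positions `q` at distance at least 2 from both ends are covered by the blocks
already accumulated; `q = a + 1` and `q = p - 1` are evaluated on the spot. If one of these two
coincides with an end, its term vanishes, because a table has no entries on the diagonal. -/
theorem Acc.product {st : Store} {kX kY kP N a p : ℕ} {X Y : ℕ → ℕ → Prop}
    {DX DY : ℕ → ℕ → Prop} (hX : Tab st kX DX X) (hY : Tab st kY DY Y)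
    (h : Acc st kP N X Y (Blocks (p - a))) (hp : p < N)
    (hDX : ∀ a' p', a' < p' → p' < N → p' - a' < p - a → DX a' p')
    (hDY : ∀ a' p', a' < p' → p' < N → p' - a' < p - a → DY a' p')
    (hDX' : ∀ a' p', DX a' p' → a' < p') (hDY' : ∀ a' p', DY a' p' → a' < p') :
    0 < st.arr kP a p + (st.arr kX a (a + 1) * st.arr kY (a + 1) p +
      st.arr kX a (p - 1) * st.arr kY (p - 1) p) ↔ ∃ q, a < q ∧ q < p ∧ X a q ∧ Y q p := by
  have term : ∀ q, 0 < st.arr kX a q * st.arr kY q p ↔ a < q ∧ q < p ∧ X a q ∧ Y q p := by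
    intro q
    have hx := hX a q
    have hy := hY q p
    constructor
    · intro h0
      have h1 := Nat.pos_of_mul_pos_right h0
      have h2 := Nat.pos_of_mul_pos_left h0
      obtain ⟨d₁, x⟩ := hx.2.1 (by omega)
      obtain ⟨d₂, y⟩ := hy.2.1 (by omega)
      exact ⟨hDX' _ _ d₁, hDY' _ _ d₂, x, y⟩
    · rintro ⟨h₁, h₂, x, y⟩
      rw [hx.2.2 ⟨hDX a q h₁ (by omega) (by omega), x⟩,
        hy.2.2 ⟨hDY q p h₂ (by omega) (by omega), y⟩]
      simp
  have hle := h.le_one a p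
  constructor
  · intro h0
    by_cases h₁ : 0 < st.arr kP a p
    · exact h.sound a p (by omega)
    · by_cases h₂ : 0 < st.arr kX a (a + 1) * st.arr kY (a + 1) p
      · exact ⟨_, (term _).1 h₂⟩
      · exact ⟨_, (term (p - 1)).1 (by omega)⟩
  · rintro ⟨q, hq⟩
    obtain ⟨h₁, h₂, x, y⟩ := id hq
    by_cases e₁ : q = a + 1
    · have := (term q).2 hq
      rw [e₁] at this; omega
    · by_cases e₂ : q = p - 1
      · have := (term q).2 hq
        rw [e₂] at this; omega
      · obtain ⟨b, hb⟩ := exists_block (a := a) (q := q) (p := p) (by omega) (by omega)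
        have := h.complete _ _ _ _ hb a q p rfl rfl rfl hp h₁ h₂ x y
        omega

/-- Compute the table entries at position `a` (variable 5) and `p` (variable 7). -/
def cellTables : Stmt :=
  .ite (.var 8) (.var 10)
    (.seq
      (.ite (.num 0) (.inp (.num 3 + (.var 8 * .var 0 + .var 9)) + (.get 9 (.var 5) (.var 7) +
          (.get 4 (.var 5) (.var 5 + .num 1) * .get 7 (.var 5 + .num 1) (.var 7) +
            .get 4 (.var 5) (.var 7 - .num 1) * .get 7 (.var 7 - .num 1) (.var 7))))
        (.put 6 (.var 5) (.var 7) (.num 1)) .skip)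
      (.ite (.num 0) (.get 6 (.var 5) (.var 7) + (.get 8 (.var 5) (.var 7) +
          (.get 5 (.var 5) (.var 5 + .num 1) * .get 6 (.var 5 + .num 1) (.var 7) +
            .get 5 (.var 5) (.var 7 - .num 1) * .get 6 (.var 7 - .num 1) (.var 7))))
        (.put 10 (.var 5) (.var 7) (.num 1)) .skip))
    (.ite (.var 10) (.var 8)
      (.ite (.num 0) (.get 10 (.var 5) (.var 7 - .num 1))
        (.seq (.put 10 (.var 5) (.var 7) (.num 1)) (.put 7 (.var 5) (.var 7) (.num 1))) .skip)
      .skip)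

/-- Compute the entries of the factors at last positions. -/
def cellFactors : Stmt :=
  .ite (.var 7) (.get 3 (.num 0) (.var 9)) .skip
    (.seq (.put 4 (.var 5) (.var 7) (.inp (.num 3 + (.var 8 * .var 0 + .var 9))))
      (.put 5 (.var 5) (.var 7) (.get 10 (.var 5) (.var 7))))

def cell : Stmt :=
  .bind (.get 1 (.num 0) (.var 5)) <| .bind (.get 1 (.num 0) (.var 7)) <|
    .bind (.get 2 (.num 0) (.var 7)) <|
      .ite (.var 5) (.get 3 (.num 0) (.var 8)) .skip (.seq cellTables cellFactors)

/-- Only the entry at `(a, p)` of the arrays in `K` may differ. -/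
def OnlyAt (a p : ℕ) (K : List ℕ) (st st' : Store) : Prop :=
  st'.scr = st.scr ∧ ∀ k a' p', ¬ (k ∈ K ∧ a' = a ∧ p' = p) → st'.arr k a' p' = st.arr k a' p'

theorem OnlyAt.refl (a p : ℕ) (K : List ℕ) (st : Store) : OnlyAt a p K st st :=
  ⟨rfl, fun _ _ _ _ => rfl⟩

theorem OnlyAt.put {a p : ℕ} {K : List ℕ} {st st' : Store} (h : OnlyAt a p K st st') {k v : ℕ}
    (hk : k ∈ K) : OnlyAt a p K st (st'.put k a p v) := by
  refine ⟨h.1, fun k' a' p' hne => ?_⟩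
  rw [Store.put_arr, if_neg]
  · exact h.2 k' a' p' hne
  · rintro ⟨rfl, rfl, rfl⟩
    exact hne ⟨hk, rfl, rfl⟩

/-- The value of an entry is the truth value of `X`. -/
def IsTruth (v : ℕ) (X : Prop) : Prop := v ≤ 1 ∧ (v = 1 ↔ X)

theorem Tab.update {st st' : Store} {k a p : ℕ} {D D' X : ℕ → ℕ → Prop} (h : Tab st k D X)
    (hD : ∀ a' p', D' a' p' ↔ D a' p' ∨ (a' = a ∧ p' = p))
    (hst : ∀ a' p', ¬ (a' = a ∧ p' = p) → st'.arr k a' p' = st.arr k a' p')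
    (hX : IsTruth (st'.arr k a p) (X a p)) : Tab st' k D' X := by
  intro a' p'
  rw [hD]
  by_cases e : a' = a ∧ p' = p
  · obtain ⟨rfl, rfl⟩ := e
    exact ⟨hX.1, hX.2.trans ⟨fun h => ⟨Or.inr ⟨rfl, rfl⟩, h⟩, fun h => h.2⟩⟩
  · rw [hst a' p' e]
    refine ⟨(h a' p').1, (h a' p').2.trans ?_⟩
    simp [e]

theorem Tab.congr {st st' : Store} {k : ℕ} {D X : ℕ → ℕ → Prop} (h : Tab st k D X)
    (hst : st'.arr k = st.arr k) : Tab st' k D X := by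
  unfold Tab; rw [hst]; exact h

theorem Acc.congr {st st' : Store} {k N : ℕ} {X Y : ℕ → ℕ → Prop} {B : ℕ → ℕ → ℕ → ℕ → Prop}
    (h : Acc st k N X Y B) (hst : st'.arr k = st.arr k) : Acc st' k N X Y B :=
  ⟨by rw [hst]; exact h.1, by rw [hst]; exact h.2, by rw [hst]; exact h.3⟩

theorem Tab.zero {st : Store} {k a p : ℕ} {D X : ℕ → ℕ → Prop} (h : Tab st k D X)
    (hD : ¬ D a p) : st.arr k a p = 0 := by
  have := h a p
  by_contra hne
  exact hD (this.2.1 (by omega)).1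

section

variable {C : Ctx} {G : Graph} {N : ℕ} {vt thr en : ℕ → ℕ} {D D' : ℕ → ℕ → Prop}
  {B : ℕ → ℕ → ℕ → ℕ → Prop} {st : Store} {a p : ℕ}

-- Three cases according to the place of `vt a`. Before the threshold, `TabD` is computed first,
-- from an edge or from the product `E·T`, and then enters `TabS` together with `R·D`. Behind the
-- threshold, `TabS` is inherited from `p - 1` and `TabT` agrees with it. At the threshold all
-- entries remain 0.
set_option maxHeartbeats 2000000 in
theorem cellTables_run (hC : Rep C G) (f : ℕ → ℕ) (hL : Layout G N vt thr en)
    (hN : 2 * N ≤ C.M) (hap : a < p) (hp : p < N)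
    (hD₁ : ∀ a' p', a' < p' → p' < N → p' - a' < p - a → D a' p')
    (hD₂ : ∀ a' p', D a' p' → a' < p') (hD₃ : ¬ D a p)
    (h : Inv G N vt thr en D (Blocks (p - a)) st) (ha : en (vt a) = a) (x₂ x₃ x₄ x₆ : ℕ) :
    Run C f cellTables [G.n, N, x₂, x₃, x₄, a, x₆, p, vt a, vt p, thr p] st 5
      fun st' => OnlyAt a p [6, 7, 10] st st' ∧
        IsTruth (st'.arr 6 a p) (TabD G vt thr en a p) ∧
        IsTruth (st'.arr 7 a p) (TabT G vt thr en a p) ∧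
        IsTruth (st'.arr 10 a p) (TabS G vt thr en a p) := by
  obtain ⟨hK, hZ, hM⟩ := id hC.large
  have hMM : 8 * C.M ≤ C.M * C.M := Nat.mul_le_mul_right _ hM
  have va := hL.vt_lt a (by omega)
  have vp := hL.vt_lt p hp
  have hidx := index_lt va vp
  have hH := hC.length
  have hadj := hC.adj _ va _ vp
  have zero6 := h.tabD.zero hD₃
  have zero7 := h.tabT.zero hD₃
  have zero10 := h.tabS.zero hD₃
  refine Run.ite (T := 4) ?_ ?_ (fun hlt => ?_) (fun hlt => ?_)
  · simp [Expr.Ok]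
  · simp [Expr.Ok]
  · simp only [Expr.eval, lookup] at hlt
    have hT : ¬ TabT G vt thr en a p := fun h => by have := h.1; omega
    have hR : Run C f (.ite (.num 0) (.inp (.num 3 + (.var 8 * .var 0 + .var 9)) +
          (.get 9 (.var 5) (.var 7) +
          (.get 4 (.var 5) (.var 5 + .num 1) * .get 7 (.var 5 + .num 1) (.var 7) +
            .get 4 (.var 5) (.var 7 - .num 1) * .get 7 (.var 7 - .num 1) (.var 7))))
        (.put 6 (.var 5) (.var 7) (.num 1)) .skip)
        [G.n, N, x₂, x₃, x₄, a, x₆, p, vt a, vt p, thr p] st 2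
        fun st' => OnlyAt a p [6] st st' ∧ IsTruth (st'.arr 6 a p) (TabD G vt thr en a p) := by
      have hprod := Acc.product h.tabE h.tabT h.accE hp hD₁ hD₁ hD₂ hD₂
      have hcond : 0 < C.inp (3 + (vt a * G.n + vt p)) + (st.arr 9 a p +
          (st.arr 4 a (a + 1) * st.arr 7 (a + 1) p + st.arr 4 a (p - 1) * st.arr 7 (p - 1) p)) ↔
          TabD G vt thr en a p := by
        rw [TabD, ← hprod, ← hadj.2]
        constructor
        · intro h0; exact ⟨ha, hlt, by omega⟩
        · rintro ⟨-, -, h0⟩; omega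
      refine Run.ite (T := 1) ?_ ?_ (fun hlt => ?_) (fun hlt => ?_)
      · simp only [Expr.Ok]; omega
      · simp only [Expr.Ok, Expr.ok_sub, Expr.eval, Expr.eval_sub, Op.eval, lookup,
          List.length_cons, List.length_nil]
        omega
      · simp only [Expr.eval, Expr.eval_sub, Op.eval, lookup] at hlt
        refine Run.put (by omega) ?_ ?_ ?_ ?_ ?_ ?_ ⟨(OnlyAt.refl a p _ st).put (by simp), ?_⟩
        iterate 6
          simp only [Expr.Ok, Expr.eval, lookup, List.length_cons, List.length_nil]
          omega
        simp only [Expr.eval, lookup]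
        rw [Store.put_arr, if_pos ⟨rfl, rfl, rfl⟩]
        exact ⟨le_rfl, fun _ => hcond.1 hlt, fun _ => rfl⟩
      · simp only [Expr.eval, Expr.eval_sub, Op.eval, lookup] at hlt
        refine Run.skip ⟨OnlyAt.refl a p _ st, ?_⟩
        rw [zero6]
        exact ⟨by omega, fun h => by omega, fun h => absurd (hcond.2 h) hlt⟩
    refine Run.seq (T₁ := 2) (T₂ := 2) hR fun st₁ ⟨ho, h6⟩ => ?_
    have same : ∀ k, k ≠ 6 → st₁.arr k = st.arr k := fun k hk => by
      funext a' p'; exact ho.2 _ _ _ (by simp [hk])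
    have h6' : Tab st₁ 6 (fun a' p' => D a' p' ∨ (a' = a ∧ p' = p)) (TabD G vt thr en) :=
      h.tabD.update (fun _ _ => Iff.rfl) (fun a' p' hne => ho.2 _ _ _ (by simp [hne])) h6
    have hprod := Acc.product (h.tabR.congr (same 5 (by simp))) h6'
      (h.accR.congr (same 8 (by simp))) hp hD₁ (fun a' p' h₁ h₂ h₃ => Or.inl (hD₁ a' p' h₁ h₂ h₃))
      hD₂ (by
        rintro a' p' (h' | ⟨rfl, rfl⟩)
        · exact hD₂ a' p' h'
        · exact hap)
    have hcond : 0 < st₁.arr 6 a p + (st₁.arr 8 a p +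
          (st₁.arr 5 a (a + 1) * st₁.arr 6 (a + 1) p + st₁.arr 5 a (p - 1) * st₁.arr 6 (p - 1) p)) ↔
          TabS G vt thr en a p := by
      rw [hL.tabS_of_lt ha hap hp hlt, ← hprod, ← h6.2]
      have := h6.1
      omega
    refine Run.ite (T := 1) ?_ ?_ (fun hlt => ?_) (fun hlt => ?_)
    · simp only [Expr.Ok]; omega
    · simp only [Expr.Ok, Expr.ok_sub, Expr.eval, Expr.eval_sub, Op.eval, lookup,
        List.length_cons, List.length_nil]
      omega
    · simp only [Expr.eval, Expr.eval_sub, Op.eval, lookup] at hlt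
      refine Run.put (by omega) ?_ ?_ ?_ ?_ ?_ ?_ ⟨OnlyAt.put ⟨ho.1, fun k a' p' hne =>
        ho.2 k a' p' fun hk => hne ⟨by have := hk.1; simp_all, hk.2⟩⟩ (by simp), ?_, ?_, ?_⟩
      iterate 6
        simp only [Expr.Ok, Expr.eval, lookup, List.length_cons, List.length_nil]
        omega
      all_goals
        simp only [Expr.eval, lookup]
        rw [Store.put_arr]
      · simpa using h6
      · rw [if_neg (by simp), same 7 (by simp), zero7]
        exact ⟨by omega, fun h => by omega, fun h => absurd h hT⟩
      · rw [if_pos ⟨rfl, rfl, rfl⟩]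
        exact ⟨le_rfl, fun _ => hcond.1 hlt, fun _ => rfl⟩
    · simp only [Expr.eval, Expr.eval_sub, Op.eval, lookup] at hlt
      refine Run.skip ⟨⟨ho.1, fun k a' p' hne =>
        ho.2 k a' p' fun hk => hne ⟨by have := hk.1; simp_all, hk.2⟩⟩, h6, ?_, ?_⟩
      · rw [same 7 (by simp), zero7]
        exact ⟨by omega, fun h => by omega, fun h => absurd h hT⟩
      · rw [same 10 (by simp), zero10]
        exact ⟨by omega, fun h => by omega, fun h => absurd (hcond.2 h) hlt⟩
  · simp only [Expr.eval, lookup] at hlt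
    have hD : IsTruth (st.arr 6 a p) (TabD G vt thr en a p) := by
      rw [zero6]
      exact ⟨by omega, fun h => by omega, fun h => absurd h.2.1 hlt⟩
    refine Run.ite (T := 3) ?_ ?_ (fun hlt' => ?_) (fun hlt' => ?_)
    · simp [Expr.Ok]
    · simp [Expr.Ok]
    · simp only [Expr.eval, lookup] at hlt'
      have hcond := hL.tabS_of_gt ha hap hp hlt'
      have hpred := (hL.pred_of_lt ha hap hp hlt').1
      have hval := h.tabS a (p - 1)
      have hcond' : 0 < st.arr 10 a (p - 1) ↔ TabS G vt thr en a p := by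
        rw [hcond]
        constructor
        · intro h0; exact (hval.2.1 (by omega)).2
        · intro h0
          rw [hval.2.2 ⟨hD₁ _ _ hpred (by omega) (by omega), h0⟩]; omega
      refine Run.ite (T := 2) ?_ ?_ (fun hlt => ?_) (fun hlt => ?_)
      · simp only [Expr.Ok]; omega
      · simp only [Expr.Ok, Expr.ok_sub, Expr.eval, Expr.eval_sub, lookup,
          List.length_cons, List.length_nil]
        omega
      · simp only [Expr.eval, Expr.eval_sub, lookup] at hlt
        have hS := hcond'.1 hlt
        refine Run.seq (T₁ := 1) (T₂ := 1) (R := fun st' => st' = st.put 10 a p 1)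
          (Run.put (by omega) ?_ ?_ ?_ ?_ ?_ ?_ rfl) ?_
        iterate 6
          simp only [Expr.Ok, Expr.eval, lookup, List.length_cons, List.length_nil]
          omega
        rintro st₁ rfl
        refine Run.put (by omega) ?_ ?_ ?_ ?_ ?_ ?_
          ⟨((OnlyAt.refl a p _ st).put (by simp)).put (by simp), ?_, ?_, ?_⟩
        iterate 6
          simp only [Expr.Ok, Expr.eval, lookup, List.length_cons, List.length_nil]
          omega
        all_goals
          simp only [Expr.eval, lookup]
          rw [Store.put_arr, Store.put_arr]
        · simpa using hD
        · simp only [and_self, if_true]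
          exact ⟨le_rfl, fun _ => ⟨hlt', hS⟩, fun _ => rfl⟩
        · simp only [and_self, if_true]
          exact ⟨le_rfl, fun _ => hS, fun _ => rfl⟩
      · simp only [Expr.eval, Expr.eval_sub, lookup] at hlt
        refine (Run.skip ⟨OnlyAt.refl a p _ st, hD, ?_, ?_⟩).le (by omega)
        · rw [zero7]
          exact ⟨by omega, fun h => by omega, fun h => absurd (hcond'.2 h.2) hlt⟩
        · rw [zero10]
          exact ⟨by omega, fun h => by omega, fun h => absurd (hcond'.2 h) hlt⟩
    · simp only [Expr.eval, lookup] at hlt'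
      have hS := hL.not_tabS ha hap hp (by omega)
      refine (Run.skip ⟨OnlyAt.refl a p _ st, hD, ?_, ?_⟩).le (by omega)
      · rw [zero7]
        exact ⟨by omega, fun h => by omega, fun h => absurd h.2 hS⟩
      · rw [zero10]
        exact ⟨by omega, fun h => by omega, fun h => absurd h hS⟩

theorem Inv.update (h : Inv G N vt thr en D B st) {st' : Store}
    (hD : ∀ a' p', D' a' p' ↔ D a' p' ∨ (a' = a ∧ p' = p))
    (ho : OnlyAt a p [4, 5, 6, 7, 10] st st')
    (h4 : IsTruth (st'.arr 4 a p) (TabE G vt en a p))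
    (h5 : IsTruth (st'.arr 5 a p) (TabR G vt thr en a p))
    (h6 : IsTruth (st'.arr 6 a p) (TabD G vt thr en a p))
    (h7 : IsTruth (st'.arr 7 a p) (TabT G vt thr en a p))
    (h10 : IsTruth (st'.arr 10 a p) (TabS G vt thr en a p)) : Inv G N vt thr en D' B st' := by
  have same : ∀ k, k ∉ [4, 5, 6, 7, 10] → st'.arr k = st.arr k := fun k hk => by
    funext a' p'; exact ho.2 _ _ _ (by tauto)
  have upd : ∀ k a' p', ¬ (a' = a ∧ p' = p) → st'.arr k a' p' = st.arr k a' p' :=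
    fun k a' p' hne => ho.2 _ _ _ (by tauto)
  exact ⟨ho.1.trans h.scr, by rw [same 1 (by simp)]; exact h.vt_eq,
    by rw [same 2 (by simp)]; exact h.thr_eq, by rw [same 3 (by simp)]; exact h.en_eq,
    h.tabE.update hD (upd 4) h4, h.tabR.update hD (upd 5) h5, h.tabD.update hD (upd 6) h6,
    h.tabT.update hD (upd 7) h7, h.accR.congr (same 8 (by simp)), h.accE.congr (same 9 (by simp)),
    h.tabS.update hD (upd 10) h10⟩

-- If `a` is not a last position, all five relations fail at `(a, p)` and the zero entries are
-- already right; the same holds for `TabE` and `TabR` if `p` is not a last position.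
set_option maxHeartbeats 1000000 in
theorem cell_run (hC : Rep C G) (f : ℕ → ℕ) (hL : Layout G N vt thr en)
    (hN : 2 * N ≤ C.M) (hap : a < p) (hp : p < N)
    (hD₁ : ∀ a' p', a' < p' → p' < N → p' - a' < p - a → D a' p')
    (hD₂ : ∀ a' p', D a' p' → a' < p') (hD₃ : ¬ D a p)
    (hD' : ∀ a' p', D' a' p' ↔ D a' p' ∨ (a' = a ∧ p' = p))
    (h : Inv G N vt thr en D (Blocks (p - a)) st) (x₂ x₃ x₄ x₆ : ℕ) :
    Run C f cell [G.n, N, x₂, x₃, x₄, a, x₆, p] st 12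
      (Inv G N vt thr en D' (Blocks (p - a))) := by
  obtain ⟨hK, hZ, hM⟩ := id hC.large
  have hMM : 8 * C.M ≤ C.M * C.M := Nat.mul_le_mul_right _ hM
  have hdim := hC.dim
  have va := hL.vt_lt a (by omega)
  have vp := hL.vt_lt p hp
  have tp := hL.thr_le hp
  have ea := hL.le_en a (by omega)
  have ep := hL.le_en p hp
  have hidx := index_lt va vp
  have hH := hC.length
  have hadj := hC.adj _ va _ vp
  refine Run.bind (v := vt a) (T := 11) ?_ (by simp [Expr.eval, lookup, h.vt_eq]) (by omega) ?_
  · simp only [Expr.Ok, Expr.eval, lookup, List.length_cons, List.length_nil]; omega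
  refine Run.bind (v := vt p) (T := 10) ?_ (by simp [Expr.eval, lookup, h.vt_eq]) (by omega) ?_
  · simp only [Expr.Ok, Expr.eval, lookup, List.length_cons, List.length_nil, List.cons_append,
      List.nil_append]
    omega
  refine Run.bind (v := thr p) (T := 9) ?_ (by simp [Expr.eval, lookup, h.thr_eq]) (by omega) ?_
  · simp only [Expr.Ok, Expr.eval, lookup, List.length_cons, List.length_nil, List.cons_append,
      List.nil_append]
    omega
  simp only [List.cons_append, List.nil_append]
  refine Run.ite (T := 8) ?_ ?_ (fun hlt => ?_) (fun hlt => ?_)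
  · simp [Expr.Ok]
  · simp only [Expr.Ok, Expr.eval, lookup, List.length_cons, List.length_nil]; omega
  · simp only [Expr.eval, lookup, h.en_eq] at hlt
    refine (Run.skip (h.update hD' (OnlyAt.refl a p _ st) ?_ ?_ ?_ ?_ ?_)).le (by omega)
    · rw [h.tabE.zero hD₃]
      exact ⟨by omega, fun h => by omega, fun h => by have := h.1; omega⟩
    · rw [h.tabR.zero hD₃]
      exact ⟨by omega, fun h => by omega, fun h => by have := h.2.1; omega⟩
    · rw [h.tabD.zero hD₃]
      exact ⟨by omega, fun h => by omega, fun h => by have := h.1; omega⟩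
    · rw [h.tabT.zero hD₃]
      exact ⟨by omega, fun h => by omega, fun h => by have := h.2.1; omega⟩
    · rw [h.tabS.zero hD₃]
      exact ⟨by omega, fun h => by omega, fun h => by have := h.1; omega⟩
  · simp only [Expr.eval, lookup, h.en_eq] at hlt
    have ha : en (vt a) = a := by omega
    refine Run.seq (T₁ := 5) (T₂ := 3) (cellTables_run hC f hL hN hap hp hD₁ hD₂ hD₃ h ha ..)
      fun st₁ ⟨ho, h6, h7, h10⟩ => ?_
    have same : ∀ k, k ∉ [6, 7, 10] → st₁.arr k = st.arr k := fun k hk => by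
      funext a' p'; exact ho.2 _ _ _ (by tauto)
    have ho' : OnlyAt a p [4, 5, 6, 7, 10] st st₁ := ⟨ho.1, fun k a' p' hne =>
        ho.2 k a' p' fun hk => hne ⟨by
          have := hk.1
          simp only [List.mem_cons, List.not_mem_nil, or_false] at this ⊢
          omega, hk.2⟩⟩
    refine Run.ite (T := 2) ?_ ?_ (fun hlt' => ?_) (fun hlt' => ?_)
    · simp [Expr.Ok]
    · simp only [Expr.Ok, Expr.eval, lookup, List.length_cons, List.length_nil]; omega
    · simp only [Expr.eval, lookup, same 3 (by simp), h.en_eq] at hlt'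
      refine (Run.skip (h.update hD' ho' ?_ ?_ h6 h7 h10)).le (by omega)
      · rw [same 4 (by simp), h.tabE.zero hD₃]
        exact ⟨by omega, fun h => by omega, fun h => by have := h.2.1; omega⟩
      · rw [same 5 (by simp), h.tabR.zero hD₃]
        exact ⟨by omega, fun h => by omega, fun h => by have := h.1; omega⟩
    · simp only [Expr.eval, lookup, same 3 (by simp), h.en_eq] at hlt'
      have hep : en (vt p) = p := by omega
      refine Run.seq (T₁ := 1) (T₂ := 1) (R := fun st' => st' = st₁.put 4 a p
        (C.inp (3 + (vt a * G.n + vt p)))) (Run.put (by omega) ?_ ?_ ?_ ?_ ?_ ?_ rfl) ?_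
      iterate 6
        simp only [Expr.Ok, Expr.eval, lookup, List.length_cons, List.length_nil, Op.eval]
        omega
      rintro st₂ rfl
      have e10 : (st₁.put 4 a p (C.inp (3 + (vt a * G.n + vt p)))).arr 10 a p = st₁.arr 10 a p := by
        rw [Store.put_arr, if_neg (by simp)]
      have hle := h10.1
      refine Run.put (by omega) ?_ ?_ ?_ ?_ ?_ ?_ (h.update hD' ((ho'.put (by simp)).put (by simp))
        ?_ ?_ ?_ ?_ ?_)
      iterate 6
        simp only [Expr.Ok, Expr.eval, lookup, List.length_cons, List.length_nil, e10]
        omega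
      all_goals
        simp only [Expr.eval, lookup, e10]
        rw [Store.put_arr, Store.put_arr]
        simp only [and_self, if_true, Nat.reduceEqDiff, false_and, if_false]
      · exact ⟨hadj.1, hadj.2.trans ⟨fun h => ⟨ha, hep, h⟩, fun h => h.2.2⟩⟩
      · exact ⟨hle, h10.2.trans ⟨fun h => ⟨hep, h⟩, fun h => h.2⟩⟩
      · exact h6
      · exact h7
      · exact h10

end

/-- The computation of all tables. -/
def mainLoop : Stmt :=
  .loop (.var 1 - .num 1) <| .bind (.var 2 + .num 1) <|
    .seq (.loop (.var 1 - .var 4) <| .bind (.var 5 + .var 4) cell) blockStage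

def mainTime (f : ℕ → ℕ) (N : ℕ) : ℕ :=
  1 + ∑ i ∈ Finset.range (N - 1), (1 + N * 14 +
    (2 + ∑ k ∈ Finset.range N, (levelTime f N (i + 1) k + 6 + 1)) + 1 + 1)

/-- Entries at distance `d` depend only on smaller distances and on the blocks due up to `d`. After
the diagonal is complete, the blocks due at `d + 1` are multiplied. -/
theorem mainLoop_run {C : Ctx} {G : Graph} (hC : Rep C G) (f : ℕ → ℕ) {N : ℕ}
    {vt thr en : ℕ → ℕ} (hL : Layout G N vt thr en) (hN : 2 * N ≤ C.M) (hN₁ : 1 ≤ N) {st : Store}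
    (h : Inv G N vt thr en (Near N 1) (Blocks 1) st) :
    Run C f mainLoop [G.n, N] st (mainTime f N) (Inv G N vt thr en (Near N N) (Blocks N)) := by
  obtain ⟨hK, hZ, hM⟩ := id hC.large
  have hMM : 8 * C.M ≤ C.M * C.M := Nat.mul_le_mul_right _ hM
  refine Run.mono (Run.loop (n := N - 1)
    (fun i => Inv G N vt thr en (Near N (i + 1)) (Blocks (i + 1)))
    (fun i => 1 + N * 14 + (2 + ∑ k ∈ Finset.range N, (levelTime f N (i + 1) k + 6 + 1)) + 1)
    ?_ ?_ (by omega) h ?_) le_rfl (fun st' h => by rwa [Nat.sub_add_cancel hN₁] at h)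
  · simp only [Expr.Ok, Expr.ok_sub, List.length_cons, List.length_nil]; omega
  · rfl
  intro i hi st₁ h₁
  refine Run.bind (v := i + 1) ?_ rfl (by omega) ?_
  · simp only [Expr.Ok, List.length_cons, List.length_nil, List.cons_append, List.nil_append]
    omega
  simp only [List.cons_append, List.nil_append]
  generalize hd : i + 1 = d at h₁ ⊢
  -- The domain when the first `j` cells of the diagonal `d` have been filled.
  let D : ℕ → ℕ → ℕ → Prop := fun j a p => a < p ∧ p < N ∧ (p < a + d ∨ p = a + d ∧ a < j)
  refine Run.seq (R := Inv G N vt thr en (Near N (d + 1)) (Blocks d)) ?_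
    fun st₂ h₂ => blockStage_run hC.large f (by omega) hN h₂ ..
  have hle : 1 + (N - d) * (12 + 1 + 1) ≤ 1 + N * 14 := by
    have := Nat.mul_le_mul_right 14 (Nat.sub_le N d)
    omega
  have cong : ∀ {D D' : ℕ → ℕ → Prop} {st : Store}, (∀ a p, D a p ↔ D' a p) →
      Inv G N vt thr en D (Blocks d) st → Inv G N vt thr en D' (Blocks d) st := by
    intro D D' st he h
    have : D = D' := by funext a p; exact propext (he a p)
    exact this ▸ h
  refine Run.mono (Run.loop_const (n := N - d)
    (fun j => Inv G N vt thr en (D j) (Blocks d)) (12 + 1)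
    ?_ ?_ (by omega) (cong (fun a p => ?_) h₁) ?_) hle fun st' => cong fun a p => ?_
  · simp only [Expr.Ok, Expr.ok_sub, List.length_cons, List.length_nil]; omega
  · rfl
  · simp only [Near, D]; omega
  · intro a ha st₂ h₂
    refine Run.bind (v := a + d) ?_ rfl (by omega) ?_
    · simp only [Expr.Ok, List.length_cons, List.length_nil, List.cons_append, List.nil_append]
      omega
    have e : a + d - a = d := by omega
    have := cell_run (a := a) (p := a + d) (D := D a) (D' := D (a + 1)) (st := st₂) hC f hL hN
      (by omega) (by omega) (fun a' p' => by simp only [D]; omega)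
      (fun a' p' => by simp only [D]; omega) (by simp only [D]; omega)
      (fun a' p' => by simp only [D]; omega) (by rw [e]; exact h₂) i (N - 1) d (N - d)
    rwa [e] at this
  · simp only [Near, D]; omega

end PAFP

namespace PAFP

open WordRAM PAFP.Graph

/-! ### Computing the layout -/

section

variable {G : Graph} {N v : ℕ} {vt thr en : ℕ → ℕ}

theorem Graph.PreLayout.push (h : PreLayout G N vt thr) (hv : v < G.n) (hle : ∀ p < N, vt p ≤ v)
    {x : ℕ} (hx : x = v ∧ (N = 0 ∨ vt (N - 1) < v) ∨ (1 ≤ N ∧ vt (N - 1) = v ∧ G.forb x v ∧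
      x < thr (N - 1) ∧ ∀ y, G.forb y v → y < thr (N - 1) → y ≤ x)) :
    PreLayout G (N + 1) (Function.update vt N v) (Function.update thr N x) := by
  refine ⟨fun p hp => ?_, fun p q hpq hq => ?_, fun p hp => ?_⟩
  · rw [Function.update_apply]
    split_ifs with e
    · exact hv
    · exact h.vt_lt p (by omega)
  · rw [Function.update_apply, Function.update_apply]
    split_ifs with e e'
    · exact le_rfl
    · omega
    · exact hle p (by omega)
    · exact h.mono p q hpq (by omega)
  · rcases Nat.lt_succ_iff_lt_or_eq.1 hp with hlt | rfl
    · simp only [Function.update_of_ne (show p ≠ N by omega),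
        Function.update_of_ne (show p - 1 ≠ N by omega)]
      exact h.step p hlt
    · rcases Nat.eq_zero_or_pos p with rfl | h0
      · simp only [Function.update_self]
        exact Or.inl ⟨by omega, Or.inl trivial⟩
      · simp only [Function.update_self, Function.update_of_ne (show p - 1 ≠ p by omega)]
        exact hx

/-- The layout of the vertices below `v`. -/
structure LayoutBelow (G : Graph) (v N : ℕ) (vt thr en : ℕ → ℕ) : Prop
    extends PreLayout G N vt thr where
  le : v ≤ N
  vt_below : ∀ p < N, vt p < v
  en_lt : ∀ u < v, en u < N
  vt_en : ∀ u < v, vt (en u) = u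
  le_en : ∀ p < N, p ≤ en (vt p)
  last : ∀ u < v, ∀ x, G.forb x u → thr (en u) ≤ x

/-- The layout of the vertices below `v`, and of `v` with the partners from `m` on. -/
structure LayoutUpTo (G : Graph) (v m N : ℕ) (vt thr en : ℕ → ℕ) : Prop
    extends PreLayout G N vt thr where
  lt : v < N
  vt_le : ∀ p < N, vt p ≤ v
  vt_pred : vt (N - 1) = v
  le_thr : m ≤ thr (N - 1)
  thr_least : ∀ x, G.forb x v → x < thr (N - 1) → x < m
  en_lt : ∀ u < v, en u < N
  vt_en : ∀ u < v, vt (en u) = u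
  le_en : ∀ p < N, vt p < v → p ≤ en (vt p)
  last : ∀ u < v, ∀ x, G.forb x u → thr (en u) ≤ x

theorem LayoutBelow.push (h : LayoutBelow G v N vt thr en) (hv : v < G.n) :
    LayoutUpTo G v v (N + 1) (Function.update vt N v) (Function.update thr N v) en := by
  refine ⟨h.toPreLayout.push hv (fun p hp => (h.vt_below p hp).le) (Or.inl ⟨rfl, ?_⟩),
    by have := h.le; omega, fun p hp => ?_, ?_, ?_, fun x hx _ => (G.forb_lt _ _ hx).1,
    fun u hu => ?_, fun u hu => ?_, fun p hp => ?_, fun u hu => ?_⟩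
  · rcases Nat.eq_zero_or_pos N with h0 | h0
    · exact Or.inl h0
    · exact Or.inr (h.vt_below _ (by omega))
  · rw [Function.update_apply]
    split_ifs with e
    · exact le_rfl
    · exact (h.vt_below p (by omega)).le
  · simp
  · simp
  · have := h.en_lt u hu; omega
  · rw [Function.update_of_ne (h.en_lt u hu).ne]
    exact h.vt_en u hu
  · rw [Function.update_apply]
    split_ifs with e
    · omega
    · exact fun _ => h.le_en p (by omega)
  · rw [Function.update_of_ne (h.en_lt u hu).ne]
    exact h.last u hu

theorem LayoutUpTo.push {x : ℕ} (h : LayoutUpTo G v (x + 1) N vt thr en) (hv : v < G.n)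
    (hx : G.forb x v) :
    LayoutUpTo G v x (N + 1) (Function.update vt N v) (Function.update thr N x) en := by
  have hle := h.le_thr
  refine ⟨h.toPreLayout.push hv h.vt_le (Or.inr ⟨by have := h.lt; omega, h.vt_pred, hx, by omega,
      fun y hy hlt => ?_⟩),
    by have := h.lt; omega, fun p hp => ?_, ?_, ?_, fun y hy => ?_,
    fun u hu => ?_, fun u hu => ?_, fun p hp => ?_, fun u hu => ?_⟩
  · have := h.thr_least y hy hlt; omega
  · rw [Function.update_apply]
    split_ifs with e
    · exact le_rfl
    · exact h.vt_le p (by omega)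
  · simp
  · simp
  · simp
  · have := h.en_lt u hu; omega
  · rw [Function.update_of_ne (h.en_lt u hu).ne]
    exact h.vt_en u hu
  · rw [Function.update_apply]
    split_ifs with e
    · omega
    · exact fun h' => h.le_en p (by omega) h'
  · rw [Function.update_of_ne (h.en_lt u hu).ne]
    exact h.last u hu

theorem LayoutUpTo.skip {x : ℕ} (h : LayoutUpTo G v (x + 1) N vt thr en) (hx : ¬ G.forb x v) :
    LayoutUpTo G v x N vt thr en := by
  refine ⟨h.toPreLayout, h.lt, h.vt_le, h.vt_pred, by have := h.le_thr; omega, fun y hy hlt => ?_,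
    h.en_lt, h.vt_en, h.le_en, h.last⟩
  have := h.thr_least y hy hlt
  have : y ≠ x := by rintro rfl; exact hx hy
  omega

/-- With `m = 0` all candidates have been examined, so `thr_least` leaves no partner below the last
threshold: the current end of the layout is the last position of `v`. -/
theorem LayoutUpTo.finish (h : LayoutUpTo G v 0 N vt thr en) :
    LayoutBelow G (v + 1) N vt thr (Function.update en v (N - 1)) := by
  have h₀ := h.lt
  refine ⟨h.toPreLayout, h.lt, fun p hp => by have := h.vt_le p hp; omega, fun u hu => ?_,
    fun u hu => ?_, fun p hp => ?_, fun u hu x hx => ?_⟩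
  all_goals rw [Function.update_apply]; split_ifs with e
  · omega
  · exact h.en_lt u (by omega)
  · rw [e]; exact h.vt_pred
  · exact h.vt_en u (by omega)
  · omega
  · exact h.le_en p hp (by have := h.vt_le p hp; omega)
  · subst e
    by_contra hlt
    have := h.thr_least x hx (by omega)
    omega
  · exact h.last u (by omega) x hx

theorem LayoutBelow.layout (h : LayoutBelow G G.n N vt thr en) : Layout G N vt thr en :=
  ⟨h.toPreLayout, h.en_lt, h.vt_en, h.le_en, h.last⟩

end

/-- Append a position of the vertex in variable 1, with the threshold in variable `k`. -/
def pushPosition (k : ℕ) : Stmt :=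
  .seq (.put 1 (.num 0) (.get 0 (.num 0) (.num 0)) (.var 1)) <|
  .seq (.put 2 (.num 0) (.get 0 (.num 0) (.num 0)) (.var k)) <|
    .put 0 (.num 0) (.num 0) (.get 0 (.num 0) (.num 0) + .num 1)

def layoutLoop : Stmt :=
  .loop (.var 0) <| .seq (pushPosition 1) <| .seq
    (.loop (.var 1) <| .bind (.var 1 - .num 1 - .var 3) <|
      .ite (.num 0) (.inp (.num 3 + (.var 0 * .var 0 + (.var 5 * .var 0 + .var 1))))
        (pushPosition 5) .skip)
    (.put 3 (.num 0) (.var 1) (.get 0 (.num 0) (.num 0) - .num 1))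

/-- The number `N` and the functions `vt`, `thr`, `en` stand in the first arrays, and all other
arrays are empty. -/
structure Holds (N : ℕ) (vt thr en : ℕ → ℕ) (st : Store) : Prop where
  scr : st.scr = fun _ => 0
  count : st.arr 0 0 0 = N
  vt_eq : st.arr 1 0 = vt
  thr_eq : st.arr 2 0 = thr
  en_eq : st.arr 3 0 = en
  zero : ∀ k i j, 4 ≤ k → st.arr k i j = 0

section

variable {C : Ctx} {G : Graph} {N v : ℕ} {vt thr en : ℕ → ℕ} {st : Store}

theorem pushPosition_run (hC : C.Large) (f : ℕ → ℕ) (hN : N < C.M) (hst : Holds N vt thr en st)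
    {env : List ℕ} {k x : ℕ} (h1 : 1 < env.length) (hk : k < env.length)
    (hv : lookup env 1 = v) (hx : lookup env k = x) (hvZ : v < C.Z) (hxZ : x < C.Z) :
    Run C f (pushPosition k) env st 3
      (Holds (N + 1) (Function.update vt N v) (Function.update thr N x) en) := by
  obtain ⟨hK, hZ, hM⟩ := hC
  have hMM : 8 * C.M ≤ C.M * C.M := Nat.mul_le_mul_right _ hM
  obtain ⟨h₁, h₂, h₃, h₄, h₅, h₆⟩ := hst
  refine Run.seq (T₁ := 1) (T₂ := 2) (R := fun st' => st' = st.put 1 0 N v)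
    (Run.put (by omega) ?_ ?_ ?_ ?_ ?_ ?_ ?_) ?_
  iterate 6
    simp only [Expr.Ok, Expr.eval, h₂, hv]; omega
  · simp only [Expr.eval, h₂, hv]
  rintro st₁ rfl
  have e : (st.put 1 0 N v).arr 0 0 0 = N := by rw [Store.put_arr, if_neg (by simp), h₂]
  refine Run.seq (T₁ := 1) (T₂ := 1) (R := fun st' => st' = (st.put 1 0 N v).put 2 0 N x)
    (Run.put (by omega) ?_ ?_ ?_ ?_ ?_ ?_ ?_) ?_
  iterate 6
    simp only [Expr.Ok, Expr.eval, e, hx]; omega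
  · simp only [Expr.eval, e, hx]
  rintro st₂ rfl
  have e' : ((st.put 1 0 N v).put 2 0 N x).arr 0 0 0 = N := by
    rw [Store.put_arr, if_neg (by simp), e]
  refine Run.put (by omega) ?_ ?_ ?_ ?_ ?_ ?_ ?_
  iterate 6
    simp only [Expr.Ok, Expr.eval, e', Op.eval]; omega
  simp only [Expr.eval, Op.eval, e']
  refine ⟨h₁, by simp [Store.put_arr], ?_, ?_, ?_, fun k i j hk => ?_⟩
  · funext p; simp [Store.put_arr, Function.update_apply, h₃]
  · funext p; simp [Store.put_arr, Function.update_apply, h₄]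
  · funext p; simp [Store.put_arr, h₅]
  · rw [Store.put_arr, if_neg (by omega), Store.put_arr, if_neg (by omega), Store.put_arr,
      if_neg (by omega), h₆ k i j hk]

/-- For each vertex all smaller vertices are tested in decreasing order, which takes quadratic time.
`card_le` applies to every intermediate layout and keeps the write position below `C.M`. -/
theorem layoutLoop_run (hC : Rep C G) (f : ℕ → ℕ) (hst : Holds 0 (fun _ => 0) (fun _ => 0)
      (fun _ => 0) st) :
    Run C f layoutLoop [G.n] st (1 + G.n * (6 * G.n + 6)) fun st' =>
      ∃ N vt thr en, Layout G N vt thr en ∧ G.n ≤ N ∧ Holds N vt thr en st' := by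
  obtain ⟨hK, hZ, hM⟩ := id hC.large
  have hMM : 8 * C.M ≤ C.M * C.M := Nat.mul_le_mul_right _ hM
  have hdim := hC.dim
  have hH := hC.length
  refine Run.mono (Run.loop_const (n := G.n) (fun v st' => ∃ N vt thr en,
    LayoutBelow G v N vt thr en ∧ Holds N vt thr en st') (6 * G.n + 5) ?_ rfl (by omega) ?_ ?_)
    le_rfl ?_
  · simp [Expr.Ok]
  · exact ⟨0, _, _, _, ⟨⟨by omega, by omega, by omega⟩, by omega, by omega, by omega, by omega,
      by omega, by omega⟩, hst⟩
  · rintro v hv st₁ ⟨N, vt, thr, en, hB, h⟩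
    have hN := hB.card_le
    simp only [List.cons_append, List.nil_append]
    refine Run.le (Run.seq (T₁ := 3) (T₂ := 6 * v + 2) (pushPosition_run (v := v) (x := v) hC.large
      f (by omega) h (by simp) (by simp) rfl rfl (by omega) (by omega)) fun st₂ h₂ => ?_)
      (by omega)
    refine Run.le (Run.seq (T₁ := 1 + v * (5 + 1)) (T₂ := 1) (R := fun st' => ∃ N vt thr,
      LayoutUpTo G v 0 N vt thr en ∧ Holds N vt thr en st') ?_ ?_) (by omega)
    · refine Run.mono (Run.loop_const (n := v) (fun y st' => ∃ N vt thr,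
        LayoutUpTo G v (v - y) N vt thr en ∧ Holds N vt thr en st') 5 ?_ rfl (by omega)
        ⟨_, _, _, hB.push hv, h₂⟩ ?_) le_rfl (fun st' h => by simpa using h)
      · simp [Expr.Ok]
      · rintro y hy st₃ ⟨N, vt, thr, hU, h⟩
        have hN := hU.card_le
        simp only [List.cons_append, List.nil_append]
        have hidx := index_lt (show v - 1 - y < G.n by omega) hv
        obtain ⟨hf, hf'⟩ := hC.forb (v - 1 - y) (by omega) v hv
        refine Run.bind (v := v - 1 - y) (T := 4) ?_ rfl (by omega) ?_
        · simp only [Expr.Ok, Expr.ok_sub, List.length_cons, List.length_nil]; omega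
        simp only [List.cons_append, List.nil_append]
        rw [show v - y = v - 1 - y + 1 by omega] at hU
        rw [show v - (y + 1) = v - 1 - y by omega]
        refine Run.ite (T := 3) ?_ ?_ (fun hlt => ?_) (fun hlt => ?_)
        · simp only [Expr.Ok]; omega
        · simp only [Expr.Ok, Expr.eval, Op.eval, lookup, List.length_cons, List.length_nil]
          omega
        · simp only [Expr.eval, Op.eval, lookup] at hlt
          exact (pushPosition_run (v := v) (x := v - 1 - y) hC.large f (by omega) h (by simp)
            (by simp) rfl rfl (by omega) (by omega)).mono le_rfl fun st' h' =>
              ⟨_, _, _, hU.push hv (hf'.1 (by omega)), h'⟩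
        · simp only [Expr.eval, Op.eval, lookup] at hlt
          exact (Run.skip ⟨_, _, _, hU.skip fun hx => by have := hf'.2 hx; omega, h⟩).le (by omega)
    · rintro st₃ ⟨N, vt, thr, hU, h⟩
      have hN := hU.card_le
      obtain ⟨h₁, h₂, h₃, h₄, h₅, h₆⟩ := h
      refine Run.put (by omega) ?_ ?_ ?_ ?_ ?_ ?_ ⟨N, vt, thr, _, hU.finish, ?_⟩
      iterate 6
        simp only [Expr.Ok, Expr.ok_sub, Expr.eval, Expr.eval_sub, lookup, h₂, List.length_cons,
          List.length_nil]
        omega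
      simp only [Expr.eval, Expr.eval_sub, lookup, h₂]
      refine ⟨h₁, by simp [Store.put_arr, h₂], ?_, ?_, ?_, fun k i j hk => ?_⟩
      · funext p; simp [Store.put_arr, h₃]
      · funext p; simp [Store.put_arr, h₄]
      · funext p; simp [Store.put_arr, Function.update_apply, h₅]
      · rw [Store.put_arr, if_neg (by omega), h₆ k i j hk]
  · rintro st' ⟨N, vt, thr, en, hB, h⟩
    exact ⟨N, vt, thr, en, hB.layout, hB.le, h⟩

/-- The domain `Near N 1` is empty, so zero tables are correct; no block is due, because `Combo`
needs `e ≥ 2` and thus a distance of at least 3. -/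
theorem Holds.inv (h : Holds N vt thr en st) :
    Inv G N vt thr en (Near N 1) (Blocks 1) st := by
  have tab : ∀ k, 4 ≤ k → ∀ X, Tab st k (Near N 1) X := fun k hk X a p => by
    rw [h.zero k a p hk]
    exact ⟨by omega, by omega, fun h' => by have := h'.1; simp only [Near] at this; omega⟩
  have acc : ∀ k, 4 ≤ k → ∀ X Y, Acc st k N X Y (Blocks 1) := fun k hk X Y => by
    refine ⟨fun a p => ?_, fun a p h' => ?_, fun b I W J hb => ?_⟩
    · rw [h.zero k a p hk]; omega
    · rw [h.zero k a p hk] at h'; omega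
    · obtain ⟨k, e, rfl, hle, hc⟩ := hb
      have h₁ := Nat.one_le_two_pow (n := k)
      have h₂ : 2 ≤ e := by unfold Combo at hc; omega
      have h₃ := Nat.mul_le_mul h₁ (show 3 ≤ e + 1 by omega)
      omega
  exact ⟨h.scr, h.vt_eq, h.thr_eq, h.en_eq, tab 4 (by omega) _, tab 5 (by omega) _,
    tab 6 (by omega) _, tab 7 (by omega) _, acc 8 (by omega) _ _, acc 9 (by omega) _ _,
    tab 10 (by omega) _⟩

end

end PAFP

namespace PAFP

open WordRAM PAFP.Graph

/-! ### Extracting a path from the tables -/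

section

variable {G : Graph} {N : ℕ} {vt thr en A P A' P' : ℕ → ℕ} {Q : List ℕ → Prop}

/-- Whatever paths are chosen for the first `k` tasks `(A i, P i)`, their concatenation, continued
by the list, satisfies `Q`. -/
def Pending (G : Graph) (vt thr A P : ℕ → ℕ) (Q : List ℕ → Prop) : ℕ → List ℕ → Prop
  | 0, L => Q L
  | k + 1, L => ∀ l, G.SafeWalk (vt (A k)) (vt (P k)) (thr (P k)) l →
      Pending G vt thr A P Q k (l ++ L)

theorem Pending.congr {k : ℕ} {L : List ℕ} (h : Pending G vt thr A P Q k L)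
    (he : ∀ i < k, A' i = A i ∧ P' i = P i) : Pending G vt thr A' P' Q k L := by
  induction k generalizing L with
  | zero => exact h
  | succ k ih =>
    intro l hl
    rw [(he k (by omega)).1, (he k (by omega)).2] at hl
    exact ih (h l hl) fun i hi => he i (by omega)

/-- There is a path for the pair of positions. -/
def Task (G : Graph) (N : ℕ) (vt thr en : ℕ → ℕ) (a p : ℕ) : Prop :=
  a ≤ p ∧ p < N ∧ en (vt a) = a ∧ (a = p ∨ TabS G vt thr en a p)

/-- The state of the extraction after `it` rounds, with `k` tasks, when the list `L` has been
found. -/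
structure Partial (G : Graph) (N : ℕ) (vt thr en : ℕ → ℕ) (Q : List ℕ → Prop) (A P : ℕ → ℕ)
    (k it : ℕ) (L : List ℕ) : Prop where
  pending : Pending G vt thr A P Q k L
  task : ∀ i < k, Task G N vt thr en (A i) (P i)
  budget : ∑ i ∈ Finset.range k, (P i + 1 - A i) + it ≤ N
  length : L.length ≤ it

/-- Every task has positive weight `P i + 1 - A i`, so the budget also bounds the height of the
stack. -/
theorem Partial.mem {k it : ℕ} {L : List ℕ} (h : Partial G N vt thr en Q A P k it L) :
    k ≤ N := by
  have h₁ : ∑ i ∈ Finset.range k, 1 ≤ ∑ i ∈ Finset.range k, (P i + 1 - A i) :=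
    Finset.sum_le_sum fun i hi => by
      have := (h.task i (Finset.mem_range.1 hi)).1; omega
  have h₂ := h.budget
  simp only [Finset.sum_const, Finset.card_range, smul_eq_mul, mul_one] at h₁
  omega

variable {k it : ℕ} {L : List ℕ}

theorem Partial.pop (h : Partial G N vt thr en Q A P (k + 1) it L) (he : A k = P k) :
    Partial G N vt thr en Q A P k (it + 1) (vt (P k) :: L) := by
  obtain ⟨h₁, h₂, h₃, h₄⟩ := h
  refine ⟨h₁ [vt (P k)] (by rw [he]; exact .single _ _), fun i hi => h₂ i (by omega), ?_, ?_⟩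
  · rw [Finset.sum_range_succ] at h₃; omega
  · simp only [List.length_cons]; omega

/-- The round is paid for by the right end of the topmost task, which moves to the left. The
hypothesis `hw` completes every path of the new task to one of the old task. -/
theorem Partial.replace (h : Partial G N vt thr en Q A P (k + 1) it L) {p : ℕ}
    (hp : p < P k) (hT : Task G N vt thr en (A k) p) {L' : List ℕ}
    (hL : L' = L ∨ ∃ v, L' = v :: L)
    (hw : ∀ l, G.SafeWalk (vt (A k)) (vt p) (thr p) l →
      ∃ m, G.SafeWalk (vt (A k)) (vt (P k)) (thr (P k)) m ∧ m ++ L = l ++ L') :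
    Partial G N vt thr en Q A (Function.update P k p) (k + 1) (it + 1) L' := by
  obtain ⟨h₁, h₂, h₃, h₄⟩ := h
  have hAk := hT.1
  refine ⟨fun l hl => ?_, fun i hi => ?_, ?_, ?_⟩
  · rw [Function.update_self] at hl
    obtain ⟨m, hm, e⟩ := hw l hl
    rw [← e]
    exact (h₁ m hm).congr fun i hi => ⟨rfl, Function.update_of_ne hi.ne _ _⟩
  · by_cases e : i = k
    · subst e; rwa [Function.update_self]
    · rw [Function.update_of_ne e]; exact h₂ i hi
  · rw [Finset.sum_range_succ] at h₃ ⊢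
    rw [Function.update_self, Finset.sum_congr rfl fun i hi => by
      rw [Function.update_of_ne (Finset.mem_range.1 hi).ne]]
    omega
  · rcases hL with rfl | ⟨v, rfl⟩
    · omega
    · simp only [List.length_cons]; omega

/-- The tasks `(A k, q)` and `(r, p)` replace `(A k, P k)`. As `q < r` and `p < P k`, their weights
add up to less than the old weight, which pays for the round. The right segment goes on top because
the list grows from its end towards the front. -/
theorem Partial.push (h : Partial G N vt thr en Q A P (k + 1) it L) {q r p : ℕ}
    (hqr : q < r) (hp : p < P k) (hTq : Task G N vt thr en (A k) q) (hTr : Task G N vt thr en r p)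
    (hw : ∀ l l', G.SafeWalk (vt (A k)) (vt q) (thr q) l → G.SafeWalk (vt r) (vt p) (thr p) l' →
      G.SafeWalk (vt (A k)) (vt (P k)) (thr (P k)) (l ++ l')) :
    Partial G N vt thr en Q (Function.update A (k + 1) r)
      (Function.update (Function.update P k q) (k + 1) p) (k + 2) (it + 1) L := by
  obtain ⟨h₁, h₂, h₃, h₄⟩ := h
  have hAk := hTq.1
  have hr := hTr.1
  have eA : ∀ i, i < k + 1 → Function.update A (k + 1) r i = A i := fun i hi =>
    Function.update_of_ne hi.ne _ _
  have eP : ∀ i, i < k → Function.update (Function.update P k q) (k + 1) p i = P i := fun i hi => by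
    rw [Function.update_of_ne (by omega), Function.update_of_ne (by omega)]
  have eP' : Function.update (Function.update P k q) (k + 1) p k = q := by simp
  refine ⟨fun l' hl' l hl => ?_, fun i hi => ?_, ?_, by omega⟩
  · rw [Function.update_self, Function.update_self] at hl'
    rw [eA k (by omega), eP'] at hl
    rw [← List.append_assoc]
    exact (h₁ _ (hw l l' hl hl')).congr fun i hi => ⟨eA i (by omega), eP i hi⟩
  · rcases Nat.lt_trichotomy i k with e | e | e
    · rw [eA i (by omega), eP i e]; exact h₂ i (by omega)
    · subst e
      rw [eA i (by omega), eP']; exact hTq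
    · have : i = k + 1 := by omega
      subst this
      rw [Function.update_self, Function.update_self]; exact hTr
  · rw [Finset.sum_range_succ] at h₃
    rw [Finset.sum_range_succ, Finset.sum_range_succ, Function.update_self, Function.update_self,
      eA k (by omega), eP', Finset.sum_congr rfl fun i hi => by
        rw [eA i (by have := Finset.mem_range.1 hi; omega), eP i (Finset.mem_range.1 hi)]]
    omega

/-- After `N` rounds the budget leaves no weight for tasks, and every task has positive weight. -/
theorem Partial.final (h : Partial G N vt thr en Q A P k N L) : Q L := by
  have h₁ := h.budget
  rcases k with _ | k
  · exact h.pending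
  · rw [Finset.sum_range_succ] at h₁
    have := (h.task k (by omega)).1
    omega

end

/-- Write the vertex in variable 9 in front of the list. -/
def emit : Stmt :=
  .seq (.put 0 (.num 0) (.num 3) (.get 0 (.num 0) (.num 3) - .num 1))
    (.put 13 (.num 0) (.get 0 (.num 0) (.num 3)) (.var 9))

/-- With `p` in variable 8, put into cell `c` an index `i < p` for which the entry at `i` in the row
of array `kX` given by variable `x`, and the entry of array `kY` at `(i, p)`, are both positive; if
there is none, leave the cell unchanged.  The number of variables in use is `d`. -/
def find (kX kY c x d : ℕ) : Stmt :=
  .loop (.var 8) <| .ite (.num 0) (.get kX (.var x) (.var d) * .get kY (.var d) (.var 8))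
    (.put 0 (.num 0) (.num c) (.var d)) .skip

/-- Treat the task in variables 7 and 8, which is the last one on the stack, when these positions
differ; its index is in variable 6 and the vertex of the second position in variable 9. -/
def splitTask : Stmt :=
  .bind (.get 1 (.num 0) (.var 7)) <| .bind (.get 2 (.num 0) (.var 8)) <|
  .ite (.var 11) (.var 10) (.put 12 (.num 0) (.var 6) (.var 8 - .num 1)) <|
  .seq (.put 0 (.num 0) (.num 4) (.var 7)) <| .seq (find 5 6 4 7 12) <|
  .bind (.get 0 (.num 0) (.num 4)) <| .seq (.put 12 (.num 0) (.var 6) (.var 12)) <|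
  .bind (.get 1 (.num 0) (.var 12)) <|
  .ite (.num 0) (.inp (.num 3 + (.var 13 * .var 0 + .var 9))) emit <|
  .seq (find 4 7 5 12 14) <|
  .seq (.put 11 (.num 0) (.var 6 + .num 1) (.get 0 (.num 0) (.num 5))) <|
  .seq (.put 12 (.num 0) (.var 6 + .num 1) (.var 8 - .num 1)) <|
    .put 0 (.num 0) (.num 2) (.var 6 + .num 2)

def extractRound : Stmt :=
  .ite (.num 0) (.get 0 (.num 0) (.num 2))
    (.bind (.get 0 (.num 0) (.num 2) - .num 1) <| .bind (.get 11 (.num 0) (.var 6)) <|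
      .bind (.get 12 (.num 0) (.var 6)) <| .bind (.get 1 (.num 0) (.var 8)) <|
      .ite (.var 7) (.var 8) splitTask (.seq emit (.put 0 (.num 0) (.num 2) (.var 6))))
    .skip

section

variable {C : Ctx} {G : Graph} {N : ℕ} {vt thr en : ℕ → ℕ} {st : Store} {env : List ℕ}

theorem emit_run (hC : C.Large) (f : ℕ → ℕ) {o v : ℕ} (ho : st.arr 0 0 3 = o) (hoM : o ≤ C.M)
    (ho0 : 1 ≤ o) (hlen : 9 < env.length) (hv : lookup env 9 = v) (hvZ : v < C.Z) :
    Run C f emit env st 2 fun st' => st' = (st.put 0 0 3 (o - 1)).put 13 0 (o - 1) v := by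
  obtain ⟨hK, hZ, hM⟩ := hC
  have hMM : 8 * C.M ≤ C.M * C.M := Nat.mul_le_mul_right _ hM
  refine Run.seq (T₁ := 1) (T₂ := 1) (R := fun st' => st' = st.put 0 0 3 (o - 1))
    (Run.put (by omega) ?_ ?_ ?_ ?_ ?_ ?_ ?_) ?_
  iterate 6
    simp only [Expr.Ok, Expr.ok_sub, Expr.eval, Expr.eval_sub, ho]; omega
  · simp only [Expr.eval, Expr.eval_sub, ho]
  rintro st₁ rfl
  have e : (st.put 0 0 3 (o - 1)).arr 0 0 3 = o - 1 := by simp [Store.put_arr]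
  refine Run.put (by omega) ?_ ?_ ?_ ?_ ?_ ?_ ?_
  iterate 6
    simp only [Expr.Ok, Expr.eval, e, hv]; omega
  simp only [Expr.eval, e, hv]

theorem Store.ext_arr {st st' : Store} (hs : st.scr = st'.scr)
    (h : ∀ k i j, st.arr k i j = st'.arr k i j) : st = st' := by
  cases st; cases st'
  simp only [Store.mk.injEq]
  exact ⟨funext fun k => funext fun i => funext fun j => h k i j, hs⟩

theorem Store.put_self (st : Store) (k i j : ℕ) : st.put k i j (st.arr k i j) = st :=
  Store.ext_arr rfl fun k' i' j' => by
    rw [Store.put_arr]; split_ifs with h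
    · obtain ⟨rfl, rfl, rfl⟩ := h; rfl
    · rfl

theorem Store.put_put (st : Store) (k i j v w : ℕ) :
    (st.put k i j v).put k i j w = st.put k i j w :=
  Store.ext_arr rfl fun k' i' j' => by
    rw [Store.put_arr, Store.put_arr, Store.put_arr]; split_ifs <;> rfl

theorem find_run (hC : C.Large) (f : ℕ → ℕ) {kX kY c x y p : ℕ} (hX : 0 < kX) (hY : 0 < kY)
    (hX' : kX < 14) (hY' : kY < 14) (hc : c < 8) (h8 : 8 < env.length) (hx : x < env.length)
    (hp : lookup env 8 = p) (hy : lookup env x = y) (hpM : p < C.M) (hyM : y < C.M) :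
    Run C f (find kX kY c x env.length) env st (1 + p * (2 + 1)) fun st' =>
      ∃ q, st' = st.put 0 0 c q ∧
        ((q = st.arr 0 0 c ∧ ∀ i < p, ¬ 0 < st.arr kX y i * st.arr kY i p) ∨
          (q < p ∧ 0 < st.arr kX y q * st.arr kY q p)) := by
  obtain ⟨hK, hZ, hM⟩ := hC
  have hMM : 8 * C.M ≤ C.M * C.M := Nat.mul_le_mul_right _ hM
  refine Run.mono (Run.loop_const (n := p) (fun n st' =>
      ∃ q, st' = st.put 0 0 c q ∧
        ((q = st.arr 0 0 c ∧ ∀ i < n, ¬ 0 < st.arr kX y i * st.arr kY i p) ∨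
          (q < p ∧ 0 < st.arr kX y q * st.arr kY q p))) 2 h8 hp (by omega)
    ⟨_, (Store.put_self st 0 0 c).symm, Or.inl ⟨rfl, by omega⟩⟩ ?_) le_rfl fun _ h => h
  rintro n hn st₁ ⟨q, rfl, hq⟩
  have l8 : lookup (env ++ [n, p]) 8 = p := by rw [lookup_append_left _ _ h8, hp]
  have lx : lookup (env ++ [n, p]) x = y := by rw [lookup_append_left _ _ hx, hy]
  have ld : lookup (env ++ [n, p]) env.length = n := lookup_append_right env [n, p] 0
  have eX : (st.put 0 0 c q).arr kX y n = st.arr kX y n := by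
    rw [Store.put_arr, if_neg (by omega)]
  have eY : (st.put 0 0 c q).arr kY n p = st.arr kY n p := by
    rw [Store.put_arr, if_neg (by omega)]
  have hlen : (env ++ [n, p]).length = env.length + 2 := by simp
  refine Run.ite (T := 1) ?_ ?_ (fun hlt => ?_) (fun hlt => ?_)
  · simp only [Expr.Ok]; omega
  · simp only [Expr.Ok, Expr.eval, l8, lx, ld, hlen]; omega
  · simp only [Expr.eval, Op.eval, l8, lx, ld, eX, eY] at hlt
    refine Run.put (by omega) ?_ ?_ ?_ ?_ ?_ ?_ ⟨n, ?_, Or.inr ⟨hn, hlt⟩⟩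
    iterate 6
      simp only [Expr.Ok, Expr.eval, ld, hlen]; omega
    simp only [Expr.eval, ld]
    exact Store.put_put ..
  · simp only [Expr.eval, Op.eval, l8, lx, ld, eX, eY] at hlt
    refine Run.skip ⟨q, rfl, hq.imp_left fun ⟨h₁, h₂⟩ => ⟨h₁, fun i hi => ?_⟩⟩
    rcases Nat.lt_succ_iff_lt_or_eq.1 hi with h | rfl
    · exact h₂ i h
    · exact hlt


theorem Store.put_row (st : Store) (k i j v : ℕ) :
    (st.put k i j v).arr k i = Function.update (st.arr k i) j v := by
  funext j'; simp [Store.put_arr, Function.update_apply]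

theorem Store.put_row_ne (st : Store) (k i j v : ℕ) {k' : ℕ} (h : k' ≠ k) :
    (st.put k i j v).arr k' = st.arr k' := by
  funext i' j'; rw [Store.put_arr, if_neg (by tauto)]

theorem Inv.put {D : ℕ → ℕ → Prop} {B : ℕ → ℕ → ℕ → ℕ → Prop} (h : Inv G N vt thr en D B st)
    {k : ℕ} (hk : k = 0 ∨ 10 < k) (i j v : ℕ) : Inv G N vt thr en D B (st.put k i j v) :=
  h.congr rfl fun k' _ _ => Store.put_row_ne _ _ _ _ _ (by omega)

theorem Tab.mul_pos {kX kY a q p : ℕ} {X Y : ℕ → ℕ → Prop} (hX : Tab st kX (Near N N) X)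
    (hY : Tab st kY (Near N N) Y) : 0 < st.arr kX a q * st.arr kY q p ↔
      a < q ∧ q < p ∧ p < N ∧ X a q ∧ Y q p := by
  have hx := hX a q
  have hy := hY q p
  constructor
  · intro h0
    have h1 := Nat.pos_of_mul_pos_right h0
    have h2 := Nat.pos_of_mul_pos_left h0
    obtain ⟨d₁, x⟩ := hx.2.1 (by omega)
    obtain ⟨d₂, y⟩ := hy.2.1 (by omega)
    exact ⟨d₁.1, d₂.1, d₂.2.1, x, y⟩
  · rintro ⟨h₁, h₂, h₃, x, y⟩
    rw [hx.2.2 ⟨⟨h₁, by omega, by omega⟩, x⟩, hy.2.2 ⟨⟨h₂, h₃, by omega⟩, y⟩]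
    simp

/-- The output pointer and the output list stand in the store. -/
def Holding (N : ℕ) (L : List ℕ) (st : Store) : Prop :=
  st.arr 0 0 3 = N - L.length ∧ ∀ i < L.length, st.arr 13 0 (N - L.length + i) = L.getD i 0

theorem Holding.cons {L : List ℕ} (h : Holding N L st) (hlt : L.length < N) (v : ℕ) :
    Holding N (v :: L) ((st.put 0 0 3 (N - L.length - 1)).put 13 0 (N - L.length - 1) v) := by
  refine ⟨?_, fun i hi => ?_⟩
  · simp [Store.put_arr, Nat.sub_sub]
  · rw [Store.put_row, Store.put_row_ne _ _ _ _ _ (by omega), List.length_cons]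
    rcases i with _ | i
    · rw [show N - (L.length + 1) + 0 = N - L.length - 1 by omega, Function.update_self]; rfl
    · simp only [List.length_cons] at hi
      rw [Function.update_of_ne (by omega),
        show N - (L.length + 1) + (i + 1) = N - L.length + i by omega]
      exact h.2 i (by omega)

theorem Holding.congr {L : List ℕ} (h : Holding N L st) {st' : Store}
    (h0 : st'.arr 0 0 3 = st.arr 0 0 3) (h13 : st'.arr 13 = st.arr 13) : Holding N L st' :=
  ⟨h0.trans h.1, by rw [h13]; exact h.2⟩

/-- The contents of the store after `it` rounds of the extraction. -/
def Extracting (G : Graph) (N : ℕ) (vt thr en : ℕ → ℕ) (Q : List ℕ → Prop) (it : ℕ) (st : Store) :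
    Prop :=
  Inv G N vt thr en (Near N N) (Blocks N) st ∧ ∃ L, Holding N L st ∧
    Partial G N vt thr en Q (st.arr 11 0) (st.arr 12 0) (st.arr 0 0 2) it L

variable {Q : List ℕ → Prop}

-- The proof of the recurrence is run backwards. Behind the threshold, `p` is replaced by `p - 1`.
-- Before it, a position `q` in front of the jump is searched; if the jump ends in `vt p` itself,
-- this vertex is written, otherwise a position `r` after the jump is searched and the task is
-- split. Two linear searches per round keep the extraction quadratic.
set_option maxHeartbeats 2000000 in
theorem splitTask_run (hC : Rep C G) (f : ℕ → ℕ) (hL : Layout G N vt thr en)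
    (hN : 2 * N ≤ C.M) {it k : ℕ} {L : List ℕ}
    (hI : Inv G N vt thr en (Near N N) (Blocks N) st) (hit : it < N)
    (hH : Holding N L st) (hk : st.arr 0 0 2 = k + 1)
    (hP : Partial G N vt thr en Q (st.arr 11 0) (st.arr 12 0) (k + 1) it L)
    {a p : ℕ} (ha : st.arr 11 0 k = a) (hp : st.arr 12 0 k = p) (hap : a < p) (x₂ x₃ x₅ : ℕ) :
    Run C f splitTask [G.n, N, x₂, x₃, it, x₅, k, a, p, vt p] st (6 * N + 20)
      (Extracting G N vt thr en Q (it + 1)) := by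
  obtain ⟨hK, hZ, hM⟩ := id hC.large
  have hMM : 8 * C.M ≤ C.M * C.M := Nat.mul_le_mul_right _ hM
  have hdim := hC.dim
  have hkN := hP.mem
  obtain ⟨-, hpN, hea, hT⟩ := hP.task k (by omega)
  have hlen := hP.length
  rw [ha] at hea hT
  rw [hp] at hpN hT
  have hS : TabS G vt thr en a p := hT.resolve_left (by omega)
  have va := hL.vt_lt a (by omega)
  have vp := hL.vt_lt p hpN
  have tp := hL.thr_le hpN
  have hvt := hL.vt_lt_vt hea hap hpN
  refine Run.bind (v := vt a) (T := 6 * N + 19) ?_ (by simp [Expr.eval, lookup, hI.vt_eq])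
    (by omega) ?_
  · simp only [Expr.Ok, Expr.eval, lookup, List.length_cons, List.length_nil]; omega
  refine Run.bind (v := thr p) (T := 6 * N + 18) ?_ (by simp [Expr.eval, lookup, hI.thr_eq])
    (by omega) ?_
  · simp only [Expr.Ok, Expr.eval, lookup, List.length_cons, List.length_nil, List.cons_append,
      List.nil_append]
    omega
  simp only [List.cons_append, List.nil_append]
  refine Run.ite (T := 6 * N + 17) ?_ ?_ (fun hlt => ?_) (fun hlt => ?_)
  · simp [Expr.Ok]
  · simp [Expr.Ok]
  · simp only [Expr.eval, lookup] at hlt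
    obtain ⟨h₁, h₂⟩ := hL.pred_of_lt hea hap hpN hlt
    refine Run.le (T := 1) (Run.put (by omega) ?_ ?_ ?_ ?_ ?_ ?_ ?_) (by omega)
    iterate 6
      simp only [Expr.Ok, Expr.ok_sub, Expr.eval, Expr.eval_sub, lookup, List.length_cons,
        List.length_nil]
      omega
    simp only [Expr.eval, Expr.eval_sub, lookup]
    refine ⟨hI.put (by omega) .., L, hH.congr (by simp [Store.put_arr])
      (Store.put_row_ne _ _ _ _ _ (by omega)), ?_⟩
    rw [Store.put_row, Store.put_row_ne _ _ _ _ _ (by omega),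
      Store.put_row_ne _ _ _ _ _ (by omega), hk]
    refine hP.replace (by omega) ?_ (Or.inl rfl) fun l hl => ⟨l, ?_, rfl⟩
    · rw [ha]
      exact ⟨h₁.le, by omega, hea, Or.inr ((hL.tabS_of_gt hea hap hpN hlt).1 hS)⟩
    · rw [ha] at hl ⊢
      rw [hp]
      exact (hL.safeWalk_pred hvt hpN hlt).2 hl
  · simp only [Expr.eval, lookup] at hlt
    have hne : vt a ≠ thr p := fun h => hL.not_tabS hea hap hpN h hS
    have hlt' : vt a < thr p := by omega
    refine Run.le (Run.seq (T₁ := 1) (T₂ := 6 * N + 16) (R := fun st' => st' = st.put 0 0 4 a)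
      (Run.put (by omega) ?_ ?_ ?_ ?_ ?_ ?_ ?_) fun st₁ hst₁ => ?_) (by omega)
    iterate 6
      simp only [Expr.Ok, Expr.eval, lookup, List.length_cons, List.length_nil]; omega
    · simp only [Expr.eval, lookup]
    have hI₁ : Inv G N vt thr en (Near N N) (Blocks N) st₁ := by
      rw [hst₁]; exact hI.put (by omega) ..
    refine Run.le (Run.seq (T₁ := 1 + p * (2 + 1)) (T₂ := 3 * N + 14)
      (find_run (env := [G.n, N, x₂, x₃, it, x₅, k, a, p, vt p, vt a, thr p]) (y := a) (p := p)
      hC.large f (by omega) (by omega) (by omega) (by omega)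
      (by omega) (by simp) (by simp) rfl rfl (by omega) (by omega)) ?_) (by omega)
    rintro st₂ ⟨q, hst₂, hq⟩
    simp only [hI₁.tabR.mul_pos hI₁.tabD] at hq
    rw [hst₁, Store.put_put] at hst₂
    -- The cell was preset to `a`. If the search finds nothing, `q = a` remains, and the recurrence
    -- says that the jump starts at `a` itself.
    have hq : q < p ∧ Task G N vt thr en a q ∧ TabD G vt thr en q p := by
      rcases hq with ⟨rfl, hno⟩ | ⟨hqp, haq, -, -, hR, hD⟩
      · have ea : st₁.arr 0 0 4 = a := by simp [hst₁, Store.put_arr]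
        rw [ea]
        refine ⟨hap, ⟨le_rfl, by omega, hea, Or.inl rfl⟩, ?_⟩
        rcases (hL.tabS_of_lt hea hap hpN hlt').1 hS with h | ⟨q, h₁, h₂, h₃, h₄⟩
        · exact h
        · exact absurd ⟨h₁, h₂, hpN, h₃, h₄⟩ (hno q h₂)
      · exact ⟨hqp, ⟨haq.le, by omega, hea, Or.inr hR.2⟩, hD⟩
    obtain ⟨hqp, hTq, heq, hqt, hD⟩ := hq
    have vq := hL.vt_lt q (by omega)
    have hidx := index_lt vq vp
    have hCH := hC.length
    obtain ⟨hadj, hadj'⟩ := hC.adj _ vq _ vp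
    refine Run.bind (v := q) (T := 3 * N + 13) ?_ ?_ (by omega) ?_
    · simp only [Expr.Ok, Expr.eval]; omega
    · simp [Expr.eval, hst₂, Store.put_arr]
    simp only [List.cons_append, List.nil_append]
    refine Run.le (Run.seq (T₁ := 1) (T₂ := 3 * N + 12)
      (R := fun st' => st' = (st.put 0 0 4 q).put 12 0 k q)
      (Run.put (by omega) ?_ ?_ ?_ ?_ ?_ ?_ ?_) fun st₃ hst₃ => ?_) (by omega)
    iterate 6
      simp only [Expr.Ok, Expr.eval, lookup, List.length_cons, List.length_nil]; omega
    · simp only [Expr.eval, lookup, hst₂]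
    have hI₃ : Inv G N vt thr en (Near N N) (Blocks N) st₃ := by
      rw [hst₃]; exact (hI.put (by omega) ..).put (by omega) ..
    have hH₃ : Holding N L st₃ := by
      refine hH.congr ?_ ?_ <;> rw [hst₃]
      · simp [Store.put_arr]
      · rw [Store.put_row_ne _ _ _ _ _ (by omega), Store.put_row_ne _ _ _ _ _ (by omega)]
    have e11 : st₃.arr 11 0 = st.arr 11 0 := by
      rw [hst₃, Store.put_row_ne _ _ _ _ _ (by omega), Store.put_row_ne _ _ _ _ _ (by omega)]
    have e12 : st₃.arr 12 0 = Function.update (st.arr 12 0) k q := by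
      rw [hst₃, Store.put_row, Store.put_row_ne _ _ _ _ _ (by omega)]
    have e2 : st₃.arr 0 0 2 = k + 1 := by simp [hst₃, Store.put_arr, hk]
    clear hst₃ hst₂
    refine Run.bind (v := vt q) (T := 3 * N + 11) ?_ (by simp [Expr.eval, lookup, hI₃.vt_eq])
      (by omega) ?_
    · simp only [Expr.Ok, Expr.eval, lookup, List.length_cons, List.length_nil]; omega
    simp only [List.cons_append, List.nil_append]
    refine Run.ite (T := 3 * N + 10) ?_ ?_ (fun hlt => ?_) (fun hlt => ?_)
    · simp only [Expr.Ok]; omega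
    · simp only [Expr.Ok, Expr.eval, Op.eval, lookup, List.length_cons, List.length_nil]; omega
    · simp only [Expr.eval, Op.eval, lookup] at hlt
      have hE := hadj'.1 (by omega)
      refine Run.mono (emit_run (v := vt p) hC.large f hH₃.1 (by omega) (by omega) (by simp) rfl
        (by omega)) (by omega) fun st' hst' => ?_
      rw [hst']
      refine ⟨(hI₃.put (by omega) ..).put (by omega) .., vt p :: L, hH₃.cons (by omega) _, ?_⟩
      rw [Store.put_row_ne _ _ _ _ _ (by omega), Store.put_row_ne _ _ _ _ _ (by omega),
        Store.put_row_ne _ _ _ _ _ (by omega), Store.put_row_ne _ _ _ _ _ (by omega),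
        Store.put_row_ne _ _ _ _ _ (by omega), e11, e12,
        show (st₃.put 0 0 3 (N - L.length - 1)).arr 0 0 2 = k + 1 by simp [Store.put_arr, e2]]
      refine hP.replace (by omega) (by rwa [ha]) (Or.inr ⟨_, rfl⟩) fun l hl => ⟨l ++ [vt p], ?_, by
        simp⟩
      rw [ha] at hl ⊢
      rw [hp]
      exact hL.join_adj (by omega) heq hqt hE hl
    · simp only [Expr.eval, Op.eval, lookup] at hlt
      obtain ⟨r₀, h₁, h₂, h₃, h₄⟩ := hD.resolve_left fun h => by have := hadj'.2 h; omega
      refine Run.le (Run.seq (T₁ := 1 + p * (2 + 1)) (T₂ := 3)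
        (find_run (env := [G.n, N, x₂, x₃, it, x₅, k, a, p, vt p, vt a, thr p, q, vt q])
        (y := q) (p := p) hC.large f (by omega) (by omega) (by omega) (by omega)
        (by omega) (by simp) (by simp) rfl rfl (by omega) (by omega)) ?_) (by omega)
      rintro st₄ ⟨r, hst₄, hr⟩
      simp only [hI₃.tabE.mul_pos hI₃.tabT] at hr
      -- This search cannot fail, since `r₀` is a hit; so its cell needs no preset value.
      have hr := hr.resolve_left fun h => h.2 r₀ h₂ ⟨h₁, h₂, hpN, h₃, h₄⟩
      obtain ⟨hrp, hqr, -, -, hE, hTt, hTS⟩ := hr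
      obtain ⟨h₅, h₆⟩ := hL.pred_of_lt hTS.1 hrp hpN hTt
      have hvr := hL.vt_lt_vt hTS.1 hrp hpN
      refine Run.seq (T₁ := 1) (T₂ := 2) (R := fun st' => st' = st₄.put 11 0 (k + 1) r)
        (Run.put (by omega) ?_ ?_ ?_ ?_ ?_ ?_ ?_) ?_
      iterate 6
        simp only [Expr.Ok, Expr.eval, lookup, List.length_cons, List.length_nil, Op.eval, hst₄,
          Store.put_arr, and_self, if_true]
        omega
      · simp only [Expr.eval, lookup, Op.eval, hst₄, Store.put_arr, and_self, if_true]
      rintro st₅ rfl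
      refine Run.seq (T₁ := 1) (T₂ := 1)
        (R := fun st' => st' = (st₄.put 11 0 (k + 1) r).put 12 0 (k + 1) (p - 1))
        (Run.put (by omega) ?_ ?_ ?_ ?_ ?_ ?_ ?_) ?_
      iterate 6
        simp only [Expr.Ok, Expr.ok_sub, Expr.eval, Expr.eval_sub, lookup, List.length_cons,
          List.length_nil, Op.eval]
        omega
      · simp only [Expr.eval, Expr.eval_sub, lookup, Op.eval]
      rintro st₆ rfl
      refine Run.put (by omega) ?_ ?_ ?_ ?_ ?_ ?_ ?_
      iterate 6
        simp only [Expr.Ok, Expr.eval, lookup, List.length_cons, List.length_nil, Op.eval]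
        omega
      simp only [Expr.eval, lookup, Op.eval, hst₄]
      refine ⟨(((hI₃.put (by omega) ..).put (by omega) ..).put (by omega) ..).put (by omega) .., L,
        hH₃.congr (by simp [Store.put_arr]) ?_, ?_⟩
      · rw [Store.put_row_ne _ _ _ _ _ (by omega), Store.put_row_ne _ _ _ _ _ (by omega),
          Store.put_row_ne _ _ _ _ _ (by omega), Store.put_row_ne _ _ _ _ _ (by omega)]
      have f11 : ((((st₃.put 0 0 5 r).put 11 0 (k + 1) r).put 12 0 (k + 1) (p - 1)).put 0 0 2
          (k + 2)).arr 11 0 = Function.update (st.arr 11 0) (k + 1) r := by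
        rw [Store.put_row_ne _ _ _ _ _ (by omega), Store.put_row_ne _ _ _ _ _ (by omega),
          Store.put_row, Store.put_row_ne _ _ _ _ _ (by omega), e11]
      have f12 : ((((st₃.put 0 0 5 r).put 11 0 (k + 1) r).put 12 0 (k + 1) (p - 1)).put 0 0 2
          (k + 2)).arr 12 0 = Function.update (Function.update (st.arr 12 0) k q) (k + 1)
            (p - 1) := by
        rw [Store.put_row_ne _ _ _ _ _ (by omega), Store.put_row,
          Store.put_row_ne _ _ _ _ _ (by omega), Store.put_row_ne _ _ _ _ _ (by omega), e12]
      have f2 : ((((st₃.put 0 0 5 r).put 11 0 (k + 1) r).put 12 0 (k + 1) (p - 1)).put 0 0 2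
          (k + 2)).arr 0 0 2 = k + 2 := by simp [Store.put_arr]
      rw [f11, f12, f2]
      -- The walk from `r` starts behind the threshold, so it is a task for `p - 1` already. This
      -- saves the unit of budget for the round.
      refine hP.push hqr (by omega) (by rwa [ha]) ⟨by omega, by omega, hTS.1,
        Or.inr ((hL.tabS_of_gt hTS.1 hrp hpN hTt).1 hTS)⟩ fun l l' hl hl' => ?_
      rw [ha] at hl ⊢
      rw [hp]
      exact hL.join (by omega) hpN heq hqt hE.2.2 hTt hvr hl
        ((hL.safeWalk_pred hvr hpN hTt).2 hl')

end

end PAFP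

/-! ### The extraction loop and the complete algorithm -/

namespace PAFP

open WordRAM PAFP.Graph

/-- With `n` and `N` in variables 0 and 1, extract a path.  At the end, the length of the output is
in cell 6 and the index of its first entry in cell 3. -/
def extract : Stmt :=
  .bind (.get 3 (.num 0) (.inp (.num 1))) <| .bind (.get 3 (.num 0) (.inp (.num 2))) <|
  .seq (.put 0 (.num 0) (.num 3) (.var 1)) <| .seq (.put 0 (.num 0) (.num 2) (.num 0)) <|
  .seq (.ite (.num 0) (.get 5 (.var 2) (.var 3) +
      (.num 1 - ((.var 2 - .var 3) + (.var 3 - .var 2))))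
    (.seq (.put 11 (.num 0) (.num 0) (.var 2)) <| .seq (.put 12 (.num 0) (.num 0) (.var 3)) <|
      .put 0 (.num 0) (.num 2) (.num 1)) .skip) <|
  .seq (.loop (.var 1) extractRound) <|
    .put 0 (.num 0) (.num 6) (.var 1 - .get 0 (.num 0) (.num 3))

/-- The complete algorithm. -/
def solve : Stmt :=
  .bind (.inp (.num 0)) <| .seq layoutLoop <| .bind (.get 0 (.num 0) (.num 0)) <|
    .seq mainLoop extract

section

variable {C : Ctx} {G : Graph} {N : ℕ} {vt thr en : ℕ → ℕ} {st : Store} {Q : List ℕ → Prop}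

/-- With an empty stack the round does nothing, and the budget condition is just `it + 1 ≤ N`. A
task with equal ends is a single vertex, which is written and removed. -/
theorem extractRound_run (hC : Rep C G) (f : ℕ → ℕ) (hL : Layout G N vt thr en)
    (hN : 2 * N ≤ C.M) {it : ℕ} (hit : it < N) (h : Extracting G N vt thr en Q it st)
    (x₂ x₃ x₅ : ℕ) :
    Run C f extractRound [G.n, N, x₂, x₃, it, x₅] st (6 * N + 30)
      (Extracting G N vt thr en Q (it + 1)) := by
  obtain ⟨hK, hZ, hM⟩ := id hC.large
  have hMM : 8 * C.M ≤ C.M * C.M := Nat.mul_le_mul_right _ hM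
  have hdim := hC.dim
  obtain ⟨hI, L, hH, hP⟩ := h
  have hlen := hP.length
  have hkN := hP.mem
  generalize hk : st.arr 0 0 2 = k at hP hkN
  refine Run.ite (T := 6 * N + 29) ?_ ?_ (fun hlt => ?_) (fun hlt => ?_)
  · simp only [Expr.Ok]; omega
  · simp only [Expr.Ok, Expr.eval]; omega
  · simp only [Expr.eval, hk] at hlt
    obtain ⟨k, rfl⟩ := Nat.exists_eq_add_of_lt hlt
    rw [zero_add] at hP hkN hk
    obtain ⟨hap, hpN, hea, hT⟩ := hP.task k (by omega)
    generalize ha : st.arr 11 0 k = a at hap hea hT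
    generalize hp : st.arr 12 0 k = p at hap hpN hT
    have vp := hL.vt_lt p hpN
    refine Run.bind (v := k) (T := 6 * N + 28) ?_ (by simp [Expr.eval, Expr.eval_sub, hk])
      (by omega) ?_
    · simp only [Expr.Ok, Expr.ok_sub, Expr.eval]; omega
    refine Run.bind (v := a) (T := 6 * N + 27) ?_ (by simp [Expr.eval, lookup, ha]) (by omega) ?_
    · simp only [Expr.Ok, Expr.eval, lookup, List.cons_append, List.nil_append, List.length_cons,
        List.length_nil]
      omega
    refine Run.bind (v := p) (T := 6 * N + 26) ?_ (by simp [Expr.eval, lookup, hp]) (by omega) ?_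
    · simp only [Expr.Ok, Expr.eval, lookup, List.cons_append, List.nil_append, List.length_cons,
        List.length_nil]
      omega
    refine Run.bind (v := vt p) (T := 6 * N + 25) ?_ (by simp [Expr.eval, lookup, hI.vt_eq])
      (by omega) ?_
    · simp only [Expr.Ok, Expr.eval, lookup, List.cons_append, List.nil_append, List.length_cons,
        List.length_nil]
      omega
    simp only [List.cons_append, List.nil_append]
    refine Run.ite (T := 6 * N + 24) ?_ ?_ (fun hlt => ?_) (fun hlt => ?_)
    · simp [Expr.Ok]
    · simp [Expr.Ok]
    · exact (splitTask_run hC f hL hN hI hit hH hk hP ha hp hlt ..).le (by omega)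
    · simp only [Expr.eval, lookup] at hlt
      have hap : a = p := by omega
      refine Run.le (Run.seq (T₁ := 2) (T₂ := 1) (emit_run (v := vt p) hC.large f hH.1 (by omega)
        (by omega) (by simp) rfl (by omega)) ?_) (by omega)
      rintro st₁ rfl
      refine Run.put (by omega) ?_ ?_ ?_ ?_ ?_ ?_ ?_
      iterate 6
        simp only [Expr.Ok, Expr.eval, lookup, List.length_cons, List.length_nil]; omega
      simp only [Expr.eval, lookup]
      refine ⟨((hI.put (by omega) ..).put (by omega) ..).put (by omega) .., vt p :: L,
        (hH.cons (by omega) _).congr (by simp [Store.put_arr])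
          (Store.put_row_ne _ _ _ _ _ (by omega)), ?_⟩
      have f2 : (((st.put 0 0 3 (N - L.length - 1)).put 13 0 (N - L.length - 1) (vt p)).put 0 0 2
          k).arr 0 0 2 = k := by simp [Store.put_arr]
      rw [f2]
      iterate 2
        rw [Store.put_row_ne _ _ _ _ _ (by omega), Store.put_row_ne _ _ _ _ _ (by omega),
          Store.put_row_ne _ _ _ _ _ (by omega)]
      have := hP.pop (by rw [ha, hp, hap])
      rwa [hp] at this
  · simp only [Expr.eval, hk] at hlt
    obtain rfl : k = 0 := by omega
    refine (Run.skip ⟨hI, L, hH, ?_⟩).le (by omega)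
    rw [hk]
    exact ⟨hP.1, hP.2, by simp only [Finset.range_zero, Finset.sum_empty]; omega, by omega⟩

/-- The store contains the output `L`. -/
def Output (M : ℕ) (L : List ℕ) (st : Store) : Prop :=
  st.arr 0 0 6 = L.length ∧ st.arr 0 0 3 + L.length ≤ M ∧
    ∀ i < L.length, st.arr 13 0 (st.arr 0 0 3 + i) = L.getD i 0

/-- The correct outputs for paths from `s` to `t`. -/
def Graph.Correct (G : Graph) (s t : ℕ) (L : List ℕ) : Prop :=
  G.SafeWalk s t 0 L ∨ (L = [] ∧ ¬ ∃ l, G.SafeWalk s t 0 l)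

/-- The single initial task leads from the last position of `s` to the last position of `t`, where
no forbidden pair is tolerated. Without a path the stack stays empty and so does the output. -/
theorem extract_run (hC : Rep C G) (f : ℕ → ℕ) (hL : Layout G N vt thr en)
    (hN : 2 * N ≤ C.M) (h : Inv G N vt thr en (Near N N) (Blocks N) st) {s t : ℕ} (hs : s < G.n)
    (ht : t < G.n) (hs' : C.inp 1 = s) (ht' : C.inp 2 = t) :
    Run C f extract [G.n, N] st (N * (6 * N + 31) + 20)
      fun st' => ∃ L, G.Correct s t L ∧ Output C.M L st' := by
  obtain ⟨hK, hZ, hM⟩ := id hC.large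
  have hMM : 8 * C.M ≤ C.M * C.M := Nat.mul_le_mul_right _ hM
  have hdim := hC.dim
  have hH := hC.length
  have es := hL.en_lt s hs
  have et := hL.en_lt t ht
  have vs := hL.vt_en s hs
  have vvt := hL.vt_en t ht
  refine Run.bind (v := en s) (T := N * (6 * N + 31) + 19) ?_
    (by simp [Expr.eval, h.en_eq, hs']) (by omega) ?_
  · simp only [Expr.Ok, Expr.eval, hs']; omega
  refine Run.bind (v := en t) (T := N * (6 * N + 31) + 18) ?_
    (by simp [Expr.eval, h.en_eq, ht']) (by omega) ?_
  · simp only [Expr.Ok, Expr.eval, ht']; omega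
  simp only [List.cons_append, List.nil_append]
  refine Run.le (Run.seq (T₁ := 1) (T₂ := N * (6 * N + 31) + 17)
    (R := fun st' => st' = st.put 0 0 3 N)
    (Run.put (by omega) ?_ ?_ ?_ ?_ ?_ ?_ ?_) ?_) (by omega)
  iterate 6
    simp only [Expr.Ok, Expr.eval, lookup, List.length_cons, List.length_nil]; omega
  · simp only [Expr.eval, lookup]
  rintro st₁ rfl
  refine Run.le (Run.seq (T₁ := 1) (T₂ := N * (6 * N + 31) + 16)
    (R := fun st' => st' = (st.put 0 0 3 N).put 0 0 2 0)
    (Run.put (by omega) ?_ ?_ ?_ ?_ ?_ ?_ ?_) ?_) (by omega)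
  iterate 6
    simp only [Expr.Ok, Expr.eval]; omega
  · simp only [Expr.eval]
  rintro st₁ hst₁
  have hI₁ : Inv G N vt thr en (Near N N) (Blocks N) st₁ := by
    rw [hst₁]; exact (h.put (by omega) ..).put (by omega) ..
  have e3 : st₁.arr 0 0 3 = N := by simp [hst₁, Store.put_arr]
  have e2 : st₁.arr 0 0 2 = 0 := by simp [hst₁, Store.put_arr]
  clear hst₁
  have hH₁ : Holding N [] st₁ := ⟨e3, by simp⟩
  have hval := hI₁.tabR (en s) (en t)
  refine Run.le (Run.seq (T₁ := 4) (T₂ := N * (6 * N + 31) + 2)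
    (R := Extracting G N vt thr en (G.Correct s t) 0) ?_ fun st₂ h₂ => ?_) (by omega)
  · refine Run.ite (T := 3) ?_ ?_ (fun hlt => ?_) (fun hlt => ?_)
    · simp only [Expr.Ok]; omega
    · simp only [Expr.Ok, Expr.ok_sub, Expr.eval, lookup, List.length_cons, List.length_nil]
      omega
    · simp only [Expr.eval, Expr.eval_sub, Op.eval, lookup] at hlt
      refine Run.le (Run.seq (T₁ := 1) (T₂ := 2) (R := fun st' => st' = st₁.put 11 0 0 (en s))
        (Run.put (by omega) ?_ ?_ ?_ ?_ ?_ ?_ ?_) ?_) (by omega)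
      iterate 6
        simp only [Expr.Ok, Expr.eval, lookup, List.length_cons, List.length_nil]; omega
      · simp only [Expr.eval, lookup]
      rintro st₂ rfl
      refine Run.le (Run.seq (T₁ := 1) (T₂ := 1)
        (R := fun st' => st' = (st₁.put 11 0 0 (en s)).put 12 0 0 (en t))
        (Run.put (by omega) ?_ ?_ ?_ ?_ ?_ ?_ ?_) ?_) (by omega)
      iterate 6
        simp only [Expr.Ok, Expr.eval, lookup, List.length_cons, List.length_nil]; omega
      · simp only [Expr.eval, lookup]
      rintro st₂ rfl
      refine Run.put (by omega) ?_ ?_ ?_ ?_ ?_ ?_ ?_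
      iterate 6
        simp only [Expr.Ok, Expr.eval]; omega
      simp only [Expr.eval]
      refine ⟨((hI₁.put (by omega) ..).put (by omega) ..).put (by omega) .., [], ?_, ?_⟩
      · refine hH₁.congr (by simp [Store.put_arr]) ?_
        rw [Store.put_row_ne _ _ _ _ _ (by omega), Store.put_row_ne _ _ _ _ _ (by omega),
          Store.put_row_ne _ _ _ _ _ (by omega)]
      have f2 : (((st₁.put 11 0 0 (en s)).put 12 0 0 (en t)).put 0 0 2 1).arr 0 0 2 = 1 := by
        simp [Store.put_arr]
      have f11 : (((st₁.put 11 0 0 (en s)).put 12 0 0 (en t)).put 0 0 2 1).arr 11 0 0 = en s := by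
        simp [Store.put_arr]
      have f12 : (((st₁.put 11 0 0 (en s)).put 12 0 0 (en t)).put 0 0 2 1).arr 12 0 0 = en t := by
        simp [Store.put_arr]
      -- The tested sum is positive if `TabR` holds or if `en s = en t`: with truncated subtraction
      -- the second summand is 1 exactly for equal positions, which have no table entry.
      have hT : en s ≤ en t ∧ (en s = en t ∨ TabS G vt thr en (en s) (en t)) := by
        by_cases e : en s = en t
        · exact ⟨e.le, Or.inl e⟩
        · obtain ⟨h₁, h₂⟩ := hval.2.1 (by omega)
          exact ⟨h₁.1.le, Or.inr h₂.2⟩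
      rw [f2]
      refine ⟨fun l hl => ?_, fun i hi => ?_, ?_, by simp⟩
      · rw [f11, f12] at hl
        have := hL.safeWalk_zero et (by rw [vvt]) hl
        rw [vs, vvt] at this
        rw [List.append_nil]
        exact Or.inl this
      · obtain rfl : i = 0 := by omega
        rw [f11, f12]
        exact ⟨hT.1, et, by rw [vs], hT.2⟩
      · rw [Finset.sum_range_one, f11, f12]; omega
    · simp only [Expr.eval, Expr.eval_sub, Op.eval, lookup] at hlt
      refine (Run.skip ⟨hI₁, [], hH₁, ?_⟩).le (by omega)
      rw [e2]
      refine ⟨Or.inr ⟨rfl, ?_⟩, by omega, by simp, by simp⟩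
      rintro ⟨l, hl⟩
      have hne : en s ≠ en t := by omega
      rcases hl.1.le.lt_or_eq with hst | rfl
      · have hlt' := hL.lt_en es ht (by rwa [vs])
        have := hval.2.2 ⟨⟨hlt', et, by omega⟩, by rw [vvt], by rw [vs], l, by
          rw [vs, vvt]; exact hl.of_zero⟩
        omega
      · exact hne rfl
  · refine Run.le (Run.seq (T₁ := 1 + N * (6 * N + 30 + 1)) (T₂ := 1)
      (R := Extracting G N vt thr en (G.Correct s t) N) ?_ ?_)
      (by have : N * (6 * N + 30 + 1) = N * (6 * N + 31) := rfl; omega)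
    · exact Run.loop_const (fun it => Extracting G N vt thr en (G.Correct s t) it) _
        (by simp [Expr.Ok]) rfl (by omega) h₂
        fun it hit st' h' => extractRound_run hC f hL hN hit h' ..
    · rintro st₃ ⟨hI, L, hH, hP⟩
      have hlen := hP.length
      have e3 := hH.1
      refine Run.put (by omega) ?_ ?_ ?_ ?_ ?_ ?_ ?_
      iterate 6
        simp only [Expr.Ok, Expr.ok_sub, Expr.eval, Expr.eval_sub, lookup, List.length_cons,
          List.length_nil]
        omega
      simp only [Expr.eval, Expr.eval_sub, lookup]
      have f3 : (st₃.put 0 0 6 (N - st₃.arr 0 0 3)).arr 0 0 3 = N - L.length := by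
        simp [Store.put_arr, e3]
      refine ⟨L, hP.final, by simp [Store.put_arr, e3]; omega, by rw [f3]; omega, fun i hi => ?_⟩
      rw [f3, Store.put_row_ne _ _ _ _ _ (by omega)]
      exact hH.2 i hi

/-- The time for the complete algorithm on a graph with `n` vertices and a layout of length `N`. -/
def solveTime (f : ℕ → ℕ) (n N : ℕ) : ℕ :=
  n * (6 * n + 6) + mainTime f N + N * (6 * N + 31) + 23

theorem levelTime_mono (f : ℕ → ℕ) {N N' : ℕ} (h : N ≤ N') (d k : ℕ) :
    levelTime f N d k ≤ levelTime f N' d k := by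
  unfold levelTime
  split_ifs with h₁ h₂
  · exact Nat.mul_le_mul_right _ (Nat.add_le_add_right (Nat.div_le_div_right h) _)
  · exact absurd ⟨h₁.1, h₁.2.trans h⟩ h₂
  · exact Nat.zero_le _
  · exact Nat.zero_le _

/-- The length of the layout is not determined by `n`, so the running time is majorized by its value
at `3n`. -/
theorem mainTime_mono (f : ℕ → ℕ) {N N' : ℕ} (h : N ≤ N') : mainTime f N ≤ mainTime f N' := by
  unfold mainTime
  refine Nat.add_le_add_left ((Finset.sum_le_sum fun i _ => ?_).trans
    (Finset.sum_le_sum_of_subset (Finset.range_mono (by omega)))) _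
  have : ∑ k ∈ Finset.range N, (levelTime f N (i + 1) k + 6 + 1) ≤
      ∑ k ∈ Finset.range N', (levelTime f N' (i + 1) k + 6 + 1) :=
    (Finset.sum_le_sum fun k _ => by have := levelTime_mono f h (i + 1) k; omega).trans
      (Finset.sum_le_sum_of_subset (Finset.range_mono h))
  omega

theorem solve_run (hC : Rep C G) (f : ℕ → ℕ) (hst : Holds 0 (fun _ => 0) (fun _ => 0)
      (fun _ => 0) st) {s t : ℕ} (hs : s < G.n) (ht : t < G.n) (hs' : C.inp 1 = s)
    (ht' : C.inp 2 = t) :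
    Run C f solve [] st (solveTime f G.n (3 * G.n))
      fun st' => ∃ L, G.Correct s t L ∧ Output C.M L st' := by
  obtain ⟨hK, hZ, hM⟩ := id hC.large
  have hMM : 8 * C.M ≤ C.M * C.M := Nat.mul_le_mul_right _ hM
  have hdim := hC.dim
  have hH := hC.length
  unfold solveTime
  refine Run.le (T := mainTime f (3 * G.n) + 3 * G.n * (6 * (3 * G.n) + 31) +
    (G.n * (6 * G.n + 6) + 22) + 1)
    (Run.bind (v := G.n) ?_ (by simp [Expr.eval, hC.inp_n]) (by omega) ?_) (by omega)
  · simp only [Expr.Ok, Expr.eval]; omega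
  simp only [List.nil_append]
  refine Run.le (Run.seq (T₂ := mainTime f (3 * G.n) + 3 * G.n * (6 * (3 * G.n) + 31) + 20 + 1)
    (layoutLoop_run hC f hst) ?_) (by rw [Nat.mul_comm G.n (6 * G.n + 6)]; omega)
  rintro st₁ ⟨N, vt, thr, en, hL, hn, hst₁⟩
  have hN := hL.card_le
  have e := hst₁.count
  refine Run.bind (v := N) ?_ (by simp [Expr.eval, e]) (by omega) ?_
  · simp only [Expr.Ok, Expr.eval]; omega
  simp only [List.cons_append, List.nil_append]
  refine Run.le (Run.seq (mainLoop_run hC f hL (by omega) (by omega) hst₁.inv)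
    fun st₂ h₂ => extract_run hC f hL (by omega) h₂ hs ht hs' ht') ?_
  have h₁ := mainTime_mono f hN
  have h₂ : N * (6 * N + 31) ≤ 3 * G.n * (6 * (3 * G.n) + 31) := Nat.mul_le_mul hN (by omega)
  omega

end

end PAFP

namespace PAFP

open WordRAM PAFP.Graph

/-! ### Estimates of the running time -/

/-- Since `n ^ ω` does not vanish for `n ≥ 1`, one constant works from 1 on. This is needed because
small block dimensions occur for every `N`. -/
theorem exists_le_mul_rpow {f : ℕ → ℕ} {ω : ℝ}
    (h : (fun n => (f n : ℝ)) =O[Filter.atTop] fun n => (n : ℝ) ^ ω) :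
    ∃ A : ℝ, 0 < A ∧ ∀ n : ℕ, 1 ≤ n → (f n : ℝ) ≤ A * (n : ℝ) ^ ω := by
  obtain ⟨A, hA, hb⟩ := Asymptotics.bound_of_isBigO_nat_atTop h
  refine ⟨A, hA, fun n hn => ?_⟩
  have hn' : (0 : ℝ) < n := by exact_mod_cast hn
  have := hb (x := n) (Real.rpow_pos_of_pos hn' ω).ne'
  rwa [Real.norm_of_nonneg (Nat.cast_nonneg _),
    Real.norm_of_nonneg (Real.rpow_pos_of_pos hn' ω).le] at this

theorem sq_le_rpow {ω : ℝ} (hω : 2 < ω) {n : ℕ} (hn : 1 ≤ n) : (n : ℝ) * n ≤ (n : ℝ) ^ ω := by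
  have h : (1 : ℝ) ≤ n := by exact_mod_cast hn
  calc (n : ℝ) * n = (n : ℝ) ^ (2 : ℝ) := by rw [Real.rpow_two, sq]
    _ ≤ (n : ℝ) ^ ω := Real.rpow_le_rpow_of_exponent_le h hω.le

/-- The powers of two up to `N` form a geometric series. -/
theorem sum_two_pow_le {r : ℝ} (hr : 1 < r) {δ : ℝ} (hδ : r = 2 ^ δ) (hδ₀ : 0 ≤ δ) {N : ℕ}
    (hN : 1 ≤ N) :
    ∑ k ∈ Finset.range N, (if 2 ^ k ≤ N then r ^ k else 0) ≤ r / (r - 1) * (N : ℝ) ^ δ := by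
  have hr0 : (0 : ℝ) < r := by linarith
  rw [← Finset.sum_filter]
  have hsub : Finset.filter (fun k => 2 ^ k ≤ N) (Finset.range N) ⊆
      Finset.range (Nat.log 2 N + 1) := by
    intro k hk
    rw [Finset.mem_range, Nat.lt_succ_iff]
    exact Nat.le_log_of_pow_le (by norm_num) (Finset.mem_filter.1 hk).2
  refine (Finset.sum_le_sum_of_subset_of_nonneg hsub fun k _ _ => by positivity).trans ?_
  rw [geom_sum_eq hr.ne', div_mul_eq_mul_div, div_le_div_iff_of_pos_right (by linarith)]
  have h₁ : r ^ Nat.log 2 N ≤ (N : ℝ) ^ δ := by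
    rw [hδ, ← Real.rpow_natCast, ← Real.rpow_mul (by norm_num), mul_comm,
      Real.rpow_mul (by norm_num)]
    refine Real.rpow_le_rpow (by positivity) ?_ hδ₀
    rw [Real.rpow_natCast]
    exact_mod_cast Nat.pow_log_le_self 2 (by omega)
  calc r ^ (Nat.log 2 N + 1) - 1 ≤ r ^ (Nat.log 2 N + 1) := by linarith
    _ = r * r ^ Nat.log 2 N := pow_succ' _ _
    _ ≤ r * (N : ℝ) ^ δ := mul_le_mul_of_nonneg_left h₁ hr0.le

/-- The number of distances after which blocks of dimension `b` are multiplied. -/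
theorem card_dvd_le {b N : ℕ} (hb : 0 < b) :
    ((Finset.range (N - 1)).filter fun i => b ∣ i + 1 + 1).card ≤ N / b := by
  have : ((Finset.range (N - 1)).filter fun i => b ∣ i + 1 + 1).card ≤
      (Finset.Ioc 0 (N / b)).card := by
    refine Finset.card_le_card_of_injOn (fun i => (i + 2) / b) (fun i hi => ?_)
      fun i hi j hj e => ?_
    · simp only [Finset.coe_filter, Finset.mem_range, Set.mem_ofPred_eq] at hi
      simp only [Finset.coe_Ioc, Set.mem_Ioc]
      exact ⟨Nat.div_pos (Nat.le_of_dvd (by omega) hi.2) hb, Nat.div_le_div_right (by omega)⟩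
    · simp only [Finset.coe_filter, Finset.mem_range, Set.mem_ofPred_eq] at hi hj
      have h₁ := Nat.div_mul_cancel hi.2
      have h₂ := Nat.div_mul_cancel hj.2
      have e : (i + 2) / b = (j + 2) / b := e
      rw [show i + 1 + 1 = i + 2 from rfl] at h₁
      rw [show j + 1 + 1 = j + 2 from rfl, ← e] at h₂
      omega
  simpa using this

/-- At scale `2 ^ k` work is only done after the distances preceding multiples of `2 ^ k`, of which
there are at most `N / 2 ^ k`. -/
theorem sum_levelTime_le (f : ℕ → ℕ) (N k : ℕ) :
    ∑ i ∈ Finset.range (N - 1), levelTime f N (i + 1) k ≤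
      if 2 ^ k ≤ N then N / 2 ^ k * ((N / 2 ^ k + 1) * (4 * cubeTime f (2 ^ k) + 1)) else 0 := by
  unfold levelTime
  split_ifs with h
  · simp only [h, and_true]
    rw [← Finset.sum_filter, Finset.sum_const, smul_eq_mul]
    exact Nat.mul_le_mul_right _ (card_dvd_le (by positivity))
  · simp [h]

/-- One scale `b` costs at most `(N/b) * (2N/b)` times `D * b ^ ω`, which is `2 * D * N² * b ^ (ω -
2)`. For `b = 2 ^ k` these are the terms of a geometric series with ratio `r = 2 ^ (ω - 2) > 1`,
dominated by the largest scale. -/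
theorem exists_mainTime_le {f : ℕ → ℕ} {ω A : ℝ} (hω : 2 < ω) (hA : 0 < A)
    (hf : ∀ n : ℕ, 1 ≤ n → (f n : ℝ) ≤ A * (n : ℝ) ^ ω) :
    ∃ B : ℝ, 0 < B ∧ ∀ N : ℕ, 1 ≤ N → (mainTime f N : ℝ) ≤ B * (N : ℝ) ^ ω := by
  set r : ℝ := 2 ^ (ω - 2) with hr
  have hr1 : 1 < r := Real.one_lt_rpow (by norm_num) (by linarith)
  have hr0 : 0 < r - 1 := by linarith
  -- Here `4 * cubeTime f b + 1` is `8 * f b + 80 * b² + 97`, and both `b²` and 1 are at most `b ^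
  -- ω`.
  set D : ℝ := 8 * A + 177 with hD
  have hD0 : 0 < D := by positivity
  refine ⟨30 + 2 * D * (r / (r - 1)), by positivity, fun N hN => ?_⟩
  have hN' : (1 : ℝ) ≤ N := by exact_mod_cast hN
  have hsq := sq_le_rpow hω hN
  have hN0 : (0 : ℝ) < N := by linarith
  have level : ∀ k, ((if 2 ^ k ≤ N then N / 2 ^ k * ((N / 2 ^ k + 1) *
      (4 * cubeTime f (2 ^ k) + 1)) else 0 : ℕ) : ℝ) ≤
      2 * D * ((N : ℝ) * N) * (if 2 ^ k ≤ N then r ^ k else 0) := by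
    intro k
    split_ifs with h
    · have hb : 1 ≤ 2 ^ k := Nat.one_le_two_pow
      generalize hbe : 2 ^ k = b at h hb
      have hb' : (1 : ℝ) ≤ b := by exact_mod_cast hb
      have hb0 : (0 : ℝ) < b := by linarith
      have hbsq := sq_le_rpow hω hb
      have hfb := hf b hb
      have h1b : (1 : ℝ) ≤ (b : ℝ) * b := by nlinarith
      have hcube : ((4 * cubeTime f b + 1 : ℕ) : ℝ) ≤ D * (b : ℝ) ^ ω := by
        unfold cubeTime
        push_cast
        rw [hD]
        nlinarith
      have hdiv : ((N / b : ℕ) : ℝ) ≤ N / b := Nat.cast_div_le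
      have hdiv1 : (1 : ℝ) ≤ N / b := by
        rw [le_div_iff₀ hb0, one_mul]; exact_mod_cast h
      have hpow : (b : ℝ) ^ ω = b * b * r ^ k := by
        have e₁ : r ^ k = (b : ℝ) ^ (ω - 2) := by
          rw [hr, ← Real.rpow_natCast, ← Real.rpow_mul (by norm_num), mul_comm,
            Real.rpow_mul (by norm_num), Real.rpow_natCast, ← hbe]
          push_cast; rfl
        rw [e₁, Real.rpow_sub hb0, Real.rpow_two]
        field_simp
      push_cast at hcube ⊢
      calc ((N / b : ℕ) : ℝ) * ((((N / b : ℕ) : ℝ) + 1) * (4 * (cubeTime f b : ℝ) + 1))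
          ≤ (N / b : ℝ) * ((N / b + N / b : ℝ) * (D * (b : ℝ) ^ ω)) := by gcongr
        _ = 2 * D * ((N : ℝ) * N) * r ^ k := by rw [hpow]; field_simp; ring
    · simp
  have sum := sum_two_pow_le hr1 hr (by linarith) hN
  have hpow : (N : ℝ) * N * (N : ℝ) ^ (ω - 2) = (N : ℝ) ^ ω := by
    rw [Real.rpow_sub hN0, Real.rpow_two]
    field_simp
  have split : mainTime f N ≤ 1 + N * (21 * N + 5) + ∑ k ∈ Finset.range N,
      if 2 ^ k ≤ N then N / 2 ^ k * ((N / 2 ^ k + 1) * (4 * cubeTime f (2 ^ k) + 1)) else 0 := by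
    refine le_trans ?_ (Nat.add_le_add_left
      (Finset.sum_le_sum fun k _ => sum_levelTime_le f N k) _)
    -- The sum over distances is taken first for each fixed scale.
    rw [Finset.sum_comm]
    unfold mainTime
    have e : ∀ i, 1 + N * 14 + (2 + ∑ k ∈ Finset.range N, (levelTime f N (i + 1) k + 6 + 1)) + 1
        + 1 = (21 * N + 5) + ∑ k ∈ Finset.range N, levelTime f N (i + 1) k := by
      intro i
      simp only [Finset.sum_add_distrib, Finset.sum_const, Finset.card_range, smul_eq_mul]
      omega
    simp only [e]
    rw [Finset.sum_add_distrib, Finset.sum_const, Finset.card_range, smul_eq_mul]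
    have := Nat.mul_le_mul_right (21 * N + 5) (Nat.sub_le N 1)
    omega
  have split' : (mainTime f N : ℝ) ≤ 1 + N * (21 * N + 5) +
      ∑ k ∈ Finset.range N, 2 * D * ((N : ℝ) * N) * (if 2 ^ k ≤ N then r ^ k else 0) := by
    refine le_trans (Nat.cast_le.2 split) ?_
    push_cast
    refine add_le_add_right (Finset.sum_le_sum fun k _ => ?_) _
    have := level k
    push_cast at this
    exact this
  rw [← Finset.mul_sum] at split'
  have h₁ := mul_le_mul_of_nonneg_left sum (show 0 ≤ 2 * D * ((N : ℝ) * N) by positivity)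
  have h₂ : 2 * D * ((N : ℝ) * N) * (r / (r - 1) * (N : ℝ) ^ (ω - 2)) =
      2 * D * (r / (r - 1)) * (N : ℝ) ^ ω := by rw [← hpow]; ring
  rw [h₂] at h₁
  nlinarith

theorem exists_solveTime_le {f : ℕ → ℕ} {ω : ℝ} (hω : 2 < ω)
    (hf : (fun n => (f n : ℝ)) =O[Filter.atTop] fun n => (n : ℝ) ^ ω) :
    ∃ B : ℝ, 0 < B ∧ ∀ n : ℕ, 1 ≤ n → (solveTime f n (3 * n) : ℝ) ≤ B * (n : ℝ) ^ ω := by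
  obtain ⟨A, hA, hf⟩ := exists_le_mul_rpow hf
  obtain ⟨B, hB, hm⟩ := exists_mainTime_le hω hA hf
  -- The factor `3 ^ ω` comes from layouts of length up to `3n`; the constant 200 covers the
  -- quadratic time for layout and extraction.
  refine ⟨B * 3 ^ ω + 200, by positivity, fun n hn => ?_⟩
  have h₁ := hm (3 * n) (by omega)
  have h₂ := sq_le_rpow hω hn
  have hn' : (1 : ℝ) ≤ n := by exact_mod_cast hn
  have h₃ : ((3 * n : ℕ) : ℝ) ^ ω = 3 ^ ω * (n : ℝ) ^ ω := by
    push_cast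
    exact Real.mul_rpow (by norm_num) (by positivity)
  rw [h₃] at h₁
  unfold solveTime
  push_cast
  nlinarith

/-- The function is bounded by a polynomial. -/
def PolyBounded (p : ℕ → ℕ) : Prop := ∃ a b, ∀ n, p n ≤ a * (n + 1) ^ b

/-! ### Polynomially bounded functions -/

namespace PolyBounded

variable {p q : ℕ → ℕ}

theorem const (k : ℕ) : PolyBounded fun _ => k := ⟨k, 0, fun n => by simp⟩

theorem id : PolyBounded fun n => n := ⟨1, 1, fun n => by simp⟩

theorem add (hp : PolyBounded p) (hq : PolyBounded q) : PolyBounded fun n => p n + q n := by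
  obtain ⟨a, b, h⟩ := hp
  obtain ⟨a', b', h'⟩ := hq
  refine ⟨a + a', b + b', fun n => ?_⟩
  rw [add_mul]
  exact Nat.add_le_add
    ((h n).trans (Nat.mul_le_mul_left _ (Nat.pow_le_pow_right (by omega) (by omega))))
    ((h' n).trans (Nat.mul_le_mul_left _ (Nat.pow_le_pow_right (by omega) (by omega))))

theorem mul (hp : PolyBounded p) (hq : PolyBounded q) : PolyBounded fun n => p n * q n := by
  obtain ⟨a, b, h⟩ := hp
  obtain ⟨a', b', h'⟩ := hq
  refine ⟨a * a', b + b', fun n => (Nat.mul_le_mul (h n) (h' n)).trans (le_of_eq ?_)⟩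
  rw [pow_add]; ring

theorem pow (hp : PolyBounded p) (k : ℕ) : PolyBounded fun n => p n ^ k := by
  induction k with
  | zero => exact const 1
  | succ k ih => simpa only [pow_succ] using ih.mul hp

theorem exists_le (hp : PolyBounded p) : ∃ c, ∀ n, p n ≤ c * (n + 1) ^ c := by
  obtain ⟨a, b, h⟩ := hp
  exact ⟨a + b, fun n => (h n).trans
    (Nat.mul_le_mul (by omega) (Nat.pow_le_pow_right (by omega) (by omega)))⟩

/-- The hypothesis is silent about `n = 0`, so `p 0` is added to the constant. -/
theorem of_le_rpow {B ω : ℝ} (h : ∀ n : ℕ, 1 ≤ n → (p n : ℝ) ≤ B * (n : ℝ) ^ ω) :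
    PolyBounded p := by
  refine ⟨p 0 + ⌈B⌉₊, ⌈ω⌉₊, fun n => ?_⟩
  rcases Nat.eq_zero_or_pos n with rfl | hn
  · simp
  have hn' : (1 : ℝ) ≤ n := by exact_mod_cast hn
  have h₁ : (n : ℝ) ^ ω ≤ ((n : ℝ) + 1) ^ ⌈ω⌉₊ :=
    calc (n : ℝ) ^ ω ≤ (n : ℝ) ^ (⌈ω⌉₊ : ℝ) :=
          Real.rpow_le_rpow_of_exponent_le hn' (Nat.le_ceil ω)
      _ = (n : ℝ) ^ ⌈ω⌉₊ := Real.rpow_natCast _ _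
      _ ≤ ((n : ℝ) + 1) ^ ⌈ω⌉₊ := by gcongr; linarith
  have h₂ : (p n : ℝ) ≤ (⌈B⌉₊ : ℝ) * ((n : ℝ) + 1) ^ ⌈ω⌉₊ :=
    calc (p n : ℝ) ≤ B * (n : ℝ) ^ ω := h n hn
      _ ≤ (⌈B⌉₊ : ℝ) * (n : ℝ) ^ ω := by gcongr; exact Nat.le_ceil B
      _ ≤ _ := by gcongr
  have h₃ : p n ≤ ⌈B⌉₊ * (n + 1) ^ ⌈ω⌉₊ := by exact_mod_cast h₂
  exact h₃.trans (Nat.mul_le_mul_right _ (by omega))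

end PolyBounded

end PAFP

namespace WordRAM

/-! ### Preparing the memory -/

/-- Multiply register 16 `k` times by register 14. -/
def powProg : ℕ → Prog
  | 0 => .skip
  | k + 1 => .seq (.arith .mul 16 16 14) (powProg k)

theorem powProg_exec {W m : ℕ} (hm : 1 ≤ m) (k : ℕ) (s : State) (h14 : s.reg 14 = m)
    (hW : s.reg 16 * m ^ k < W) :
    ∃ s', Exec W (powProg k) s (k + 1) s' ∧ s'.mem = s.mem ∧ s'.reg 16 = s.reg 16 * m ^ k ∧
      ∀ r, r ≠ 16 → s'.reg r = s.reg r := by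
  induction k generalizing s with
  | zero => exact ⟨s, .skip s, rfl, by simp, fun _ _ => rfl⟩
  | succ k ih =>
    have e : s.reg 16 * m ^ (k + 1) = s.reg 16 * m * m ^ k := by rw [pow_succ']; ring
    rw [e] at hW ⊢
    have h₁ : s.reg 16 * m ≤ s.reg 16 * m * m ^ k := Nat.le_mul_of_pos_right _ (by positivity)
    obtain ⟨s', hs', hmem, h16, hr⟩ := ih (s.setReg 16 (s.reg 16 * m))
      (by rw [setReg_ne _ _ (by simp), h14]) (by rwa [setReg_same])
    rw [setReg_same] at h16
    have := Exec.seq (exec_arith (W := W) (o := .mul) (r := 16) (a := 16) (b := 14)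
      (v := s.reg 16 * m) (by rw [Op.eval, h14]) (by omega)) hs'
    refine ⟨s', by rwa [Nat.add_comm 1] at this, hmem, h16, fun r h => ?_⟩
    rw [hr r h, setReg_ne _ _ h]

/-- Compute the sizes of the parts of the memory from the number in cell 0. -/
def sizesProg (c : ℕ) : Prog :=
  .seq (.load 12 2) <| .seq (.const 14 8) <| .seq (.arith .mul 4 14 12) <|
  .seq (.arith .add 4 4 14) <| .seq (.arith .mul 6 12 12) <| .seq (.arith .add 6 6 6) <|
  .seq (.const 14 3) <| .seq (.arith .add 6 14 6) <| .seq (.arith .mul 12 4 4) <|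
  .seq (.const 14 14) <| .seq (.arith .mul 10 14 12) <| .seq (.arith .add 10 6 10) <|
  .seq (.const 14 9) <| .seq (.arith .mul 8 14 12) <| .seq (.const 14 100) <|
  .seq (.arith .add 8 8 14) <| .seq (.const 14 1) <| .seq (.arith .add 14 4 14) <|
  .const 16 c

/-- Compute also the bound for all numbers. -/
def initProg (c : ℕ) : Prog :=
  .seq (sizesProg c) <| .seq (powProg c) (.arith .add 8 8 16)

/-- The bound for the numbers, for arrays of dimension `M`. -/
def sizeBound (c M : ℕ) : ℕ := 9 * (M * M) + 100 + c * (M + 1) ^ c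

/-- The exponent `c` is a constant of the program, so the power in `sizeBound` is computed by `c`
unrolled multiplications. -/
theorem initProg_exec {W n : ℕ} (c : ℕ) {input : List ℕ} (hn : input.getD 0 0 = n)
    (hW : 2 * (n * n) + 20 * ((8 * n + 8) * (8 * n + 8)) + 200 + c * (8 * n + 9) ^ c ≤ W) :
    ∃ s', Exec W (initProg c) (State.init input) (c + 21) s' ∧
      s'.mem = (State.init input).mem ∧ s'.reg 2 = 0 ∧ s'.reg 4 = 8 * n + 8 ∧
      s'.reg 6 = 3 + 2 * (n * n) ∧
      s'.reg 10 = 3 + 2 * (n * n) + 14 * ((8 * n + 8) * (8 * n + 8)) ∧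
      s'.reg 8 = sizeBound c (8 * n + 8) := by
  have h0 : (State.init input).mem 0 = n := hn
  have hMM : 8 * (8 * n + 8) ≤ (8 * n + 8) * (8 * n + 8) := Nat.mul_le_mul_right _ (by omega)
  have hc : c ≤ c * (8 * n + 9) ^ c := Nat.le_mul_of_pos_right _ (by positivity)
  have hr : ∀ r, (State.init input).reg r = 0 := fun _ => rfl
  generalize State.init input = s at h0 hr
  generalize hM : 8 * n + 8 = M at hW hMM ⊢
  generalize hX : M * M = X at hW hMM ⊢
  generalize hY : n * n = Y at hW ⊢
  have hW' : c * (M + 1) ^ c < W := by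
    rw [← hM]; exact Nat.lt_of_lt_of_le (Nat.lt_add_of_pos_left (by omega)) hW
  have hs₁ : ∃ s₁, Exec W (sizesProg c) s 19 s₁ ∧ s₁.mem = s.mem ∧ s₁.reg 2 = 0 ∧ s₁.reg 4 = M ∧
      s₁.reg 6 = 3 + 2 * Y ∧ s₁.reg 10 = 3 + 2 * Y + 14 * X ∧ s₁.reg 8 = 9 * X + 100 ∧
      s₁.reg 14 = M + 1 ∧ s₁.reg 16 = c := by
    refine ⟨_, .seq (.load s 12 2) <| .seq (.const _ 14 8 (by omega)) <|
        .seq (exec_arith (v := 8 * n) (by simp [Op.eval, setReg_same, setReg_ne, hr, h0])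
          (by omega)) <|
        .seq (exec_arith (v := M) (by simp [Op.eval, setReg_same, setReg_ne, hM]) (by omega)) <|
        .seq (exec_arith (v := Y) (by simp [Op.eval, setReg_same, setReg_ne, hr, h0, hY])
          (by omega)) <|
        .seq (exec_arith (v := 2 * Y) (by simp [Op.eval, setReg_same, two_mul])
          (by omega)) <|
        .seq (.const _ 14 3 (by omega)) <|
        .seq (exec_arith (v := 3 + 2 * Y) (by simp [Op.eval, setReg_same, setReg_ne])
          (by omega)) <|
        .seq (exec_arith (v := X) (by simp [Op.eval, setReg_same, setReg_ne, hX]) (by omega)) <|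
        .seq (.const _ 14 14 (by omega)) <|
        .seq (exec_arith (v := 14 * X) (by simp [Op.eval, setReg_same, setReg_ne])
          (by omega)) <|
        .seq (exec_arith (v := 3 + 2 * Y + 14 * X) (by simp [Op.eval, setReg_same, setReg_ne])
          (by omega)) <|
        .seq (.const _ 14 9 (by omega)) <|
        .seq (exec_arith (v := 9 * X) (by simp [Op.eval, setReg_same, setReg_ne])
          (by omega)) <|
        .seq (.const _ 14 100 (by omega)) <|
        .seq (exec_arith (v := 9 * X + 100) (by simp [Op.eval, setReg_same, setReg_ne])
          (by omega)) <|
        .seq (.const _ 14 1 (by omega)) <|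
        .seq (exec_arith (v := M + 1) (by simp [Op.eval, setReg_same, setReg_ne])
          (by omega)) <| .const _ 16 c (by omega), rfl, ?_, ?_, ?_, ?_, ?_, ?_, ?_⟩ <;>
      simp [setReg_same, setReg_ne, hr]
  obtain ⟨s₁, hE, hmem, h2, h4, h6, h10, h8, h14, h16⟩ := hs₁
  obtain ⟨s₂, hE₂, hmem₂, h16', hr₂⟩ := powProg_exec (W := W) (by omega) c s₁ h14 (by rwa [h16])
  have hle : 9 * X + 100 + c * (M + 1) ^ c < W := by
    rw [show 8 * n + 9 = M + 1 by omega] at hW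
    omega
  have := hE.seq (.seq hE₂ (exec_arith (o := .add) (r := 8) (a := 8) (b := 16)
    (v := 9 * X + 100 + c * (M + 1) ^ c)
    (by rw [Op.eval, h16', h16, hr₂ 8 (by simp), h8]) hle))
  refine ⟨s₂.setReg 8 (9 * X + 100 + c * (M + 1) ^ c),
    by rwa [show 19 + (c + 1 + 1) = c + 21 by omega] at this, hmem₂.trans hmem, ?_, ?_,
    ?_, ?_, ?_⟩
  · rw [setReg_ne _ _ (by simp), hr₂ 2 (by simp), h2]
  · rw [setReg_ne _ _ (by simp), hr₂ 4 (by simp), h4]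
  · rw [setReg_ne _ _ (by simp), hr₂ 6 (by simp), h6]
  · rw [setReg_ne _ _ (by simp), hr₂ 10 (by simp), h10]
  · rw [setReg_same, sizeBound, hX]

/-- Write the length and the address of the output into registers 0 and 1. -/
def outProg : Prog :=
  .seq (.const 12 6) <| .seq (.arith .add 12 6 12) <| .seq (.load 0 12) <| .seq (.const 12 3) <|
  .seq (.arith .add 12 6 12) <| .seq (.load 12 12) <| .seq (.const 14 13) <|
  .seq (.arith .mul 14 14 4) <| .seq (.arith .mul 14 14 4) <| .seq (.arith .add 14 6 14) <|
    .arith .add 1 14 12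

/-- The cells 3 and 6 of row 0 of array 0 are at `H + 3` and `H + 6`; row 0 of array 13, with the
path, starts at `H + 13 * M * M`. -/
theorem outProg_exec {W H M o k : ℕ} {s : State} (h4 : s.reg 4 = M) (h6 : s.reg 6 = H)
    (hk : s.mem (H + 6) = k) (ho : s.mem (H + 3) = o) (hM : 1 ≤ M) (hoM : o ≤ M)
    (hW : H + 14 * M * M + 20 ≤ W) :
    ∃ s', Exec W outProg s 11 s' ∧ s'.mem = s.mem ∧ s'.reg 0 = k ∧
      s'.reg 1 = H + 13 * M * M + o := by
  have hMM : M ≤ M * M := Nat.le_mul_of_pos_right _ (by omega)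
  simp only [mul_assoc] at hW ⊢
  refine ⟨_, .seq (.const s 12 6 (by omega)) <|
    .seq (exec_arith (v := H + 6) (by simp [Op.eval, setReg_same, setReg_ne, h6]) (by omega)) <|
    .seq (.load _ 0 12) <| .seq (.const _ 12 3 (by omega)) <|
    .seq (exec_arith (v := H + 3) (by simp [Op.eval, setReg_same, setReg_ne, h6]) (by omega)) <|
    .seq (.load _ 12 12) <| .seq (.const _ 14 13 (by omega)) <|
    .seq (exec_arith (v := 13 * M) (by simp [Op.eval, setReg_same, setReg_ne, h4]) (by omega)) <|
    .seq (exec_arith (v := 13 * (M * M))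
      (by simp [Op.eval, setReg_same, setReg_ne, h4, mul_assoc]) (by omega)) <|
    .seq (exec_arith (v := H + 13 * (M * M))
      (by simp [Op.eval, setReg_same, setReg_ne, h6]) (by omega)) <|
    exec_arith (v := H + 13 * (M * M) + o) ?_ (by omega), ?_, ?_, ?_⟩
  · simp only [Op.eval, setReg_same, setReg_ne, ne_eq, not_false_eq_true,
      Nat.reduceEqDiff]
    congr 1
  · rfl
  · simp [State.setReg, hk]
  · simp [setReg_same]

end WordRAM

namespace PAFP

open WordRAM PAFP.Graph

/-! ### Instances as graphs -/

/-- The graph of an instance. -/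
def Instance.graph (I : Instance) (hI : I.WellParenthesized) : Graph where
  n := I.n
  adj u v := ∃ (hu : u < I.n) (hv : v < I.n), I.adj ⟨u, hu⟩ ⟨v, hv⟩ = true
  forb u v := ∃ (hu : u < I.n) (hv : v < I.n), I.forb ⟨u, hu⟩ ⟨v, hv⟩ = true
  adj_lt := fun _ _ ⟨_, hv, h⟩ => ⟨I.adj_lt _ _ h, hv⟩
  forb_lt := fun _ _ ⟨_, hv, h⟩ => ⟨I.forb_lt _ _ h, hv⟩
  not_halving := fun _ _ _ _ ⟨_, _, h⟩ ⟨_, _, h'⟩ => hI _ _ _ _ h h'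

section

variable {I : Instance} {hI : I.WellParenthesized}

theorem walk_graph_iff {u v : Fin I.n} {l : List ℕ} :
    (I.graph hI).Walk u v l ↔ ∃ l' : List (Fin I.n), (l'.IsChain fun u v => I.adj u v = true) ∧
      l'.head? = some u ∧ l'.getLast? = some v ∧ l = l'.map Fin.val := by
  constructor
  -- The ends are generalized to natural numbers, since the inner vertices of a walk are not given
  -- as elements of `Fin I.n`.
  · have key : ∀ (u' v' : ℕ) (l : List ℕ), (I.graph hI).Walk u' v' l → ∀ u v : Fin I.n,
        u' = u → v' = v → ∃ l' : List (Fin I.n), (l'.IsChain fun u v => I.adj u v = true) ∧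
          l'.head? = some u ∧ l'.getLast? = some v ∧ l = l'.map Fin.val := by
      intro u' v' l h
      induction h with
      | single u' =>
        rintro u v rfl huv
        obtain rfl : u = v := Fin.ext huv
        exact ⟨[u], by simp, by simp, by simp, by simp⟩
      | @cons u' w v' l h _ ih =>
        rintro u v rfl rfl
        obtain ⟨hu, hw, hadj⟩ := h
        obtain ⟨l', h₁, h₂, h₃, rfl⟩ := ih ⟨w, hw⟩ v rfl rfl
        cases l' with
        | nil => simp at h₂
        | cons x l' =>
          simp only [List.head?_cons, Option.some.injEq] at h₂
          subst h₂
          exact ⟨u :: ⟨w, hw⟩ :: l', List.isChain_cons_cons.2 ⟨hadj, h₁⟩, rfl, by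
            rw [List.getLast?_cons_cons]; exact h₃, rfl⟩
    exact fun h => key _ _ _ h u v rfl rfl
  · rintro ⟨l', h₁, h₂, h₃, rfl⟩
    induction l' generalizing u with
    | nil => simp at h₂
    | cons x l' ih =>
      simp only [List.head?_cons, Option.some.injEq] at h₂
      subst h₂
      cases l' with
      | nil =>
        simp only [List.getLast?_singleton, Option.some.injEq] at h₃
        subst h₃
        exact .single _
      | cons y l' =>
        rw [List.isChain_cons_cons] at h₁
        rw [List.getLast?_cons_cons] at h₃
        exact .cons ⟨x.2, y.2, h₁.1⟩ (ih (u := y) h₁.2 rfl h₃)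

theorem safeWalk_graph_iff {l : List ℕ} :
    (I.graph hI).SafeWalk I.s I.t 0 l ↔
      ∃ l' : List (Fin I.n), I.IsPath l' ∧ I.Safe l' ∧ l = l'.map Fin.val := by
  constructor
  · rintro ⟨hw, hs⟩
    obtain ⟨l', h₁, h₂, h₃, rfl⟩ := walk_graph_iff.1 hw
    refine ⟨l', ⟨h₁, h₂, h₃⟩, fun u v huv ⟨hu, hv⟩ => ?_, rfl⟩
    have := hs u v ⟨u.2, v.2, huv⟩ (List.mem_map_of_mem hu) (List.mem_map_of_mem hv)
    omega
  · rintro ⟨l', ⟨h₁, h₂, h₃⟩, hs, rfl⟩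
    refine ⟨walk_graph_iff.2 ⟨l', h₁, h₂, h₃, rfl⟩, fun a b ⟨ha, hb, hab⟩ ha' hb' => ?_⟩
    have mem : ∀ {x : ℕ} (hx : x < I.n), x ∈ l'.map Fin.val → (⟨x, hx⟩ : Fin I.n) ∈ l' := by
      intro x hx h
      obtain ⟨y, hy, rfl⟩ := List.mem_map.1 h
      exact hy
    exact absurd ⟨mem ha ha', mem hb hb'⟩ (hs _ _ hab)

theorem correct_of_graph {L : List ℕ} (h : (I.graph hI).Correct I.s I.t L) :
    wellParenthesizedPAFP.Correct ⟨I, hI⟩ L := by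
  rcases h with h | ⟨rfl, h⟩
  · exact Or.inl (safeWalk_graph_iff.1 h)
  · exact Or.inr ⟨fun ⟨l, h₁, h₂⟩ => h ⟨_, safeWalk_graph_iff.2 ⟨l, h₁, h₂, rfl⟩⟩, rfl⟩

end

end PAFP

/-! ### Assembling the program for an instance -/

namespace PAFP

open WordRAM PAFP.Graph

section

variable {I : Instance} (hI : I.WellParenthesized)

/-- The sizes of the parts of the memory for an instance. -/
def context (c : ℕ) : Ctx where
  inp i := (wellParenthesizedPAFP.input ⟨I, hI⟩).getD i 0
  M := 8 * I.n + 8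
  Z := sizeBound c (8 * I.n + 8)
  H := 3 + 2 * (I.n * I.n)
  K := 14

theorem context_large (c : ℕ) : (context hI c).Large where
  K := rfl
  M := by simp only [context]; omega
  Z := by simp only [context, sizeBound]; omega

theorem input_adj {u v : ℕ} (hu : u < I.n) (hv : v < I.n) :
    (wellParenthesizedPAFP.input ⟨I, hI⟩).getD (3 + (u * I.n + v)) 0 =
      (I.adj ⟨u, hu⟩ ⟨v, hv⟩).toNat := by
  have h := index_lt hu hv
  rw [Nat.add_comm 3]
  simp only [wellParenthesizedPAFP, List.getD_cons_succ]
  rw [List.getD_append _ _ _ _ (by rwa [encodeMatrix_length]), encodeMatrix_getD]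

theorem input_forb {u v : ℕ} (hu : u < I.n) (hv : v < I.n) :
    (wellParenthesizedPAFP.input ⟨I, hI⟩).getD (3 + (I.n * I.n + (u * I.n + v))) 0 =
      (I.forb ⟨u, hu⟩ ⟨v, hv⟩).toNat := by
  rw [Nat.add_comm 3]
  simp only [wellParenthesizedPAFP, List.getD_cons_succ]
  rw [List.getD_append_right _ _ _ _ (by rw [encodeMatrix_length]; omega), encodeMatrix_length,
    Nat.add_sub_cancel_left, encodeMatrix_getD]

theorem input_length : (wellParenthesizedPAFP.input ⟨I, hI⟩).length = 3 + 2 * (I.n * I.n) := by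
  simp only [wellParenthesizedPAFP, List.length_cons, List.length_append, encodeMatrix_length]
  omega

theorem input_getD_le (i : ℕ) : (wellParenthesizedPAFP.input ⟨I, hI⟩).getD i 0 ≤ I.n := by
  have hs := I.s.2
  have ht := I.t.2
  have key : ∀ x ∈ wellParenthesizedPAFP.input ⟨I, hI⟩, x ≤ I.n := by
    intro x hx
    simp only [wellParenthesizedPAFP, List.mem_cons, List.mem_append] at hx
    rcases hx with rfl | rfl | rfl | hx | hx
    · exact le_rfl
    · omega
    · omega
    · have := encodeMatrix_le_one _ x hx; omega
    · have := encodeMatrix_le_one _ x hx; omega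
  rcases Nat.lt_or_ge i (wellParenthesizedPAFP.input ⟨I, hI⟩).length with h | h
  · rw [List.getD_eq_getElem _ _ h]
    exact key _ (List.getElem_mem h)
  · rw [List.getD_eq_default _ _ h]
    exact Nat.zero_le _

theorem context_rep (c : ℕ) : Rep (context hI c) (I.graph hI) where
  large := context_large hI c
  dim := rfl
  length := rfl
  inp_n := rfl
  adj u hu v hv := by
    have e : (context hI c).inp (3 + (u * I.n + v)) = _ := input_adj hI hu hv
    have hu' : u < I.n := hu
    have hv' : v < I.n := hv
    show (context hI c).inp (3 + (u * I.n + v)) ≤ 1 ∧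
      ((context hI c).inp (3 + (u * I.n + v)) = 1 ↔ _)
    rw [e]
    exact ⟨Bool.toNat_le _, by simp [Instance.graph, hu', hv']⟩
  forb u hu v hv := by
    have e : (context hI c).inp (3 + (I.n * I.n + (u * I.n + v))) = _ := input_forb hI hu hv
    have hu' : u < I.n := hu
    have hv' : v < I.n := hv
    show (context hI c).inp (3 + (I.n * I.n + (u * I.n + v))) ≤ 1 ∧
      ((context hI c).inp (3 + (I.n * I.n + (u * I.n + v))) = 1 ↔ _)
    rw [e]
    exact ⟨Bool.toNat_le _, by simp [Instance.graph, hu', hv']⟩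

theorem le_sizeBound (c M : ℕ) : M ≤ sizeBound c M := by
  have : M ≤ M * M + 1 := by nlinarith
  unfold sizeBound
  omega

/-- All memory behind the input is zero at the start. This serves at once as empty arrays, as a
clean scratch array, and as the supply of clean windows for later calls. -/
theorem context_sim (c : ℕ) {s : State}
    (hmem : s.mem = (State.init (wellParenthesizedPAFP.input ⟨I, hI⟩)).mem) (h2 : s.reg 2 = 0)
    (h4 : s.reg 4 = 8 * I.n + 8) (h6 : s.reg 6 = 3 + 2 * (I.n * I.n))
    (h10 : s.reg 10 = 3 + 2 * (I.n * I.n) + 14 * ((8 * I.n + 8) * (8 * I.n + 8)))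
    (h8 : s.reg 8 = sizeBound c (8 * I.n + 8)) :
    Sim (context hI c) [] ⟨fun _ _ _ => 0, fun _ => 0⟩ s := by
  have hlen := input_length hI
  have hZ := le_sizeBound c (8 * I.n + 8)
  have zero : ∀ i, 3 + 2 * (I.n * I.n) ≤ i → s.mem i = 0 := fun i hi => by
    rw [hmem]
    exact List.getD_eq_default _ _ (by rwa [hlen])
  refine ⟨h2, h4, h6, h8, ?_, fun i hi => absurd hi (by simp), fun i hi => ⟨by rw [hmem]; rfl, ?_⟩,
    fun k hk i hi j hj => ⟨zero _ ?_, ?_⟩, fun i hi => zero _ ?_, fun i hi => zero _ ?_⟩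
  · rw [h10]
    simp only [context, mul_assoc]
    exact le_rfl
  · have := input_getD_le hI i
    simp only [context]
    omega
  · simp only [context]; omega
  · simp only [context]; omega
  · rw [h10]; omega
  · rw [h10] at hi; omega

/-- The scratch length contains the term `c * (M + 1) ^ c`, which dominates the word bound of the
multiplication program for every dimension `b ≤ M`; the quadratic term has room for the input and
the output. -/
theorem context_mulSpec {c : ℕ} {fm : ℕ → ℕ} {mp : Prog}
    (hmul : ∀ x : MatrixPair, ∃ (t : ℕ) (s' : State),
      Exec (c * (x.n + 1) ^ c) mp (State.init (booleanMatrixMultiplication.input x)) t s' ∧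
      t ≤ fm x.n ∧ booleanMatrixMultiplication.Correct x s'.output) :
    MulSpec (context hI c) fm mp := by
  intro b hb A B
  obtain ⟨t, s', h₁, h₂, h₃⟩ := hmul ⟨b, A, B⟩
  refine ⟨_, t, s', h₁, h₂, h₃, ?_⟩
  have hb : b ≤ 8 * I.n + 8 := hb
  show c * (b + 1) ^ c + b + 2 + b * b ≤ sizeBound c (8 * I.n + 8)
  generalize 8 * I.n + 8 = M at hb
  have h₄ : c * (b + 1) ^ c ≤ c * (M + 1) ^ c :=
    Nat.mul_le_mul_left _ (Nat.pow_le_pow_left (by omega) _)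
  have h₅ : b * b ≤ M * M := Nat.mul_le_mul hb hb
  have h₆ : b ≤ b * b + 1 := by nlinarith
  unfold sizeBound
  omega

theorem output_eq {C : Ctx} {L : List ℕ} {st : Store} {s : State} (hC : C.Large)
    (hs : Sim C [] st s) (hL : Output C.M L st) {s' : State} (hmem : s'.mem = s.mem)
    (h0 : s'.reg 0 = L.length) (h1 : s'.reg 1 = C.H + 13 * C.M * C.M + st.arr 0 0 3) :
    s'.output = L := by
  obtain ⟨-, hle, hent⟩ := hL
  have hM := hC.M
  refine List.ext_getElem (by simp [State.output, h0]) fun i h₁ h₂ => ?_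
  have := (hs.arr 13 (by rw [hC.K]; omega) 0 (by omega) (st.arr 0 0 3 + i) (by omega)).1
  rw [hent i h₂, List.getD_eq_getElem _ _ h₂, add_zero] at this
  simp only [State.output, List.getElem_map, List.getElem_range, h1, hmem]
  rw [← this]
  congr 1
  omega

/-- The complete program, where `mp` is a program for matrix multiplication whose numbers are
bounded by a polynomial with parameter `c`. -/
def solveProg (mp : Prog) (c : ℕ) : Prog :=
  .seq (initProg c) <| .seq (solve.compile mp 0) outProg

/-- The sum of the lower bounds for the word bound. -/
def wordBound (fm : ℕ → ℕ) (c n : ℕ) : ℕ :=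
  (2 * (n * n) + 20 * ((8 * n + 8) * (8 * n + 8)) + 200 + c * (8 * n + 9) ^ c) +
    sizeBound c (8 * n + 8) ^ solve.size +
    (3 + 2 * (n * n) + 14 * ((8 * n + 8) * (8 * n + 8)) +
      (solveTime fm n (3 * n) + 1) * sizeBound c (8 * n + 8))

theorem solveProg_exec {c W : ℕ} {fm : ℕ → ℕ} {mp : Prog}
    (hmul : ∀ x : MatrixPair, ∃ (t : ℕ) (s' : State),
      Exec (c * (x.n + 1) ^ c) mp (State.init (booleanMatrixMultiplication.input x)) t s' ∧
      t ≤ fm x.n ∧ booleanMatrixMultiplication.Correct x s'.output)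
    (hW : wordBound fm c I.n ≤ W) :
    ∃ t s', Exec W (solveProg mp c) (State.init (wellParenthesizedPAFP.input ⟨I, hI⟩)) t s' ∧
      t ≤ solve.cost mp * solveTime fm I.n (3 * I.n) + (c + 32) ∧
      wellParenthesizedPAFP.Correct ⟨I, hI⟩ s'.output := by
  unfold wordBound at hW
  have hM := le_sizeBound c (8 * I.n + 8)
  have hl := context_large hI c
  obtain ⟨hlK, hlZ, hlM⟩ := id hl
  obtain ⟨s₁, hE₁, hmem₁, h2, h4, h6, h10, h8⟩ :=
    initProg_exec (W := W) (n := I.n) c (input := wellParenthesizedPAFP.input ⟨I, hI⟩) rfl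
      (by omega)
  have hsim := context_sim hI c hmem₁ h2 h4 h6 h10 h8
  have hst : Holds 0 (fun _ => 0) (fun _ => 0) (fun _ => 0) ⟨fun _ _ _ => 0, fun _ => 0⟩ :=
    ⟨rfl, rfl, rfl, rfl, rfl, fun _ _ _ _ => rfl⟩
  have hrun := solve_run (context_rep hI c) fm hst (s := I.s) (t := I.t) I.s.2 I.t.2 rfl rfl
  obtain ⟨t, s₂, st, hE₂, ht, hsim₂, ⟨L, hcor, hout⟩, -⟩ :=
    Stmt.compile_exec (W := W) (by omega) (by omega)
      (context_mulSpec hI hmul) solve _ _ _ _ s₁ hsim hrun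
      (show sizeBound c (8 * I.n + 8) ^ solve.size ≤ W by omega)
      (show s₁.reg 10 + (solveTime fm I.n (3 * I.n) + 1) * sizeBound c (8 * I.n + 8) ≤ W by
        rw [h10]; omega)
  have e6 := (hsim₂.arr 0 (by rw [hl.K]; omega) 0 (by omega) 6 (by omega)).1
  have e3 := (hsim₂.arr 0 (by rw [hl.K]; omega) 0 (by omega) 3 (by omega)).1
  simp only [zero_mul, zero_add] at e6 e3
  obtain ⟨s₃, hE₃, hmem₃, h0, h1⟩ := outProg_exec (W := W) hsim₂.dim hsim₂.start e6 e3
    (by omega) (by have := hout.2.1; omega) (by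
      simp only [context, mul_assoc]; omega)
  refine ⟨_, s₃, .seq hE₁ (.seq hE₂ hE₃), ?_, ?_⟩
  · have : t ≤ solve.cost mp * solveTime fm I.n (3 * I.n) := ht
    omega
  · rw [output_eq hl hsim₂ hout hmem₃ (h0.trans hout.1) h1]
    exact correct_of_graph hcor

end

theorem polyBounded_wordBound {fm : ℕ → ℕ} (c : ℕ)
    (h : PolyBounded fun n => solveTime fm n (3 * n)) : PolyBounded (wordBound fm c) := by
  have lin : ∀ a b, PolyBounded fun n => a * n + b := fun a b =>
    ((PolyBounded.const a).mul .id).add (.const b)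
  have hX : PolyBounded fun n => (8 * n + 8) * (8 * n + 8) := (lin 8 8).mul (lin 8 8)
  have hY : PolyBounded fun n => 2 * (n * n) :=
    (PolyBounded.const 2).mul (PolyBounded.id.mul .id)
  have hpow : PolyBounded fun n => c * (8 * n + 9) ^ c :=
    (PolyBounded.const c).mul ((lin 8 9).pow c)
  have hZ : PolyBounded fun n => sizeBound c (8 * n + 8) :=
    (((PolyBounded.const 9).mul hX).add (.const 100)).add hpow
  exact (((((hY.add ((PolyBounded.const 20).mul hX)).add (.const 200)).add hpow)).add
    (hZ.pow _)).add ((((PolyBounded.const 3).add hY).add ((PolyBounded.const 14).mul hX)).add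
    ((h.add (.const 1)).mul hZ))

end PAFP

theorem mainTheorem2 (ω : ℝ) (hω : 2 < ω)
    (hmul : WordRAM.booleanMatrixMultiplication.SolvableInTime (fun n => (n : ℝ) ^ ω)) :
    PAFP.wellParenthesizedPAFP.SolvableInTime (fun n => (n : ℝ) ^ ω) := by
  obtain ⟨mp, c, fm, hfm, hmul⟩ := hmul
  obtain ⟨B, hB, hT⟩ := PAFP.exists_solveTime_le hω hfm
  -- The required word bound involves the running time, because each call takes new memory. It is
  -- polynomial because the time is.
  obtain ⟨c', hc'⟩ := (PAFP.polyBounded_wordBound c (.of_le_rpow hT)).exists_le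
  refine ⟨PAFP.solveProg mp c, c', fun n =>
    PAFP.solve.cost mp * PAFP.solveTime fm n (3 * n) + (c + 32), ?_, ?_⟩
  · refine Asymptotics.IsBigO.of_bound (PAFP.solve.cost mp * B + (c + 32)) ?_
    filter_upwards [Filter.eventually_ge_atTop 1] with n hn
    have h₁ := hT n hn
    have hn' : (1 : ℝ) ≤ n := by exact_mod_cast hn
    have h₂ : (1 : ℝ) ≤ (n : ℝ) ^ ω := Real.one_le_rpow hn' (by linarith)
    rw [Real.norm_of_nonneg (Nat.cast_nonneg _), Real.norm_of_nonneg (by linarith)]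
    push_cast
    calc _ ≤ (PAFP.solve.cost mp : ℝ) * (B * (n : ℝ) ^ ω) + (c + 32) * (n : ℝ) ^ ω := by
          gcongr
          exact le_mul_of_one_le_right (by positivity) h₂
      _ = _ := by ring
  · rintro ⟨I, hI⟩
    exact PAFP.solveProg_exec hI hmul (hc' I.n)
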